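/- Let $T=[0,2\pi]$. For a sequence $\Lambda=\{\lambda_n\}_{n\ge1}$ of positive numbers, a real function $f(x,y)$ that is $2\pi$-periodic in each variable belongs to $P\Lambda BV$ (bounded partial $\Lambda$-variation) if $$\sup_{y\in T}\ \sup_{\{I_i\}}\sum_i\frac{|f(b_i,y)-f(a_i,y)|}{\lambda_i}+\sup_{x\in T}\ \sup_{\{I_i\}}\sum_i\frac{|f(x,b_i)-f(x,a_i)|}{\lambda_i}<\infty ,$$ where $\{I_i\}=\{(a_i,b_i)\}_{i\ge1}$ runs over all collections of nonoverlapping intervals of $T$, ordered in an arbitrary way. For $f\in L^1(T^2)$ let $$\widehat f(k,l)=\frac1{4\pi^2}\int_{T^2} f(x,y)e^{-ikx}e^{-ily}\,dx\,dy,\qquad S_{M,N}[f,(x,y)]=\sum_{k=-M}^{M}\sum_{l=-N}^{N}\widehat f(k,l)e^{ikx}e^{ily},$$ and for $a,b>-1$ let the Cesàro $(C;a,b)$ means of the double Fourier series of $f$ be $$\sigma^{a,b}_{n,m}f(x,y)=\frac1{A^{a}_nA^{b}_m}\sum_{i=0}^n\sum_{j=0}^m A^{a-1}_{n-i}A^{b-1}_{m-j}\,S_{i,j}[f,(x,y)],\qquad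 A^{a}_0=1,\quad A^{a}_k=\frac{(a+1)\cdots(a+k)}{k!}.$$ Denote by $f(x\pm0,y\pm0)$ the four limits of $f$ at $(x,y)$ along the open coordinate quadrants, and by $\sum f(x\pm0,y\pm0)$ their sum. Let $\alpha,\beta\in(0,1)$ with $\alpha+\beta<1$. (a) Let $f\in L^1(T^2)$ be $2\pi$-periodic in each variable and let $f\in P\left\{\frac{n^{1-(\alpha+\beta)}}{\log^{1+\varepsilon}(n+1)}\right\}BV$ for some $\varepsilon>0$. Then at every point $(x,y)$ where the four quadrant limits exist, $$\lim_{n,m\to\infty}\sigma^{-\alpha,-\beta}_{n,m}f(x,y)=\tfrac14\sum f(x\pm0,y\pm0)$$ ($n$ and $m$ tending to infinity independently). Moreover, $\sigma^{-\alpha,-\beta}_{n,m}f\to f$ as $n,m\to\infty$ uniformly on every compact set $K\subset\mathbb R^2$ such that $f$ is continuous at every point of $K$. (b) There exists a continuous function $f$ on $\mathbb R^2$, $2\pi$-periodic in each variable, with $f\in P\left\{\frac{n^{1-(\alpha+\beta)}}{\log(n+1)}\right\}BV$, such that the $(C;-\alpha,-\beta)$ means of its double Fourier series diverge over cubes at $(0,0)$,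 i.e. the sequence $\sigma^{-\alpha,-\beta}_{N,N}f(0,0)$, $N=1,2,\dots$, does not converge. -/

import Mathlib

open Set Filter Topology MeasureTheory
open scoped Nat ENNReal

noncomputable section

namespace CesaroNeg

/-- `f` is `2π`-periodic with respect to each of its two variables. -/
def IsBiperiodic (f : ℝ × ℝ → ℝ) : Prop :=
  ∀ x y : ℝ, f (x + 2 * Real.pi, y) = f (x, y) ∧ f (x, y + 2 * Real.pi) = f (x, y)

/-- The square `T² = [0, 2π] × [0, 2π]`. -/
def square : Set (ℝ × ℝ) := Icc 0 (2 * Real.pi) ×ˢ Icc 0 (2 * Real.pi)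

/-- A finite ordered collection of pairwise nonoverlapping (nondegenerate) intervals
`(a i, b i)`, `i < n`, contained in `T = [0, 2π]`; the order is arbitrary. -/
structure IntervalCollection where
  n : ℕ
  a : Fin n → ℝ
  b : Fin n → ℝ
  zero_le : ∀ i, 0 ≤ a i
  lt : ∀ i, a i < b i
  le_two_pi : ∀ i, b i ≤ 2 * Real.pi
  nonoverlapping : ∀ i j, i ≠ j → Disjoint (Ioo (a i) (b i)) (Ioo (a j) (b j))

/-- The `Λ`-variation on `T` of a function `g` of one variable, `Λ = {lam 1, lam 2, …}`: the supremum of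
`∑ i, |g (b i) - g (a i)| / lam i` over all ordered collections of nonoverlapping intervals.
The first interval of a collection gets the weight `1 / lam 1`, and so on; `lam 0` is not used.
(Infinite sequences of intervals give the same supremum, as the terms are nonnegative.) -/
def lambdaVar (lam : ℕ → ℝ) (g : ℝ → ℝ) : ℝ≥0∞ :=
  ⨆ E : IntervalCollection,
    ∑ i : Fin E.n, ENNReal.ofReal (|g (E.b i) - g (E.a i)| / lam ((i : ℕ) + 1))

/-- `ΛV₁(f)`: the supremum over `y ∈ T` of the `Λ`-variation in the first variable. -/
def lambdaVar₁ (lam : ℕ → ℝ) (f : ℝ × ℝ → ℝ) : ℝ≥0∞ :=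
  ⨆ y ∈ Icc (0 : ℝ) (2 * Real.pi), lambdaVar lam (fun x => f (x, y))

/-- `ΛV₂(f)`: the supremum over `x ∈ T` of the `Λ`-variation in the second variable. -/
def lambdaVar₂ (lam : ℕ → ℝ) (f : ℝ × ℝ → ℝ) : ℝ≥0∞ :=
  ⨆ x ∈ Icc (0 : ℝ) (2 * Real.pi), lambdaVar lam (fun y => f (x, y))

/-- `f ∈ PΛBV`: the function `f` has bounded partial `Λ`-variation. -/
def MemPLambdaBV (lam : ℕ → ℝ) (f : ℝ × ℝ → ℝ) : Prop :=
  lambdaVar₁ lam f + lambdaVar₂ lam f < ∞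

/-- The Fourier coefficient
`(1 / 4π²) ∫_{T²} f(x, y) e^{-imx} e^{-iny} dx dy`. -/
def fourierCoeff₂ (f : ℝ × ℝ → ℝ) (m n : ℤ) : ℂ :=
  (1 / (4 * (Real.pi : ℂ) ^ 2)) *
    ∫ p in square, (f p : ℂ) * Complex.exp (-(Complex.I * m * p.1)) *
      Complex.exp (-(Complex.I * n * p.2))

/-- The rectangular partial sum `S_{M,N}[f, (x, y)]` of the double Fourier series. -/
def rectPartialSum (f : ℝ × ℝ → ℝ) (M N : ℕ) (p : ℝ × ℝ) : ℂ :=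
  ∑ m ∈ Finset.Icc (-(M : ℤ)) M, ∑ n ∈ Finset.Icc (-(N : ℤ)) N,
    fourierCoeff₂ f m n * Complex.exp (Complex.I * m * p.1) *
      Complex.exp (Complex.I * n * p.2)

/-- The Cesàro number `A_k^a = (a + 1) ⋯ (a + k) / k!`, with `A_0^a = 1`. -/
def cesaroNumber (a : ℝ) (k : ℕ) : ℝ :=
  (∏ j ∈ Finset.range k, (a + ((j : ℝ) + 1))) / (k ! : ℝ)

/-- The Cesàro `(C; a, b)` mean `σ_{n,m}^{a,b} f(x, y)` of the double Fourier series of `f`. -/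
def cesaroMean (a b : ℝ) (f : ℝ × ℝ → ℝ) (n m : ℕ) (p : ℝ × ℝ) : ℂ :=
  (1 / (cesaroNumber a n : ℂ)) * (1 / (cesaroNumber b m : ℂ)) *
    ∑ i ∈ Finset.range (n + 1), ∑ j ∈ Finset.range (m + 1),
      (cesaroNumber (a - 1) (n - i) : ℂ) * (cesaroNumber (b - 1) (m - j) : ℂ) *
        rectPartialSum f i j p

/-- The four open coordinate quadrant limits `f(x+0, y+0)`, `f(x+0, y-0)`, `f(x-0, y+0)`,
`f(x-0, y-0)` exist (as finite numbers) and equal `pp`, `pm`, `mp`, `mm` respectively. -/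
def HasQuadrantLimits (f : ℝ × ℝ → ℝ) (x y pp pm mp mm : ℝ) : Prop :=
  Tendsto f (𝓝[>] x ×ˢ 𝓝[>] y) (𝓝 pp) ∧ Tendsto f (𝓝[>] x ×ˢ 𝓝[<] y) (𝓝 pm) ∧
    Tendsto f (𝓝[<] x ×ˢ 𝓝[>] y) (𝓝 mp) ∧ Tendsto f (𝓝[<] x ×ˢ 𝓝[<] y) (𝓝 mm)

end CesaroNeg

end

/-!
The Cesàro mean at `(x, y)` is an integral of `f` against a product of two kernels of orders `-α`
and `-β`, which folds into four integrals over `(0, π)²`, one per quadrant. At `t ≥ 1 / n` the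
kernel of order `-α` has size `n * (n t) ^ (α - 1)` and oscillates with frequency
`n + (1 - α) / 2`. Cutting `(0, π)` into cells of length `π / n` and summing the tail integrals of
the kernel by parts, one writes the integral against it as an average of functionals consisting of
a point evaluation and increments over intervals of length at most `π / n`, the `i`-th with a
coefficient `O(i ^ (α - 1))`. In two variables this gives double sums of
`i ^ (α - 1) * j ^ (β - 1) * |Δ i j|`. In the part `j ≤ i` the variation in the first variable
bounds the sum over `i` by `j ^ (-β) / log ^ p j`, leaving `∑ 1 / (j * log ^ p j)`, which
converges for `p > 1`; the part `i ≤ j` is symmetric. The terms with `i, j < R` are evaluated near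
the corner of the quadrant, where `f` is close to its limit.

For the counterexample, products of waves in phase with the kernels of index `2 ^ m`, one on each
dyadic square `[2 ^ (k - m), 2 ^ (k + 1 - m)]²` and with coefficient `2 ^ (-(α + β) k) / k`,
contribute about `1 / k` each to the mean at the origin. The means add up to a partial sum of the
harmonic series, while the variations stay bounded. The uniform boundedness principle on `ℓ¹` then
yields an absolutely convergent superposition of these functions whose means are unbounded.
-/

noncomputable section

namespace CesaroNeg

open scoped Real
open Complex (I)

/-! ### Cesàro numbers -/

lemma cesaroNumber_zero (a : ℝ) : cesaroNumber a 0 = 1 := by simp [cesaroNumber]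

lemma cesaroNumber_succ (a : ℝ) (k : ℕ) :
    cesaroNumber a (k + 1) = (a + k + 1) / (k + 1) * cesaroNumber a k := by
  have hk : (k ! : ℝ) ≠ 0 := by positivity
  simp only [cesaroNumber, Finset.prod_range_succ, Nat.factorial_succ]
  push_cast
  field_simp
  ring

lemma cesaroNumber_sub_one_succ (a : ℝ) (k : ℕ) :
    cesaroNumber (a - 1) (k + 1) = a / (k + 1) * cesaroNumber a k := by
  induction k with
  | zero => simp [cesaroNumber_succ, cesaroNumber_zero]
  | succ k ih =>
    rw [cesaroNumber_succ, ih, cesaroNumber_succ]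
    push_cast
    field_simp
    ring

lemma cesaroNumber_succ_sub (a : ℝ) (k : ℕ) :
    cesaroNumber a (k + 1) - cesaroNumber a k = cesaroNumber (a - 1) (k + 1) := by
  rw [cesaroNumber_succ, cesaroNumber_sub_one_succ]
  field_simp
  ring

lemma sum_cesaroNumber_sub_one (a : ℝ) (n : ℕ) :
    ∑ j ∈ Finset.range (n + 1), cesaroNumber (a - 1) j = cesaroNumber a n := by
  induction n with
  | zero => simp [cesaroNumber_zero]
  | succ n ih => rw [Finset.sum_range_succ, ih, ← cesaroNumber_succ_sub]; ring

lemma sum_cesaroNumber_sub_one_reflect (a : ℝ) (n : ℕ) :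
    ∑ i ∈ Finset.range (n + 1), cesaroNumber (a - 1) (n - i) = cesaroNumber a n := by
  rw [← sum_cesaroNumber_sub_one]
  exact Finset.sum_range_reflect (fun j => cesaroNumber (a - 1) j) (n + 1)

lemma add_one_mul_sum_cesaroNumber (a : ℝ) (n : ℕ) :
    (a + 1) * ∑ j ∈ Finset.range (n + 1), cesaroNumber a j = (a + n + 1) * cesaroNumber a n := by
  induction n with
  | zero => simp [cesaroNumber_zero]
  | succ n ih =>
    rw [Finset.sum_range_succ, mul_add, ih, cesaroNumber_succ]
    push_cast
    field_simp
    ring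

lemma cesaroNumber_pos {a : ℝ} (ha : -1 < a) (n : ℕ) : 0 < cesaroNumber a n := by
  induction n with
  | zero => simp [cesaroNumber_zero]
  | succ n ih =>
    have : 0 < a + n + 1 := by linarith [n.cast_nonneg (α := ℝ)]
    rw [cesaroNumber_succ]
    positivity

section NegativeOrder

variable {α : ℝ}

lemma cesaroNumber_neg_pos (hα : α < 1) (n : ℕ) : 0 < cesaroNumber (-α) n :=
  cesaroNumber_pos (by linarith) n

lemma add_one_div_add_two_rpow_le (hα₀ : 0 ≤ α) (hα₁ : α ≤ 1) {x : ℝ} (hx : 0 ≤ x) :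
    ((x + 1) / (x + 2)) ^ α ≤ (-α + x + 2) / (x + 2) := by
  have hbernoulli := rpow_one_add_le_one_add_mul_self (s := -(1 / (x + 2))) (p := α)
    (by rw [neg_le_neg_iff, div_le_one (by positivity)]; linarith) hα₀ hα₁
  convert hbernoulli using 2 <;> (field_simp; ring)

lemma div_le_add_one_div_add_two_rpow (hα₀ : 0 ≤ α) (hα₁ : α ≤ 1) {x : ℝ} (hx : 0 ≤ x) :
    (-α + x + 1) / (x + 1) ≤ ((x + 1) / (x + 2)) ^ α := by
  have hbernoulli : ((x + 2) / (x + 1)) ^ α ≤ (x + 1 + α) / (x + 1) := by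
    have h := rpow_one_add_le_one_add_mul_self (s := 1 / (x + 1)) (p := α)
      (by have : 0 ≤ 1 / (x + 1) := by positivity
          linarith) hα₀ hα₁
    convert h using 2 <;> (field_simp; try ring)
  have hpos : 0 < ((x + 2) / (x + 1)) ^ α := by positivity
  rw [← inv_div (x + 2), Real.inv_rpow (by positivity), ← one_div, le_div_iff₀ hpos]
  calc (-α + x + 1) / (x + 1) * ((x + 2) / (x + 1)) ^ α
      ≤ (-α + x + 1) / (x + 1) * ((x + 1 + α) / (x + 1)) :=
        mul_le_mul_of_nonneg_left hbernoulli (div_nonneg (by linarith) (by positivity))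
    _ ≤ 1 := by
        rw [div_mul_div_comm, div_le_one (by positivity)]
        nlinarith [sq_nonneg α]

lemma div_rpow_mul_rpow_neg {x y : ℝ} (hx : 0 < x) (hy : 0 < y) (s : ℝ) :
    (x / y) ^ s * x ^ (-s) = y ^ (-s) := by
  rw [Real.div_rpow hx.le hy.le, Real.rpow_neg hx.le, Real.rpow_neg hy.le]
  field_simp

lemma cesaroNumber_neg_le (hα₀ : 0 ≤ α) (hα₁ : α < 1) (n : ℕ) :
    cesaroNumber (-α) n ≤ ((n : ℝ) + 1) ^ (-α) := by
  induction n with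
  | zero => simp [cesaroNumber_zero]
  | succ n ih =>
    calc cesaroNumber (-α) (n + 1)
        = (-α + n + 1) / (n + 1) * cesaroNumber (-α) n := cesaroNumber_succ ..
      _ ≤ (((n : ℝ) + 1) / (n + 2)) ^ α * ((n : ℝ) + 1) ^ (-α) :=
          mul_le_mul (div_le_add_one_div_add_two_rpow hα₀ hα₁.le n.cast_nonneg) ih
            (cesaroNumber_neg_pos hα₁ n).le (by positivity)
      _ = (((n + 1 : ℕ) : ℝ) + 1) ^ (-α) := by
          rw [div_rpow_mul_rpow_neg (by positivity) (by positivity)]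
          push_cast
          ring_nf

lemma le_cesaroNumber_neg (hα₀ : 0 ≤ α) (hα₁ : α ≤ 1) (n : ℕ) :
    (1 - α) * ((n : ℝ) + 1) ^ (-α) ≤ cesaroNumber (-α) (n + 1) := by
  induction n with
  | zero => simp [cesaroNumber_succ, cesaroNumber_zero]
  | succ n ih =>
    have hratio := add_one_div_add_two_rpow_le hα₀ hα₁ (n.cast_nonneg (α := ℝ))
    calc (1 - α) * (((n + 1 : ℕ) : ℝ) + 1) ^ (-α)
        = (((n : ℝ) + 1) / (n + 2)) ^ α * ((1 - α) * ((n : ℝ) + 1) ^ (-α)) := by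
          rw [mul_left_comm, div_rpow_mul_rpow_neg (by positivity) (by positivity)]
          push_cast
          ring_nf
      _ ≤ (-α + n + 2) / (n + 2) * cesaroNumber (-α) (n + 1) :=
          mul_le_mul hratio ih (mul_nonneg (by linarith) (by positivity))
            (le_trans (by positivity) hratio)
      _ = cesaroNumber (-α) (n + 1 + 1) := by
          rw [cesaroNumber_succ _ (n + 1)]
          push_cast
          ring_nf

lemma cesaroNumber_neg_sub_one_succ_neg (hα : α ∈ Ioo (0 : ℝ) 1) (j : ℕ) :
    cesaroNumber (-α - 1) (j + 1) < 0 := by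
  rw [cesaroNumber_sub_one_succ]
  exact mul_neg_of_neg_of_pos (div_neg_of_neg_of_pos (neg_lt_zero.2 hα.1) (by positivity))
    (cesaroNumber_neg_pos hα.2 j)

lemma cesaroNumber_neg_sub_one_succ_le (hα : α ∈ Ioo (0 : ℝ) 1) (j : ℕ) :
    cesaroNumber (-α - 1) (j + 1) ≤ cesaroNumber (-α - 1) (j + 2) := by
  have hratio : (-α - 1 + (j + 1 : ℕ) + 1) / ((j + 1 : ℕ) + 1) ≤ 1 := by
    push_cast
    rw [div_le_one (by positivity)]
    linarith [hα.1]
  rw [cesaroNumber_succ _ (j + 1)]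
  nlinarith [cesaroNumber_neg_sub_one_succ_neg hα j]

lemma sum_abs_cesaroNumber_neg_sub_one (hα : α ∈ Ioo (0 : ℝ) 1) (n : ℕ) :
    ∑ j ∈ Finset.range (n + 1), |cesaroNumber (-α - 1) j| = 2 - cesaroNumber (-α) n := by
  induction n with
  | zero => simp [cesaroNumber_zero]; norm_num
  | succ n ih =>
    rw [Finset.sum_range_succ, ih, abs_of_neg (cesaroNumber_neg_sub_one_succ_neg hα n),
      ← cesaroNumber_succ_sub]
    ring

lemma one_le_alternating_sum_cesaroNumber (hα : α ∈ Ioo (0 : ℝ) 1) (n : ℕ) :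
    1 ≤ ∑ j ∈ Finset.range (n + 1), cesaroNumber (-α - 1) j * (-1) ^ j := by
  have hodd (k : ℕ) : (-1 : ℝ) ^ (2 * k + 1) = -1 := by rw [pow_succ, pow_mul]; simp
  have heven (k : ℕ) :
      1 ≤ ∑ j ∈ Finset.range (2 * k + 1), cesaroNumber (-α - 1) j * (-1) ^ j := by
    induction k with
    | zero => simp [cesaroNumber_zero]
    | succ k ih =>
      have hpair := cesaroNumber_neg_sub_one_succ_le hα (2 * k)
      rw [show 2 * (k + 1) + 1 = (2 * k + 1) + 1 + 1 by ring, Finset.sum_range_succ,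
        Finset.sum_range_succ, pow_succ _ (2 * k + 1), hodd]
      linarith
  rcases Nat.even_or_odd' n with ⟨k, rfl | rfl⟩
  · exact heven k
  · rw [Finset.sum_range_succ, hodd]
    linarith [heven k, cesaroNumber_neg_sub_one_succ_neg hα (2 * k)]

end NegativeOrder

/-! ### The one-dimensional Cesàro kernel -/

/-- The Dirichlet kernel, normalised as `1 / 2 + ∑_{1 ≤ k ≤ n} cos kt`. -/
def dirichletKernel (n : ℕ) (t : ℝ) : ℝ :=
  1 / 2 + ∑ k ∈ Finset.range n, Real.cos ((k + 1) * t)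

/-- The kernel of the `(C; a)` means: they are the convolutions `π⁻¹ ∫ f(x - t) K(t) dt` over a
period. -/
def cesaroKernel (a : ℝ) (n : ℕ) (t : ℝ) : ℝ :=
  (∑ i ∈ Finset.range (n + 1), cesaroNumber (a - 1) (n - i) * dirichletKernel i t) /
    cesaroNumber a n

lemma dirichletKernel_neg (n : ℕ) (t : ℝ) : dirichletKernel n (-t) = dirichletKernel n t := by
  simp [dirichletKernel, Real.cos_neg]

lemma cesaroKernel_neg (a : ℝ) (n : ℕ) (t : ℝ) : cesaroKernel a n (-t) = cesaroKernel a n t := by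
  simp [cesaroKernel, dirichletKernel_neg]

lemma dirichletKernel_periodic (n : ℕ) : Function.Periodic (dirichletKernel n) (2 * π) := by
  intro t
  simp only [dirichletKernel]
  congr 1
  refine Finset.sum_congr rfl fun k _ => ?_
  rw [← Real.cos_add_nat_mul_two_pi ((k + 1) * t) (k + 1)]
  push_cast
  ring_nf

lemma cesaroKernel_periodic (a : ℝ) (n : ℕ) : Function.Periodic (cesaroKernel a n) (2 * π) := by
  intro t
  simp only [cesaroKernel, dirichletKernel_periodic _ t]

@[fun_prop]
lemma continuous_dirichletKernel (n : ℕ) : Continuous (dirichletKernel n) := by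
  unfold dirichletKernel; fun_prop

@[fun_prop]
lemma continuous_cesaroKernel (a : ℝ) (n : ℕ) : Continuous (cesaroKernel a n) := by
  unfold cesaroKernel; fun_prop

lemma integral_dirichletKernel (n : ℕ) : ∫ t in (0 : ℝ)..π, dirichletKernel n t = π / 2 := by
  have hcos (k : ℕ) : ∫ t in (0 : ℝ)..π, Real.cos ((k + 1) * t) = 0 := by
    have hsin := Real.sin_nat_mul_pi (k + 1)
    push_cast at hsin
    rw [intervalIntegral.integral_comp_mul_left Real.cos (by positivity), integral_cos]
    simp [hsin]
  simp only [dirichletKernel]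
  rw [intervalIntegral.integral_add (by simp) (by apply Continuous.intervalIntegrable; fun_prop),
    intervalIntegral.integral_finsetSum
      (fun i _ => by apply Continuous.intervalIntegrable; fun_prop),
    Finset.sum_eq_zero fun k _ => hcos k]
  simp
  ring

lemma integral_cesaroKernel {a : ℝ} {n : ℕ} (h : cesaroNumber a n ≠ 0) :
    ∫ t in (0 : ℝ)..π, cesaroKernel a n t = π / 2 := by
  simp only [cesaroKernel]
  rw [intervalIntegral.integral_div, intervalIntegral.integral_finsetSum
      (fun i _ => by apply Continuous.intervalIntegrable; fun_prop)]
  simp only [intervalIntegral.integral_const_mul, integral_dirichletKernel, ← Finset.sum_mul]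
  rw [sum_cesaroNumber_sub_one_reflect]
  field_simp

lemma sum_Ico_cesaroNumber_sub_one (a : ℝ) {k n : ℕ} (hk : k ≤ n) :
    ∑ i ∈ Finset.Ico k (n + 1), cesaroNumber (a - 1) (n - i) = cesaroNumber a (n - k) := by
  rw [← sum_cesaroNumber_sub_one_reflect, Finset.sum_Ico_eq_sum_range,
    show n + 1 - k = n - k + 1 by omega]
  exact Finset.sum_congr rfl fun i _ => by rw [Nat.sub_sub]

lemma sum_cesaroNumber_mul_dirichletKernel (a : ℝ) (n : ℕ) (t : ℝ) :
    ∑ i ∈ Finset.range (n + 1), cesaroNumber (a - 1) (n - i) * dirichletKernel i t =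
      cesaroNumber a n / 2 +
        ∑ k ∈ Finset.range n, cesaroNumber a (n - (k + 1)) * Real.cos ((k + 1) * t) := by
  have hswap : ∑ i ∈ Finset.range (n + 1), ∑ k ∈ Finset.range i,
      cesaroNumber (a - 1) (n - i) * Real.cos ((k + 1) * t) =
      ∑ k ∈ Finset.range n, ∑ i ∈ Finset.Ico (k + 1) (n + 1),
        cesaroNumber (a - 1) (n - i) * Real.cos ((k + 1) * t) :=
    Finset.sum_comm' fun i k => by simp only [Finset.mem_range, Finset.mem_Ico]; omega
  simp only [dirichletKernel, mul_add, Finset.sum_add_distrib, ← Finset.sum_mul,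
    sum_cesaroNumber_sub_one_reflect, Finset.mul_sum]
  rw [hswap, mul_one_div]
  congr 1
  refine Finset.sum_congr rfl fun k hk => ?_
  rw [← Finset.sum_mul, sum_Ico_cesaroNumber_sub_one a (Nat.succ_le_of_lt (Finset.mem_range.1 hk))]

lemma abs_cesaroKernel_le {α : ℝ} (hα₀ : 0 ≤ α) (hα₁ : α < 1) (n : ℕ) (t : ℝ) :
    |cesaroKernel (-α) n t| ≤ (n + 1) / (1 - α) := by
  have hA := cesaroNumber_neg_pos hα₁
  have hcoeff : |cesaroNumber (-α) n / 2 + ∑ k ∈ Finset.range n,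
      cesaroNumber (-α) (n - (k + 1)) * Real.cos ((k + 1) * t)| ≤
      ∑ j ∈ Finset.range (n + 1), cesaroNumber (-α) j := by
    rw [Finset.sum_range_succ, add_comm _ (cesaroNumber (-α) n), ← Finset.sum_range_reflect]
    refine (abs_add_le _ _).trans (add_le_add ?_ ?_)
    · rw [abs_of_pos (half_pos (hA n))]
      exact half_le_self (hA n).le
    · refine (Finset.abs_sum_le_sum_abs _ _).trans (Finset.sum_le_sum fun k hk => ?_)
      have hk := Finset.mem_range.1 hk
      rw [abs_mul, abs_of_pos (hA _), show n - (n - 1 - k + 1) = k by omega]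
      exact mul_le_of_le_one_right (hA _).le (Real.abs_cos_le_one _)
  rw [cesaroKernel, sum_cesaroNumber_mul_dirichletKernel, abs_div, abs_of_pos (hA n),
    div_le_iff₀ (hA n)]
  refine hcoeff.trans ?_
  rw [div_mul_eq_mul_div, le_div_iff₀ (by linarith), mul_comm, show 1 - α = -α + 1 by ring,
    add_one_mul_sum_cesaroNumber]
  exact mul_le_mul_of_nonneg_right (by linarith) (hA n).le

lemma two_mul_sin_mul_dirichletKernel (n : ℕ) (t : ℝ) :
    2 * Real.sin (t / 2) * dirichletKernel n t = Real.sin ((n + 1 / 2) * t) := by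
  induction n with
  | zero => simp [dirichletKernel]; ring_nf
  | succ n ih =>
    have hsucc : dirichletKernel (n + 1) t = dirichletKernel n t + Real.cos ((n + 1) * t) := by
      simp [dirichletKernel, Finset.sum_range_succ, add_assoc]
    rw [hsucc, mul_add, ih,
      show ((n + 1 : ℕ) + 1 / 2 : ℝ) * t = (n + 1) * t + t / 2 by push_cast; ring,
      show ((n : ℝ) + 1 / 2) * t = (n + 1) * t - t / 2 by ring, Real.sin_add, Real.sin_sub]
    ring

/-- The trigonometric polynomial `∑_{j ≤ n} A_j^{a-1} e^{-iju}`, a partial sum of the binomial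
series of `(1 - e^{-iu})^{-a}`. -/
def cesaroPoly (a : ℝ) (n : ℕ) (u : ℝ) : ℂ :=
  ∑ j ∈ Finset.range (n + 1), (cesaroNumber (a - 1) j : ℂ) * Complex.exp (-(u * I)) ^ j

lemma two_mul_sin_mul_cesaroKernel (a : ℝ) (n : ℕ) (t : ℝ) :
    2 * Real.sin (t / 2) * cesaroKernel a n t =
      (Complex.exp ((n + 1 / 2 : ℝ) * t * I) * cesaroPoly a n t).im / cesaroNumber a n := by
  rw [cesaroKernel, mul_div_assoc']
  congr 1
  rw [cesaroPoly, Finset.mul_sum, Finset.mul_sum, ← Finset.sum_range_reflect, Complex.im_sum]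
  refine Finset.sum_congr rfl fun j hj => ?_
  have hj : j ≤ n := Nat.lt_succ_iff.1 (Finset.mem_range.1 hj)
  have hexp : Complex.exp ((n + 1 / 2 : ℝ) * t * I) * Complex.exp (-(t * I)) ^ j =
      Complex.exp ((((n - j : ℕ) + 1 / 2) * t : ℝ) * I) := by
    rw [← Complex.exp_nat_mul, ← Complex.exp_add]
    push_cast [Nat.cast_sub hj]
    ring_nf
  rw [show n + 1 - 1 - j = n - j by omega, show n - (n - j) = j by omega, mul_left_comm,
    two_mul_sin_mul_dirichletKernel, mul_left_comm, hexp, Complex.im_ofReal_mul,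
    Complex.exp_ofReal_mul_I_im]

lemma exists_cesaroPoly_pi_eq {α : ℝ} (hα : α ∈ Ioo (0 : ℝ) 1) (n : ℕ) :
    ∃ r ∈ Icc (1 : ℝ) 2, cesaroPoly (-α) n π = r := by
  refine ⟨_, ⟨one_le_alternating_sum_cesaroNumber hα n, ?_⟩, ?_⟩
  · calc ∑ j ∈ Finset.range (n + 1), cesaroNumber (-α - 1) j * (-1) ^ j
        ≤ ∑ j ∈ Finset.range (n + 1), |cesaroNumber (-α - 1) j * (-1) ^ j| :=
          (le_abs_self _).trans (Finset.abs_sum_le_sum_abs _ _)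
      _ = 2 - cesaroNumber (-α) n := by
          simpa [abs_mul] using sum_abs_cesaroNumber_neg_sub_one hα n
      _ ≤ 2 := sub_le_self _ (cesaroNumber_neg_pos hα.2 n).le
  · rw [cesaroPoly, Complex.exp_neg, Complex.exp_pi_mul_I]
    norm_num

lemma one_sub_mul_sum_cesaroNumber (a : ℝ) (n : ℕ) (z : ℂ) :
    (1 - z) * ∑ j ∈ Finset.range n, (cesaroNumber a j : ℂ) * z ^ j =
      ∑ j ∈ Finset.range (n + 1), (cesaroNumber (a - 1) j : ℂ) * z ^ j -
        cesaroNumber a n * z ^ n := by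
  induction n with
  | zero => simp [cesaroNumber_zero]
  | succ n ih =>
    rw [Finset.sum_range_succ, mul_add, ih, Finset.sum_range_succ _ (n + 1),
      ← cesaroNumber_succ_sub]
    push_cast
    ring

lemma hasDerivAt_exp_neg_mul_I (u : ℝ) :
    HasDerivAt (fun u : ℝ => Complex.exp (-(u * I))) (Complex.exp (-(u * I)) * -I) u := by
  simpa using ((Complex.ofRealCLM.hasDerivAt (x := u)).mul_const I).fun_neg.cexp

lemma hasDerivAt_cesaroPoly (a : ℝ) (n : ℕ) (u : ℝ) :
    HasDerivAt (cesaroPoly a n) (-(I * a * Complex.exp (-(u * I)) *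
      ∑ j ∈ Finset.range n, (cesaroNumber a j : ℂ) * Complex.exp (-(u * I)) ^ j)) u := by
  have hterm (j : ℕ) := ((hasDerivAt_exp_neg_mul_I u).pow j).const_mul (cesaroNumber (a - 1) j : ℂ)
  refine (HasDerivAt.fun_sum fun j _ => hterm j).congr_deriv ?_
  rw [Finset.sum_range_succ', Finset.mul_sum, ← Finset.sum_neg_distrib]
  simp only [CharP.cast_eq_zero, zero_mul, mul_zero, add_zero]
  refine Finset.sum_congr rfl fun j _ => ?_
  have hj : (j : ℂ) + 1 ≠ 0 := by exact_mod_cast Nat.succ_ne_zero j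
  rw [cesaroNumber_sub_one_succ, Nat.add_sub_cancel]
  push_cast
  field_simp

/-! ### Amplitude and phase of the kernel -/

lemma intervalIntegrable_deriv_of_norm_le {S : ℝ → ℂ} {g : ℝ → ℝ} {t T : ℝ} (htT : t ≤ T)
    (hg : IntervalIntegrable g volume t T) (hS : ∀ x ∈ Icc t T, ‖deriv S x‖ ≤ g x) :
    IntervalIntegrable (deriv S) volume t T := by
  refine hg.mono_fun (measurable_deriv S).aestronglyMeasurable ?_
  rw [uIoc_of_le htT]
  filter_upwards [ae_restrict_mem measurableSet_Ioc] with x hx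
  exact (hS x (Ioc_subset_Icc_self hx)).trans (Real.le_norm_self _)

lemma norm_integral_exp_mul_le {S : ℝ → ℂ} {t T M : ℝ} (hM : 0 < M) (γ : ℝ) (htT : t ≤ T)
    (hS : ∀ x ∈ Icc t T, DifferentiableAt ℝ S x) (hS' : IntervalIntegrable (deriv S) volume t T) :
    ‖∫ x in t..T, Complex.exp ((M * x + γ : ℝ) * I) * S x‖ ≤
      (‖S t‖ + ‖S T‖ + ∫ x in t..T, ‖deriv S x‖) / M := by
  set E : ℝ → ℂ := fun x => Complex.exp ((M * x + γ : ℝ) * I) / (M * I) with hE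
  have hMI : (M : ℂ) * I ≠ 0 := by simp [hM.ne']
  have hnorm (x : ℝ) : ‖E x‖ = M⁻¹ := by
    simp only [hE, norm_div, Complex.norm_exp_ofReal_mul_I, norm_mul, Complex.norm_I,
      Complex.norm_real, Real.norm_of_nonneg hM.le]
    simp
  have hderiv (x : ℝ) : HasDerivAt E (Complex.exp ((M * x + γ : ℝ) * I)) x := by
    have hphase : HasDerivAt (fun x : ℝ => ((M * x + γ : ℝ) : ℂ)) (M * 1 : ℝ) x :=
      (((hasDerivAt_id x).const_mul M).add_const γ).ofReal_comp
    refine ((hphase.mul_const I).cexp.div_const (M * I)).congr_deriv ?_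
    rw [mul_one]
    exact mul_div_cancel_right₀ _ hMI
  have hparts : ∫ x in t..T, S x * Complex.exp ((M * x + γ : ℝ) * I) =
      S T * E T - S t * E t - ∫ x in t..T, deriv S x * E x :=
    intervalIntegral.integral_mul_deriv_eq_deriv_mul
      (fun x hx => (hS x (uIcc_of_le htT ▸ hx)).hasDerivAt) (fun x _ => hderiv x) hS'
      ((by fun_prop : Continuous fun x : ℝ => Complex.exp ((M * x + γ : ℝ) * I)).intervalIntegrable
        _ _)
  have hlast : ‖∫ x in t..T, deriv S x * E x‖ ≤ (∫ x in t..T, ‖deriv S x‖) * M⁻¹ := by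
    refine (intervalIntegral.norm_integral_le_integral_norm htT).trans_eq ?_
    simp only [norm_mul, hnorm, intervalIntegral.integral_mul_const]
  simp only [mul_comm (Complex.exp _)]
  calc _ = ‖S T * E T - S t * E t - ∫ x in t..T, deriv S x * E x‖ := by rw [hparts]
    _ ≤ ‖S T * E T‖ + ‖S t * E t‖ + ‖∫ x in t..T, deriv S x * E x‖ :=
        (norm_sub_le _ _).trans (add_le_add_left (norm_sub_le _ _) _)
    _ ≤ ‖S T‖ * M⁻¹ + ‖S t‖ * M⁻¹ + (∫ x in t..T, ‖deriv S x‖) * M⁻¹ := by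
        rw [norm_mul, norm_mul, hnorm, hnorm]
        gcongr
    _ = _ := by ring

/-- The length `|1 - exp (-iu)| = 2 sin (u / 2)` of the chord subtending the angle `u`, valid for
`0 ≤ u ≤ 2π`. -/
def chord (u : ℝ) : ℝ := 2 * Real.sin (u / 2)

lemma hasDerivAt_chord (u : ℝ) : HasDerivAt chord (Real.cos (u / 2)) u := by
  refine ((((hasDerivAt_id u).div_const 2).sin).const_mul 2).congr_deriv ?_
  simp only [id_eq]
  ring

lemma one_sub_exp_neg_mul_I (u : ℝ) :
    1 - Complex.exp (-(u * I)) = chord u * Complex.exp (((π - u) / 2 : ℝ) * I) := by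
  have hsq : Complex.exp (-(u * I)) = Complex.exp (-(u / 2 : ℝ) * I) ^ 2 := by
    rw [← Complex.exp_nat_mul]
    push_cast
    ring_nf
  have hrot : Complex.exp (((π - u) / 2 : ℝ) * I) = I * Complex.exp (-(u / 2 : ℝ) * I) := by
    rw [show ((((π - u) / 2 : ℝ) : ℂ)) * I = π / 2 * I + -(u / 2 : ℝ) * I by push_cast; ring,
      Complex.exp_add, Complex.exp_pi_div_two_mul_I]
  have hcs : (Real.cos (u / 2) : ℂ) ^ 2 + (Real.sin (u / 2) : ℂ) ^ 2 = 1 := by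
    exact_mod_cast Real.cos_sq_add_sin_sq (u / 2)
  rw [hsq, hrot, ← Complex.ofReal_neg, Complex.exp_mul_I, ← Complex.ofReal_cos,
    ← Complex.ofReal_sin, Real.cos_neg, Real.sin_neg, chord]
  simp only [Complex.ofReal_neg, Complex.ofReal_mul, Complex.ofReal_ofNat]
  linear_combination -hcs + (Real.sin (u / 2) : ℂ) ^ 2 * Complex.I_sq

lemma mul_le_chord {u : ℝ} (hu : u ∈ Icc 0 π) : 2 / π * u ≤ chord u := by
  have := Real.mul_le_sin (x := u / 2) (by linarith [hu.1]) (by linarith [hu.2])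
  rw [chord]
  linarith

lemma chord_le {u : ℝ} (hu : 0 ≤ u) : chord u ≤ u := by
  have := Real.sin_le (x := u / 2) (by linarith)
  rw [chord]
  linarith

lemma chord_pos {u : ℝ} (hu : u ∈ Ioc 0 π) : 0 < chord u :=
  (by have := hu.1; positivity : 0 < 2 / π * u).trans_le (mul_le_chord (Ioc_subset_Icc_self hu))

lemma chord_rpow_neg_le {u q : ℝ} (hu : u ∈ Ioc 0 π) (hq₀ : 0 ≤ q) (hq₂ : q ≤ 2) :
    chord u ^ (-q) ≤ 3 * u ^ (-q) := by
  have hu₀ := hu.1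
  have hconst : (π / 2) ^ q ≤ 3 := calc
    (π / 2) ^ q ≤ (π / 2) ^ (2 : ℝ) :=
      Real.rpow_le_rpow_of_exponent_le (by linarith [Real.pi_gt_three]) hq₂
    _ ≤ 3 := by
      rw [Real.rpow_two]
      nlinarith [Real.pi_lt_d2, Real.pi_gt_three]
  calc chord u ^ (-q) ≤ (2 / π * u) ^ (-q) :=
        Real.rpow_le_rpow_of_nonpos (by positivity) (mul_le_chord (Ioc_subset_Icc_self hu))
          (neg_nonpos.2 hq₀)
    _ = (π / 2) ^ q * u ^ (-q) := by
        rw [Real.mul_rpow (by positivity) hu₀.le, Real.rpow_neg (by positivity),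
          ← Real.inv_rpow (by positivity), inv_div]
    _ ≤ 3 * u ^ (-q) := by gcongr

lemma one_sub_exp_neg_mul_I_mem_slitPlane {u : ℝ} (hu : u ∈ Ioc 0 π) :
    1 - Complex.exp (-(u * I)) ∈ Complex.slitPlane := by
  left
  rw [one_sub_exp_neg_mul_I, Complex.re_ofReal_mul, Complex.exp_ofReal_mul_I_re]
  exact mul_pos (chord_pos hu) (Real.cos_pos_of_mem_Ioo ⟨by linarith [hu.2, Real.pi_pos],
    by linarith [hu.1]⟩)

lemma one_sub_exp_neg_mul_I_cpow {u : ℝ} (hu : u ∈ Ioc 0 π) (s : ℝ) :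
    (1 - Complex.exp (-(u * I))) ^ (s : ℂ) =
      (chord u ^ s : ℝ) * Complex.exp ((s * (π - u) / 2 : ℝ) * I) := by
  have hlog : Complex.log (Complex.exp (((π - u) / 2 : ℝ) * I)) = ((π - u) / 2 : ℝ) * I := by
    apply Complex.log_exp <;>
      simp only [Complex.mul_I_im, Complex.ofReal_re] <;> linarith [hu.1, hu.2, Real.pi_pos]
  have hc := chord_pos hu
  rw [one_sub_exp_neg_mul_I, Complex.cpow_def_of_ne_zero
      (mul_ne_zero (Complex.ofReal_ne_zero.2 hc.ne') (Complex.exp_ne_zero _)),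
    Complex.log_ofReal_mul hc (Complex.exp_ne_zero _), hlog, Real.rpow_def_of_pos hc,
    Complex.ofReal_exp, ← Complex.exp_add]
  push_cast
  ring_nf

lemma norm_one_sub_exp_neg_mul_I_cpow {u : ℝ} (hu : u ∈ Ioc 0 π) (s : ℝ) :
    ‖(1 - Complex.exp (-(u * I))) ^ (s : ℂ)‖ = chord u ^ s := by
  rw [one_sub_exp_neg_mul_I_cpow hu, norm_mul, Complex.norm_exp_ofReal_mul_I, mul_one,
    Complex.norm_of_nonneg (Real.rpow_nonneg (chord_pos hu).le _)]

/-- The quotient of `cesaroPoly (-α) n` by the boundary value of `(1 - z) ^ α` at `z = exp (-iu)`;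
the power series of that function has the Cesàro numbers `A_j^{-α-1}` as its coefficients, so the
quotient varies slowly. -/
def kernelModulation (α : ℝ) (n : ℕ) (u : ℝ) : ℂ :=
  cesaroPoly (-α) n u * (1 - Complex.exp (-(u * I))) ^ ((-α : ℝ) : ℂ)

/-- The amplitude of the Cesàro kernel with respect to the linear phase `kernelPhase`. -/
def kernelAmplitude (α : ℝ) (n : ℕ) (u : ℝ) : ℂ :=
  kernelModulation α n u * (chord u ^ (α - 1) : ℝ)

/-- The frequency of the Cesàro kernel of order `-α`. -/
def kernelFreq (α : ℝ) (n : ℕ) : ℝ := n + 1 / 2 - α / 2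

/-- The linear phase of the Cesàro kernel of order `-α`. -/
def kernelPhase (α : ℝ) (n : ℕ) (u : ℝ) : ℝ := kernelFreq α n * u + α * π / 2

lemma cesaroKernel_eq_im (α : ℝ) (n : ℕ) {u : ℝ} (hu : u ∈ Ioc 0 π) :
    cesaroKernel (-α) n u =
      (Complex.exp (kernelPhase α n u * I) * kernelAmplitude α n u).im / cesaroNumber (-α) n := by
  have hc := chord_pos hu
  have hpow : chord u ^ (-α) * chord u ^ (α - 1) = (chord u)⁻¹ := by
    rw [← Real.rpow_add hc, show -α + (α - 1) = -1 by ring, Real.rpow_neg_one]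
  have hphase : Complex.exp (kernelPhase α n u * I) *
      Complex.exp ((-α * (π - u) / 2 : ℝ) * I) = Complex.exp ((n + 1 / 2 : ℝ) * u * I) := by
    rw [← Complex.exp_add, kernelPhase, kernelFreq]
    push_cast
    ring_nf
  have hfactor : Complex.exp (kernelPhase α n u * I) * kernelAmplitude α n u =
      ((chord u)⁻¹ : ℝ) * (Complex.exp ((n + 1 / 2 : ℝ) * u * I) * cesaroPoly (-α) n u) := by
    rw [← hpow, ← hphase, kernelAmplitude, kernelModulation, one_sub_exp_neg_mul_I_cpow hu]
    push_cast
    ring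
  rw [hfactor, Complex.im_ofReal_mul, mul_div_assoc, ← two_mul_sin_mul_cesaroKernel, ← chord,
    inv_mul_cancel_left₀ hc.ne']

lemma hasDerivAt_kernelModulation (α : ℝ) (n : ℕ) {u : ℝ} (hu : u ∈ Ioc 0 π) :
    HasDerivAt (kernelModulation α n) (-I * α * cesaroNumber (-α) n *
      Complex.exp (-(u * I)) ^ (n + 1) * (1 - Complex.exp (-(u * I))) ^ ((-α - 1 : ℝ) : ℂ)) u := by
  have hslit := one_sub_exp_neg_mul_I_mem_slitPlane hu
  have hpow := HasDerivAt.scomp (g₁ := fun w : ℂ => w ^ ((-α : ℝ) : ℂ)) u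
    (Complex.hasStrictDerivAt_cpow_const hslit).hasDerivAt
    ((hasDerivAt_exp_neg_mul_I u).const_sub 1)
  refine ((hasDerivAt_cesaroPoly (-α) n u).mul hpow).congr_deriv ?_
  have hsum := one_sub_mul_sum_cesaroNumber (-α) n (Complex.exp (-(u * I)))
  rw [← cesaroPoly] at hsum
  have hsucc : (1 - Complex.exp (-(u * I))) ^ ((-α : ℝ) : ℂ) =
      (1 - Complex.exp (-(u * I))) * (1 - Complex.exp (-(u * I))) ^ ((-α - 1 : ℝ) : ℂ) := by
    rw [Complex.ofReal_sub, Complex.ofReal_one,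
      Complex.cpow_sub _ _ (Complex.slitPlane_ne_zero hslit), Complex.cpow_one,
      mul_div_cancel₀ _ (Complex.slitPlane_ne_zero hslit)]
  rw [Function.comp_apply, hsucc]
  push_cast
  simp only [smul_eq_mul]
  linear_combination I * α * Complex.exp (-(u * I)) *
    (1 - Complex.exp (-(u * I))) ^ (-α - 1 : ℂ) * hsum

section KernelBounds

variable {α : ℝ} (hα : α ∈ Ioo (0 : ℝ) 1)
include hα

lemma kernelFreq_ge (n : ℕ) : (n : ℝ) ≤ kernelFreq α n := by
  rw [kernelFreq]
  linarith [hα.2]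

lemma cesaroNumber_neg_mul_rpow_le (n : ℕ) {u : ℝ} (hu : 0 < u) :
    cesaroNumber (-α) n * u ^ (-α) ≤ (((n : ℝ) + 1) * u) ^ (-α) := by
  rw [Real.mul_rpow (by positivity) hu.le]
  exact mul_le_mul_of_nonneg_right (cesaroNumber_neg_le hα.1.le hα.2 n) (by positivity)

lemma norm_deriv_kernelModulation_le (n : ℕ) {u : ℝ} (hu : u ∈ Ioc 0 π) :
    ‖deriv (kernelModulation α n) u‖ ≤ 3 * α * cesaroNumber (-α) n * u ^ (-α - 1) := by
  have hα₀ := hα.1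
  have hA := (cesaroNumber_neg_pos hα.2 n).le
  have hchord := chord_rpow_neg_le (q := α + 1) hu (by linarith) (by linarith [hα.2])
  rw [show -(α + 1) = -α - 1 by ring] at hchord
  have hexp : ‖Complex.exp (-(u * I))‖ = 1 := by
    rw [← neg_mul, ← Complex.ofReal_neg, Complex.norm_exp_ofReal_mul_I]
  calc ‖deriv (kernelModulation α n) u‖ = α * cesaroNumber (-α) n * chord u ^ (-α - 1) := by
        rw [(hasDerivAt_kernelModulation α n hu).deriv, norm_mul, norm_mul, norm_mul, norm_mul,
          norm_pow, hexp, norm_one_sub_exp_neg_mul_I_cpow hu, norm_neg, Complex.norm_I,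
          Complex.norm_of_nonneg hα₀.le, Complex.norm_of_nonneg hA]
        ring
    _ ≤ α * cesaroNumber (-α) n * (3 * u ^ (-α - 1)) := by gcongr
    _ = _ := by ring

lemma norm_kernelModulation_sub_le (n : ℕ) {u : ℝ} (hu : u ∈ Ioc 0 π) :
    ‖kernelModulation α n π - kernelModulation α n u‖ ≤ 3 * (((n : ℝ) + 1) * u) ^ (-α) := by
  have hα₀ := hα.1
  have hA := (cesaroNumber_neg_pos hα.2 n).le
  have hsub : Icc u π ⊆ Ioc 0 π := fun x hx => ⟨hu.1.trans_le hx.1, hx.2⟩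
  have h0 : (0 : ℝ) ∉ uIcc u π := by simp [uIcc_of_le hu.2, hu.1]
  have hdiff (x : ℝ) (hx : x ∈ Icc u π) : DifferentiableAt ℝ (kernelModulation α n) x :=
    (hasDerivAt_kernelModulation α n (hsub hx)).differentiableAt
  calc ‖kernelModulation α n π - kernelModulation α n u‖
      ≤ ∫ x in u..π, 3 * α * cesaroNumber (-α) n * x ^ (-α - 1) :=
        norm_sub_le_integral_of_norm_deriv_le_of_le hu.2
          (fun x hx => (hdiff x hx).continuousAt.continuousWithinAt)
          (fun x hx => (hdiff x (Ioo_subset_Icc_self hx)).differentiableWithinAt)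
          (.of_forall fun x hx =>
            norm_deriv_kernelModulation_le hα n (hsub (Ioo_subset_Icc_self hx)))
          ((intervalIntegral.intervalIntegrable_rpow (Or.inr h0)).const_mul _)
    _ = 3 * (cesaroNumber (-α) n * u ^ (-α)) - 3 * (cesaroNumber (-α) n * π ^ (-α)) := by
        rw [intervalIntegral.integral_const_mul,
          integral_rpow (Or.inr ⟨by linarith, h0⟩), sub_add_cancel]
        field_simp
        ring
    _ ≤ 3 * (((n : ℝ) + 1) * u) ^ (-α) := by
        have := cesaroNumber_neg_mul_rpow_le hα n hu.1
        have : 0 ≤ cesaroNumber (-α) n * π ^ (-α) := by positivity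
        linarith

lemma exists_kernelModulation_pi_eq (n : ℕ) :
    ∃ r ∈ Icc (1 / 2 : ℝ) 2, kernelModulation α n π = r := by
  obtain ⟨r, ⟨hr₁, hr₂⟩, hr⟩ := exists_cesaroPoly_pi_eq hα n
  have hlower : (2 : ℝ)⁻¹ ≤ 2 ^ (-α) := by
    rw [← Real.rpow_neg_one]
    exact Real.rpow_le_rpow_of_exponent_le (by norm_num) (by linarith [hα.2])
  have hupper : (2 : ℝ) ^ (-α) ≤ 1 :=
    Real.rpow_le_one_of_one_le_of_nonpos (by norm_num) (by linarith [hα.1])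
  refine ⟨r * 2 ^ (-α), ⟨by nlinarith, by nlinarith⟩, ?_⟩
  rw [kernelModulation, hr, one_sub_exp_neg_mul_I_cpow ⟨Real.pi_pos, le_rfl⟩]
  simp [chord]

lemma norm_kernelModulation_le (n : ℕ) {u : ℝ} (hu : u ∈ Ioc 0 π)
    (hnu : 1 ≤ ((n : ℝ) + 1) * u) : ‖kernelModulation α n u‖ ≤ 5 := by
  obtain ⟨r, ⟨hr₁, hr₂⟩, hr⟩ := exists_kernelModulation_pi_eq hα n
  have hsub := norm_kernelModulation_sub_le hα n hu
  have hdecay : (((n : ℝ) + 1) * u) ^ (-α) ≤ 1 :=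
    Real.rpow_le_one_of_one_le_of_nonpos hnu (by linarith [hα.1])
  have htri := norm_sub_norm_le (kernelModulation α n u) (kernelModulation α n π)
  rw [norm_sub_rev, hr, Complex.norm_of_nonneg (by linarith)] at htri
  rw [hr] at hsub
  linarith

lemma norm_kernelAmplitude_le (n : ℕ) {u : ℝ} (hu : u ∈ Ioc 0 π)
    (hnu : 1 ≤ ((n : ℝ) + 1) * u) : ‖kernelAmplitude α n u‖ ≤ 15 * u ^ (α - 1) := by
  have hc := chord_pos hu
  have hchord := chord_rpow_neg_le (q := 1 - α) hu (by linarith [hα.2]) (by linarith [hα.1])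
  rw [neg_sub] at hchord
  rw [kernelAmplitude, norm_mul, Complex.norm_of_nonneg (by positivity)]
  calc _ ≤ 5 * (3 * u ^ (α - 1)) :=
        mul_le_mul (norm_kernelModulation_le hα n hu hnu) hchord (by positivity) (by norm_num)
    _ = _ := by ring

lemma re_kernelAmplitude_ge (n : ℕ) {u : ℝ} (hu : u ∈ Ioc 0 π)
    (hnu : 12 * (((n : ℝ) + 1) * u) ^ (-α) ≤ 1) :
    1 / 4 * u ^ (α - 1) ≤ (kernelAmplitude α n u).re := by
  obtain ⟨r, ⟨hr, -⟩, hpi⟩ := exists_kernelModulation_pi_eq hα n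
  have hsub := (Complex.re_le_norm _).trans (norm_kernelModulation_sub_le hα n hu)
  rw [hpi, Complex.sub_re, Complex.ofReal_re] at hsub
  rw [kernelAmplitude, Complex.re_mul_ofReal]
  exact mul_le_mul (by linarith)
    (Real.rpow_le_rpow_of_nonpos (chord_pos hu) (chord_le hu.1.le) (by linarith [hα.2]))
    (by have := hu.1; positivity) (by linarith)

omit hα in
lemma hasDerivAt_kernelAmplitude (n : ℕ) {u : ℝ} (hu : u ∈ Ioc 0 π) :
    HasDerivAt (kernelAmplitude α n)
      (deriv (kernelModulation α n) u * (chord u ^ (α - 1) : ℝ) +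
        kernelModulation α n u * (Real.cos (u / 2) * (α - 1) * chord u ^ (α - 2) : ℝ)) u := by
  have hpow :=
    ((hasDerivAt_chord u).rpow_const (p := α - 1) (Or.inl (chord_pos hu).ne')).ofReal_comp
  rw [sub_sub, one_add_one_eq_two] at hpow
  exact (hasDerivAt_kernelModulation α n hu).differentiableAt.hasDerivAt.mul hpow

lemma norm_deriv_kernelAmplitude_le (n : ℕ) {u : ℝ} (hu : u ∈ Ioc 0 π)
    (hnu : 1 ≤ ((n : ℝ) + 1) * u) : ‖deriv (kernelAmplitude α n) u‖ ≤ 24 * u ^ (α - 2) := by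
  obtain ⟨hα₀, hα₁⟩ := hα
  have hu₀ := hu.1
  have hc := chord_pos hu
  have hA := (cesaroNumber_neg_pos hα₁ n).le
  have h1α : 0 < 1 - α := by linarith
  have hchord₁ := chord_rpow_neg_le (q := 1 - α) hu (by linarith) (by linarith)
  have hchord₂ := chord_rpow_neg_le (q := 2 - α) hu (by linarith) (by linarith)
  rw [neg_sub] at hchord₁ hchord₂
  have hsmall : cesaroNumber (-α) n * u ^ (-α) ≤ 1 :=
    (cesaroNumber_neg_mul_rpow_le ⟨hα₀, hα₁⟩ n hu₀).trans
      (Real.rpow_le_one_of_one_le_of_nonpos hnu (by linarith))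
  have hfirst : ‖deriv (kernelModulation α n) u * (chord u ^ (α - 1) : ℝ)‖ ≤
      9 * α * u ^ (α - 2) := calc
    _ ≤ (3 * α * cesaroNumber (-α) n * u ^ (-α - 1)) * (3 * u ^ (α - 1)) := by
        rw [norm_mul, Complex.norm_of_nonneg (by positivity)]
        exact mul_le_mul (norm_deriv_kernelModulation_le ⟨hα₀, hα₁⟩ n hu) hchord₁ (by positivity)
          (by positivity)
    _ = 9 * α * (cesaroNumber (-α) n * u ^ (-α)) * u ^ (α - 2) := by
        have : u ^ (-α - 1) * u ^ (α - 1) = u ^ (-α) * u ^ (α - 2) := by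
          rw [← Real.rpow_add hu₀, ← Real.rpow_add hu₀]
          ring_nf
        linear_combination 9 * α * cesaroNumber (-α) n * this
    _ ≤ 9 * α * 1 * u ^ (α - 2) := by gcongr
    _ = _ := by ring
  have hsecond : ‖kernelModulation α n u * (Real.cos (u / 2) * (α - 1) * chord u ^ (α - 2) : ℝ)‖ ≤
      15 * (1 - α) * u ^ (α - 2) := calc
    _ ≤ 5 * (1 * (1 - α) * (3 * u ^ (α - 2))) := by
        rw [norm_mul, Complex.norm_real, norm_mul, norm_mul, Real.norm_eq_abs, Real.norm_eq_abs,
          Real.norm_of_nonneg (by positivity), abs_sub_comm, abs_of_pos h1α]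
        gcongr
        · exact norm_kernelModulation_le ⟨hα₀, hα₁⟩ n hu hnu
        · exact Real.abs_cos_le_one _
    _ = _ := by ring
  have hpow : 0 ≤ u ^ (α - 2) := by positivity
  rw [(hasDerivAt_kernelAmplitude n hu).deriv]
  nlinarith [norm_add_le_of_le hfirst hsecond]

lemma one_div_cesaroNumber_neg_le {n : ℕ} (hn : 1 ≤ n) :
    1 / cesaroNumber (-α) n ≤ (n : ℝ) ^ α / (1 - α) := by
  obtain ⟨k, rfl⟩ := Nat.exists_eq_add_of_le' hn
  have hle := le_cesaroNumber_neg hα.1.le hα.2.le k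
  rw [Real.rpow_neg (by positivity)] at hle
  rw [div_le_div_iff₀ (cesaroNumber_neg_pos hα.2 _) (sub_pos.2 hα.2), one_mul]
  push_cast
  calc 1 - α = ((k : ℝ) + 1) ^ α * ((1 - α) * (((k : ℝ) + 1) ^ α)⁻¹) := by field_simp
    _ ≤ _ := by gcongr

lemma intervalIntegrable_and_integral_norm_deriv_kernelAmplitude_le (n : ℕ) {t T : ℝ} (ht : 0 < t)
    (htT : t ≤ T) (hT : T ≤ π) (hnt : 1 ≤ ((n : ℝ) + 1) * t) :
    IntervalIntegrable (deriv (kernelAmplitude α n)) volume t T ∧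
      ∫ x in t..T, ‖deriv (kernelAmplitude α n) x‖ ≤ 24 / (1 - α) * t ^ (α - 1) := by
  have h1α : 0 < 1 - α := by linarith [hα.2]
  have h0 : (0 : ℝ) ∉ uIcc t T := by simp [uIcc_of_le htT, ht]
  have hmajorant : IntervalIntegrable (fun x : ℝ => 24 * x ^ (α - 2)) volume t T :=
    (intervalIntegral.intervalIntegrable_rpow (Or.inr h0)).const_mul _
  have hle (x : ℝ) (hx : x ∈ Icc t T) : ‖deriv (kernelAmplitude α n) x‖ ≤ 24 * x ^ (α - 2) :=
    norm_deriv_kernelAmplitude_le hα n ⟨ht.trans_le hx.1, hx.2.trans hT⟩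
      (hnt.trans (by have := hx.1; gcongr))
  have hint := intervalIntegrable_deriv_of_norm_le htT hmajorant hle
  refine ⟨hint, ?_⟩
  calc _ ≤ ∫ x in t..T, 24 * x ^ (α - 2) :=
        intervalIntegral.integral_mono_on htT hint.norm hmajorant hle
    _ = 24 / (1 - α) * t ^ (α - 1) - 24 / (1 - α) * T ^ (α - 1) := by
        rw [intervalIntegral.integral_const_mul,
          integral_rpow (Or.inr ⟨by linarith, h0⟩), show α - 2 + 1 = α - 1 by ring,
          ← neg_sub 1 α]
        field_simp
        ring
    _ ≤ _ := sub_le_self _ (by have := ht.trans_le htT; positivity)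

lemma abs_cesaroKernel_le_rpow {n : ℕ} (hn : 1 ≤ n) {t : ℝ} (ht : t ∈ Ioc 0 π)
    (hnt : 1 ≤ n * t) : |cesaroKernel (-α) n t| ≤ 15 / (1 - α) * n * (n * t) ^ (α - 1) := by
  have hn₀ : (0 : ℝ) < n := by exact_mod_cast hn
  have ht₀ := ht.1
  rw [cesaroKernel_eq_im α n ht, abs_div, abs_of_pos (cesaroNumber_neg_pos hα.2 n),
    div_eq_mul_one_div]
  calc _ ≤ (15 * t ^ (α - 1)) * ((n : ℝ) ^ α / (1 - α)) := by
        refine mul_le_mul ((Complex.abs_im_le_norm _).trans ?_)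
          (one_div_cesaroNumber_neg_le hα hn)
          (one_div_nonneg.2 (cesaroNumber_neg_pos hα.2 n).le) (by positivity)
        rw [norm_mul, Complex.norm_exp_ofReal_mul_I, one_mul]
        exact norm_kernelAmplitude_le hα n ht (by nlinarith)
    _ = _ := by
        rw [Real.mul_rpow hn₀.le ht₀.le, Real.rpow_sub_one hn₀.ne']
        field_simp

omit hα in
lemma integral_cesaroKernel_eq_im (n : ℕ) {t : ℝ} (ht : t ∈ Ioc 0 π) :
    ∫ x in t..π, cesaroKernel (-α) n x =
      (∫ x in t..π, Complex.exp (kernelPhase α n x * I) * kernelAmplitude α n x).im /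
        cesaroNumber (-α) n := by
  have hsub (x : ℝ) (hx : x ∈ uIcc t π) : x ∈ Ioc 0 π := by
    rw [uIcc_of_le ht.2] at hx
    exact ⟨ht.1.trans_le hx.1, hx.2⟩
  have hint : IntervalIntegrable
      (fun x : ℝ => Complex.exp (kernelPhase α n x * I) * kernelAmplitude α n x) volume t π := by
    refine ContinuousOn.intervalIntegrable (ContinuousOn.mul ?_ fun x hx =>
      (hasDerivAt_kernelAmplitude n (hsub x hx)).continuousAt.continuousWithinAt)
    unfold kernelPhase
    fun_prop
  rw [← Complex.imCLM_apply, ← ContinuousLinearMap.intervalIntegral_comp_comm _ hint,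
    ← intervalIntegral.integral_div]
  exact intervalIntegral.integral_congr fun x hx => cesaroKernel_eq_im α n (hsub x hx)

lemma abs_integral_cesaroKernel_le {n : ℕ} (hn : 1 ≤ n) {t : ℝ} (ht : t ∈ Ioc 0 π)
    (hnt : 1 ≤ n * t) : |∫ x in t..π, cesaroKernel (-α) n x| ≤
      (30 + 24 / (1 - α)) / (1 - α) * (n * t) ^ (α - 1) := by
  obtain ⟨ht₀, htπ⟩ := ht
  have h1α : 0 < 1 - α := by linarith [hα.2]
  have hn₀ : (0 : ℝ) < n := by exact_mod_cast hn
  have hnt' : 1 ≤ ((n : ℝ) + 1) * t := by nlinarith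
  have hsub : Icc t π ⊆ Ioc 0 π := fun x hx => ⟨ht₀.trans_le hx.1, hx.2⟩
  have hdiff (x : ℝ) (hx : x ∈ Icc t π) : DifferentiableAt ℝ (kernelAmplitude α n) x :=
    (hasDerivAt_kernelAmplitude n (hsub hx)).differentiableAt
  obtain ⟨hint, hderiv⟩ :=
    intervalIntegrable_and_integral_norm_deriv_kernelAmplitude_le hα n ht₀ htπ le_rfl hnt'
  have hosc : ‖∫ x in t..π, Complex.exp (kernelPhase α n x * I) * kernelAmplitude α n x‖ ≤
      (30 + 24 / (1 - α)) * t ^ (α - 1) / n := by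
    refine (norm_integral_exp_mul_le (hn₀.trans_le (kernelFreq_ge hα n)) _ htπ hdiff hint).trans
      (div_le_div₀ (by positivity) ?_ hn₀ (kernelFreq_ge hα n))
    have hleft := norm_kernelAmplitude_le hα n ⟨ht₀, htπ⟩ hnt'
    have hright := norm_kernelAmplitude_le hα n ⟨Real.pi_pos, le_rfl⟩ (hnt'.trans (by gcongr))
    have hmono : π ^ (α - 1) ≤ t ^ (α - 1) :=
      Real.rpow_le_rpow_of_nonpos ht₀ htπ (by linarith)
    linarith
  rw [integral_cesaroKernel_eq_im n ⟨ht₀, htπ⟩, abs_div,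
    abs_of_pos (cesaroNumber_neg_pos hα.2 n), div_eq_mul_one_div]
  calc _ ≤ ((30 + 24 / (1 - α)) * t ^ (α - 1) / n) * ((n : ℝ) ^ α / (1 - α)) :=
        mul_le_mul ((Complex.abs_im_le_norm _).trans hosc) (one_div_cesaroNumber_neg_le hα hn)
          (one_div_nonneg.2 (cesaroNumber_neg_pos hα.2 n).le) (by positivity)
    _ = _ := by
        rw [Real.mul_rpow hn₀.le ht₀.le, Real.rpow_sub_one hn₀.ne']
        field_simp

lemma exists_cesaroKernel_bounds : ∃ C : ℝ, 0 < C ∧ ∀ n : ℕ, 1 ≤ n →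
    (∀ t, |cesaroKernel (-α) n t| ≤ C * n) ∧
    (∀ t, t ≤ π → 1 ≤ n * t → |cesaroKernel (-α) n t| ≤ C * n * (n * t) ^ (α - 1)) ∧
    (∀ t, t ≤ π → 1 ≤ n * t →
      |∫ x in t..π, cesaroKernel (-α) n x| ≤ C * (n * t) ^ (α - 1)) := by
  have h1α : 0 < 1 - α := by linarith [hα.2]
  have hq : 0 < 24 / (1 - α) := by positivity
  refine ⟨(30 + 24 / (1 - α)) / (1 - α), by positivity, fun n hn => ?_⟩
  have hn₁ : (1 : ℝ) ≤ n := by exact_mod_cast hn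
  have hpos {t : ℝ} (hnt : 1 ≤ n * t) : 0 < t :=
    pos_of_mul_pos_right (one_pos.trans_le hnt) n.cast_nonneg
  refine ⟨fun t => ?_, fun t htπ hnt => ?_, fun t htπ hnt =>
    abs_integral_cesaroKernel_le hα hn ⟨hpos hnt, htπ⟩ hnt⟩
  · refine (abs_cesaroKernel_le hα.1.le hα.2 n t).trans ?_
    rw [div_mul_eq_mul_div]
    gcongr
    nlinarith
  · refine (abs_cesaroKernel_le_rpow hα hn ⟨hpos hnt, htπ⟩ hnt).trans ?_
    have := hpos hnt
    gcongr
    linarith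

end KernelBounds

/-! ### Weights -/

/-- The sequence `n ^ (1 - s) / log (n + 1) ^ p`. -/
def powLogSeq (s p : ℝ) (n : ℕ) : ℝ := (n : ℝ) ^ (1 - s) / Real.log (n + 1) ^ p

/-- The rate `(j + 1) ^ (-β) / log (j + 2) ^ p` at which weighted sums of increments of functions of
bounded variation for the sequence `powLogSeq (α + β) p` decay. -/
def tailRate (β p : ℝ) (j : ℕ) : ℝ := ((j : ℝ) + 1) ^ (-β) / Real.log (j + 2) ^ p

lemma log_natCast_add_two_pos (j : ℕ) : 0 < Real.log (j + 2) :=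
  Real.log_pos (by linarith [j.cast_nonneg (α := ℝ)])

lemma powLogSeq_succ (s p : ℝ) (l : ℕ) :
    powLogSeq s p (l + 1) = ((l : ℝ) + 1) ^ (1 - s) / Real.log (l + 2) ^ p := by
  simp only [powLogSeq, Nat.cast_add_one, add_assoc, one_add_one_eq_two]

lemma powLogSeq_succ_pos (s p : ℝ) (l : ℕ) : 0 < powLogSeq s p (l + 1) := by
  have := log_natCast_add_two_pos l
  rw [powLogSeq_succ]
  positivity

lemma tailRate_pos (β p : ℝ) (j : ℕ) : 0 < tailRate β p j := by
  have := log_natCast_add_two_pos j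
  unfold tailRate
  positivity

lemma log_add_one_le_mul_rpow {δ x y : ℝ} (hδ : 0 < δ) (hx : 1 ≤ x) (hxy : x ≤ y) :
    Real.log (y + 1) ≤ (1 + 1 / (δ * Real.log 2)) * (y / x) ^ δ * Real.log (x + 1) := by
  have hx₀ : 0 < x := by linarith
  have hy₀ : 0 < y := by linarith
  have hlog₂ : 0 < Real.log 2 := Real.log_pos one_lt_two
  have hlog : Real.log 2 ≤ Real.log (x + 1) := Real.log_le_log two_pos (by linarith)
  have hsplit : Real.log (y + 1) ≤ Real.log (x + 1) + Real.log (y / x) := by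
    rw [← Real.log_mul (by positivity) (by positivity)]
    refine Real.log_le_log (by positivity) ?_
    rw [mul_div_assoc', le_div_iff₀ hx₀]
    nlinarith
  have hquot : Real.log (y / x) ≤ 1 / (δ * Real.log 2) * (y / x) ^ δ * Real.log (x + 1) :=
    calc Real.log (y / x) ≤ (y / x) ^ δ / δ := Real.log_le_rpow_div (by positivity) hδ
      _ = 1 / (δ * Real.log 2) * (y / x) ^ δ * Real.log 2 := by field_simp
      _ ≤ _ := by gcongr
  have hpow : 1 ≤ (y / x) ^ δ := Real.one_le_rpow ((one_le_div hx₀).2 hxy) hδ.le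
  nlinarith

lemma exists_rpow_mul_log_le {κ p : ℝ} (hκ : 0 < κ) (hp : 0 < p) : ∃ C : ℝ, 1 ≤ C ∧
    ∀ x y : ℝ, 1 ≤ x → x ≤ y →
      x ^ κ * Real.log (y + 1) ^ p ≤ C * (y ^ κ * Real.log (x + 1) ^ p) := by
  have : 0 < Real.log 2 := Real.log_pos one_lt_two
  set B := 1 + 1 / (κ / p * Real.log 2) with hB
  have hB₁ : 1 ≤ B := by rw [hB, le_add_iff_nonneg_right]; positivity
  refine ⟨B ^ p, Real.one_le_rpow hB₁ hp.le, fun x y hx hxy => ?_⟩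
  have hx₀ : 0 < x := by linarith
  have hy₀ : 0 < y := by linarith
  have hlogx : 0 < Real.log (x + 1) := Real.log_pos (by linarith)
  have hlogy : 0 < Real.log (y + 1) := Real.log_pos (by linarith)
  calc x ^ κ * Real.log (y + 1) ^ p
      ≤ x ^ κ * (B * (y / x) ^ (κ / p) * Real.log (x + 1)) ^ p := by
        gcongr
        exact log_add_one_le_mul_rpow (div_pos hκ hp) hx hxy
    _ = x ^ κ * (B ^ p * (y / x) ^ κ * Real.log (x + 1) ^ p) := by
        rw [Real.mul_rpow (by positivity) hlogx.le, Real.mul_rpow (by positivity) (by positivity),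
          ← Real.rpow_mul (by positivity), div_mul_cancel₀ _ hp.ne']
    _ = _ := by
        rw [Real.div_rpow hy₀.le hx₀.le]
        field_simp

lemma exists_weight_mul_powLogSeq_le {α β p : ℝ} (hβ : 0 ≤ β) (hαβ : α + β < 1) (hp : 0 < p) :
    ∃ C : ℝ, 0 < C ∧ ∀ j l : ℕ,
      ((j + l : ℕ) + 1 : ℝ) ^ (α - 1) * powLogSeq (α + β) p (l + 1) ≤ C * tailRate β p j := by
  obtain ⟨C, hC₁, hC⟩ := exists_rpow_mul_log_le (κ := 1 - (α + β)) (p := p) (by linarith) hp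
  refine ⟨C, by linarith, fun j l => ?_⟩
  have hlogj := log_natCast_add_two_pos j
  have hlogl := log_natCast_add_two_pos l
  have hcancel (x : ℝ) (hx : 0 < x) : x ^ (α - 1) * x ^ (1 - (α + β)) = x ^ (-β) := by
    rw [← Real.rpow_add hx]
    ring_nf
  have hweight (k : ℕ) (hk : k ≤ j + l) :
      ((j + l : ℕ) + 1 : ℝ) ^ (α - 1) ≤ ((k : ℝ) + 1) ^ (α - 1) :=
    Real.rpow_le_rpow_of_nonpos (by positivity) (by gcongr) (by linarith)
  rw [powLogSeq_succ, tailRate]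
  rcases le_total j l with hjl | hlj
  · calc _ ≤ ((l : ℝ) + 1) ^ (α - 1) *
          (((l : ℝ) + 1) ^ (1 - (α + β)) / Real.log (l + 2) ^ p) := by
          exact mul_le_mul_of_nonneg_right (hweight l (by lia)) (by positivity)
      _ = ((l : ℝ) + 1) ^ (-β) / Real.log (l + 2) ^ p := by
          rw [← mul_div_assoc, hcancel _ (by positivity)]
      _ ≤ 1 * (((j : ℝ) + 1) ^ (-β) / Real.log (j + 2) ^ p) := by
          rw [one_mul]
          exact div_le_div₀ (by positivity)
            (Real.rpow_le_rpow_of_nonpos (by positivity) (by gcongr) (by linarith))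
            (by positivity) (by gcongr)
      _ ≤ _ := by gcongr
  · have halmost : ((l : ℝ) + 1) ^ (1 - (α + β)) * Real.log (j + 2) ^ p ≤
        C * (((j : ℝ) + 1) ^ (1 - (α + β)) * Real.log (l + 2) ^ p) := by
      simpa only [add_assoc, one_add_one_eq_two] using
        hC (l + 1) (j + 1) (by simp) (by gcongr)
    calc _ ≤ ((j : ℝ) + 1) ^ (α - 1) *
          (C * (((j : ℝ) + 1) ^ (1 - (α + β)) / Real.log (j + 2) ^ p)) := by
          refine mul_le_mul (hweight j (by lia)) ?_ (by positivity) (by positivity)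
          rw [mul_div_assoc', div_le_div_iff₀ (by positivity) (by positivity)]
          linarith
      _ = _ := by
          rw [← hcancel _ (by positivity)]
          ring

lemma condensed_one_div_mul_log_rpow_le {p : ℝ} (hp : 0 ≤ p) {k : ℕ} (hk : 0 < k) :
    2 ^ k * (1 / (((2 ^ k : ℕ) : ℝ) * Real.log ((2 ^ k : ℕ) + 1) ^ p)) ≤
      1 / Real.log 2 ^ p * (1 / (k : ℝ) ^ p) := by
  have hlog₂ : 0 < Real.log 2 := Real.log_pos one_lt_two
  have hlog : k * Real.log 2 ≤ Real.log ((2 ^ k : ℕ) + 1) := by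
    rw [← Real.log_pow]
    exact Real.log_le_log (by positivity) (by simp)
  calc _ = 1 / Real.log ((2 ^ k : ℕ) + 1) ^ p := by
        push_cast
        field_simp
    _ ≤ 1 / (k * Real.log 2) ^ p := by gcongr
    _ = _ := by
        rw [Real.mul_rpow (by positivity) hlog₂.le]
        field_simp

lemma summable_one_div_mul_log_rpow {p : ℝ} (hp : 1 < p) :
    Summable fun j : ℕ => 1 / (((j : ℝ) + 1) * Real.log (j + 2) ^ p) := by
  let f : ℕ → ℝ := fun n => 1 / ((n : ℝ) * Real.log (n + 1) ^ p)
  have hf_nonneg (n : ℕ) : 0 ≤ f n := by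
    have : 0 ≤ Real.log (n + 1) := Real.log_nonneg (by simp)
    positivity
  have hf_anti : ∀ ⦃m n : ℕ⦄, 0 < m → m ≤ n → f n ≤ f m := by
    intro m n hm hmn
    have : 0 < Real.log (m + 1) := Real.log_pos (by simpa using hm)
    simp only [f]
    gcongr
  suffices hf : Summable f by
    refine ((summable_nat_add_iff 1).2 hf).congr fun j => ?_
    simp only [f, Nat.cast_add_one, add_assoc, one_add_one_eq_two]
  rw [← summable_condensed_iff_of_nonneg hf_nonneg hf_anti, ← summable_nat_add_iff 1]
  have hzeta : Summable fun k : ℕ => 1 / Real.log 2 ^ p * (1 / ((k + 1 : ℕ) : ℝ) ^ p) :=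
    ((summable_nat_add_iff 1).2 (Real.summable_one_div_nat_rpow.2 hp)).mul_left _
  exact hzeta.of_nonneg_of_le (fun k => mul_nonneg (by positivity) (hf_nonneg _))
    fun k => condensed_one_div_mul_log_rpow_le (by linarith) k.succ_pos

/-- The sum over `j` of `(j + 1) ^ (β - 1)` times the tail rate at `max j R`. It tends to zero with
`R → ∞`, which is where the condition `p > 1` on the exponent of the logarithm enters. -/
def tailSum (β p : ℝ) (R : ℕ) : ℝ :=
  ∑' j : ℕ, ((j : ℝ) + 1) ^ (β - 1) * tailRate β p (max j R)

section Tail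

variable {β p : ℝ}

lemma tailRate_antitone (hβ : 0 ≤ β) (hp : 0 ≤ p) : Antitone (tailRate β p) := by
  intro i j hij
  have := log_natCast_add_two_pos i
  exact div_le_div₀ (by positivity)
    (Real.rpow_le_rpow_of_nonpos (by positivity) (by gcongr) (by linarith))
    (by positivity) (by gcongr)

lemma tendsto_tailRate (hβ : 0 < β) (hp : 0 ≤ p) : Tendsto (tailRate β p) atTop (𝓝 0) := by
  have hpow : Tendsto (fun j : ℕ => ((j : ℝ) + 1) ^ (-β)) atTop (𝓝 0) :=
    (tendsto_rpow_neg_atTop hβ).comp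
      (tendsto_atTop_add_const_right _ _ tendsto_natCast_atTop_atTop)
  have : 0 < Real.log 2 := Real.log_pos one_lt_two
  refine squeeze_zero (fun j => (tailRate_pos β p j).le) (fun j => ?_)
    (by simpa using hpow.div_const (Real.log 2 ^ p))
  have hlog : Real.log 2 ≤ Real.log (j + 2) := Real.log_le_log two_pos (by simp)
  unfold tailRate
  gcongr

lemma weight_mul_tailRate_nonneg (β p : ℝ) (j R : ℕ) :
    0 ≤ ((j : ℝ) + 1) ^ (β - 1) * tailRate β p R :=
  mul_nonneg (by positivity) (tailRate_pos _ _ _).le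

lemma weight_mul_tailRate_max_le (hβ : 0 ≤ β) (hp : 0 ≤ p) (j R : ℕ) :
    ((j : ℝ) + 1) ^ (β - 1) * tailRate β p (max j R) ≤
      1 / (((j : ℝ) + 1) * Real.log (j + 2) ^ p) :=
  calc _ ≤ ((j : ℝ) + 1) ^ (β - 1) * tailRate β p j := by
        gcongr
        exact tailRate_antitone hβ hp (le_max_left _ _)
    _ = ((j : ℝ) + 1) ^ (β - 1 + -β) / Real.log (j + 2) ^ p := by
        rw [tailRate, mul_div_assoc', Real.rpow_add (by positivity)]
    _ = _ := by
        rw [show β - 1 + -β = -1 by ring, Real.rpow_neg_one, inv_eq_one_div, div_div]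

lemma sum_weight_mul_tailRate_le_tailSum (hβ : 0 ≤ β) (hp : 1 < p) (m R : ℕ) :
    ∑ j ∈ Finset.range m, ((j : ℝ) + 1) ^ (β - 1) * tailRate β p (max j R) ≤ tailSum β p R :=
  ((summable_one_div_mul_log_rpow hp).of_nonneg_of_le
    (fun j => weight_mul_tailRate_nonneg β p j _)
    fun j => weight_mul_tailRate_max_le hβ (by linarith) j R).sum_le_tsum _
      fun j _ => weight_mul_tailRate_nonneg β p j _

lemma tendsto_tailSum (hβ : 0 < β) (hp : 1 < p) : Tendsto (tailSum β p) atTop (𝓝 0) := by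
  have hp₀ : 0 ≤ p := by linarith
  have hpointwise (j : ℕ) : Tendsto
      (fun R => ((j : ℝ) + 1) ^ (β - 1) * tailRate β p (max j R)) atTop (𝓝 0) := by
    have hmax : Tendsto (fun R : ℕ => max j R) atTop atTop :=
      tendsto_atTop_mono (fun R => le_max_right j R) tendsto_id
    simpa using ((tendsto_tailRate hβ hp₀).comp hmax).const_mul (((j : ℝ) + 1) ^ (β - 1))
  rw [← tsum_zero (β := ℕ)]
  refine tendsto_tsum_of_dominated_convergence (summable_one_div_mul_log_rpow hp) hpointwise
    (Eventually.of_forall fun R j => ?_)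
  rw [Real.norm_of_nonneg (weight_mul_tailRate_nonneg β p j _)]
  exact weight_mul_tailRate_max_le hβ.le hp₀ j R

end Tail

lemma weight_le_one {α : ℝ} (hα : α ≤ 1) (i : ℕ) : ((i : ℝ) + 1) ^ (α - 1) ≤ 1 :=
  Real.rpow_le_one_of_one_le_of_nonpos (by simp) (by linarith)

lemma sum_range_eq_sum_range_min_add_sum_Ico (F : ℕ → ℝ) (n R : ℕ) :
    ∑ i ∈ Finset.range n, F i =
      ∑ i ∈ Finset.range (min n R), F i + ∑ i ∈ Finset.Ico R n, F i := by
  rcases le_total n R with h | h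
  · simp [h]
  · rw [min_eq_right h, Finset.sum_range_add_sum_Ico _ h]

lemma sum_sum_le_corner_add_strips {n m : ℕ} {F : ℕ → ℕ → ℝ}
    (hF : ∀ i < n, ∀ j < m, 0 ≤ F i j) (R : ℕ) :
    ∑ i ∈ Finset.range n, ∑ j ∈ Finset.range m, F i j ≤
      ∑ i ∈ Finset.range (min n R), ∑ j ∈ Finset.range (min m R), F i j +
        (∑ j ∈ Finset.range m, ∑ i ∈ Finset.Ico (max j R) n, F i j +
          ∑ i ∈ Finset.range n, ∑ j ∈ Finset.Ico (max i R) m, F i j) := by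
  let s : Finset (ℕ × ℕ) := Finset.range n ×ˢ Finset.range m
  have hcorner : ∑ i ∈ Finset.range (min n R), ∑ j ∈ Finset.range (min m R), F i j =
      ∑ q ∈ s, if q.1 < R ∧ q.2 < R then F q.1 q.2 else 0 := by
    rw [← Finset.sum_product', ← Finset.sum_filter]
    refine Finset.sum_congr ?_ fun _ _ => rfl
    ext
    simp [s]
    tauto
  have hright : ∑ j ∈ Finset.range m, ∑ i ∈ Finset.Ico (max j R) n, F i j =
      ∑ q ∈ s, if max q.2 R ≤ q.1 then F q.1 q.2 else 0 := by
    rw [Finset.sum_product_right]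
    refine Finset.sum_congr rfl fun j _ => ?_
    rw [← Finset.sum_filter]
    refine Finset.sum_congr ?_ fun _ _ => rfl
    ext
    simp
    tauto
  have htop : ∑ i ∈ Finset.range n, ∑ j ∈ Finset.Ico (max i R) m, F i j =
      ∑ q ∈ s, if max q.1 R ≤ q.2 then F q.1 q.2 else 0 := by
    rw [Finset.sum_product]
    refine Finset.sum_congr rfl fun i _ => ?_
    rw [← Finset.sum_filter]
    refine Finset.sum_congr ?_ fun _ _ => rfl
    ext
    simp
    tauto
  rw [hcorner, hright, htop, ← Finset.sum_product', ← Finset.sum_add_distrib,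
    ← Finset.sum_add_distrib]
  refine Finset.sum_le_sum fun q hq => ?_
  have hq₀ : 0 ≤ F q.1 q.2 := by
    simp only [Finset.mem_product, Finset.mem_range] at hq
    exact hF q.1 hq.1 q.2 hq.2
  split_ifs <;> first | linarith | lia

lemma sum_weight_le {α β p : ℝ} (hα : α ≤ 1) {d : ℕ → ℝ} {n R : ℕ} {B δ : ℝ} (hδ : 0 ≤ δ)
    (htail : ∑ i ∈ Finset.Ico R n, ((i : ℝ) + 1) ^ (α - 1) * d i ≤ B * tailRate β p R)
    (hhead : ∀ i < n, i < R → d i ≤ δ) :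
    ∑ i ∈ Finset.range n, ((i : ℝ) + 1) ^ (α - 1) * d i ≤ δ * R + B * tailRate β p R := by
  rw [sum_range_eq_sum_range_min_add_sum_Ico _ n R]
  refine add_le_add ?_ htail
  calc _ ≤ ∑ _i ∈ Finset.range (min n R), δ := Finset.sum_le_sum fun i hi => by
        have hi := lt_min_iff.1 (Finset.mem_range.1 hi)
        calc _ ≤ ((i : ℝ) + 1) ^ (α - 1) * δ := by gcongr; exact hhead i hi.1 hi.2
          _ ≤ δ := mul_le_of_le_one_left hδ (weight_le_one hα i)
    _ = (min n R : ℕ) * δ := by simp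
    _ ≤ δ * R := by
        rw [mul_comm]
        gcongr
        exact min_le_right n R

lemma sum_weight_mul_sum_Ico_le_tailSum {β p : ℝ} (hβ : 0 ≤ β) (hp : 1 < p) {F : ℕ → ℕ → ℝ}
    {n m R : ℕ} {B : ℝ} (hB : 0 ≤ B)
    (htail : ∀ j < m, ∀ k, ∑ i ∈ Finset.Ico k n, F i j ≤ B * tailRate β p k) :
    ∑ j ∈ Finset.range m, ((j : ℝ) + 1) ^ (β - 1) * ∑ i ∈ Finset.Ico (max j R) n, F i j ≤
      B * tailSum β p R :=
  calc _ ≤ ∑ j ∈ Finset.range m, B * (((j : ℝ) + 1) ^ (β - 1) * tailRate β p (max j R)) :=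
        Finset.sum_le_sum fun j hj => by
          rw [mul_left_comm B]
          gcongr
          exact htail j (Finset.mem_range.1 hj) _
    _ ≤ _ := by
        rw [← Finset.mul_sum]
        exact mul_le_mul_of_nonneg_left (sum_weight_mul_tailRate_le_tailSum hβ hp m R) hB

lemma sum_sum_weight_le {α β p : ℝ} (hα : α ∈ Icc (0 : ℝ) 1) (hβ : β ∈ Icc (0 : ℝ) 1) (hp : 1 < p)
    {D : ℕ → ℕ → ℝ} {n m R : ℕ} {B δ : ℝ} (hδ : 0 ≤ δ) (hB : 0 ≤ B)
    (hD : ∀ i < n, ∀ j < m, 0 ≤ D i j)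
    (htail₁ : ∀ j < m, ∀ k,
      ∑ i ∈ Finset.Ico k n, ((i : ℝ) + 1) ^ (α - 1) * D i j ≤ B * tailRate β p k)
    (htail₂ : ∀ i < n, ∀ k,
      ∑ j ∈ Finset.Ico k m, ((j : ℝ) + 1) ^ (β - 1) * D i j ≤ B * tailRate α p k)
    (hcorner : ∀ i < n, ∀ j < m, i < R → j < R → D i j ≤ δ) :
    ∑ i ∈ Finset.range n, ∑ j ∈ Finset.range m,
      ((i : ℝ) + 1) ^ (α - 1) * (((j : ℝ) + 1) ^ (β - 1) * D i j) ≤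
      δ * R ^ 2 + B * (tailSum β p R + tailSum α p R) := by
  refine (sum_sum_le_corner_add_strips (fun i hi j hj => ?_) R).trans ?_
  · have := hD i hi j hj
    positivity
  rw [mul_add]
  refine add_le_add ?_ (add_le_add ?_ ?_)
  · calc _ ≤ ∑ _i ∈ Finset.range (min n R), ∑ _j ∈ Finset.range (min m R), δ := by
          refine Finset.sum_le_sum fun i hi => Finset.sum_le_sum fun j hj => ?_
          have hi := lt_min_iff.1 (Finset.mem_range.1 hi)
          have hj := lt_min_iff.1 (Finset.mem_range.1 hj)
          have := hD i hi.1 j hj.1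
          calc _ ≤ 1 * (1 * D i j) := by
                gcongr
                exacts [weight_le_one hα.2 i, weight_le_one hβ.2 j]
            _ ≤ δ := by simpa using hcorner i hi.1 j hj.1 hi.2 hj.2
      _ = δ * ((min n R : ℕ) * (min m R : ℕ)) := by
          simp only [Finset.sum_const, Finset.card_range, nsmul_eq_mul]
          ring
      _ ≤ δ * R ^ 2 := by
          rw [pow_two]
          gcongr
          exacts [min_le_right n R, min_le_right m R]
  · refine le_trans (le_of_eq ?_)
      (sum_weight_mul_sum_Ico_le_tailSum (R := R) hβ.1 hp hB htail₁)
    simp only [Finset.mul_sum]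
    exact Finset.sum_congr rfl fun j _ => Finset.sum_congr rfl fun i _ => mul_left_comm _ _ _
  · simpa only [Finset.mul_sum] using
      sum_weight_mul_sum_Ico_le_tailSum (F := fun j i => ((j : ℝ) + 1) ^ (β - 1) * D i j) (R := R)
        hα.1 hp hB htail₂

/-! ### Functionals given by a point evaluation and finitely many increments -/

/-- The data of a linear functional on functions of one variable: an evaluation at `τ`, with
coefficient `c`, plus two families of `n` increments over the intervals `[a e i, b e i]`, with
coefficients `coeff e i`. Integration against a Cesàro kernel is an average of such functionals. -/
structure IncrementFunctional where
  n : ℕ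
  c : ℝ
  τ : ℝ
  coeff : Fin 2 → ℕ → ℝ
  a : Fin 2 → ℕ → ℝ
  b : Fin 2 → ℕ → ℝ

/-- The sums of increments of `g` over consecutive intervals in `(0, 2π]`, divided by the sequence
`lam` in the order of the intervals, are at most `V`. -/
def IncVarLE (lam : ℕ → ℝ) (V : ℝ) (g : ℝ → ℝ) : Prop :=
  ∀ (n : ℕ) (a b : ℕ → ℝ), (∀ i < n, 0 < a i ∧ a i < b i ∧ b i ≤ 2 * π) →
    (∀ i, i + 1 < n → b i ≤ a (i + 1)) →
    ∑ i ∈ Finset.range n, |g (b i) - g (a i)| / lam (i + 1) ≤ V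

namespace IncrementFunctional

/-- The increment of a function over the `i`-th interval of the family `e`. -/
def increment (L : IncrementFunctional) (e : Fin 2) (i : ℕ) (ϕ : ℝ → ℝ) : ℝ :=
  ϕ (L.b e i) - ϕ (L.a e i)

/-- The value of the functional at a function. -/
def eval (L : IncrementFunctional) (ϕ : ℝ → ℝ) : ℝ :=
  L.c * ϕ L.τ + ∑ e, ∑ i ∈ Finset.range L.n, L.coeff e i * L.increment e i ϕ

/-- The functional behaves like integration against a kernel of order `-α` at scale `h`: its
coefficients are `O((i + 1) ^ (α - 1))`, the intervals of each family are consecutive in `(0, 2π]`,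
and the `i`-th of them lies in `(0, (i + 2) * h]`. -/
structure IsAdmissible (L : IncrementFunctional) (α C h : ℝ) : Prop where
  abs_c_le : |L.c| ≤ C
  τ_pos : 0 < L.τ
  τ_le : L.τ ≤ h
  abs_coeff_le : ∀ e, ∀ i < L.n, |L.coeff e i| ≤ C * ((i : ℝ) + 1) ^ (α - 1)
  a_pos : ∀ e, ∀ i < L.n, 0 < L.a e i
  a_lt_b : ∀ e, ∀ i < L.n, L.a e i < L.b e i
  b_le_two_pi : ∀ e, ∀ i < L.n, L.b e i ≤ 2 * π
  b_le : ∀ e, ∀ i < L.n, L.b e i ≤ (i + 2) * h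
  b_le_a_succ : ∀ e i, i + 1 < L.n → L.b e i ≤ L.a e (i + 1)

/-- The tails of the weighted sums of increments of `g` decay at the rate `tailRate β p`. -/
def TailLE (L : IncrementFunctional) (α β p B : ℝ) (g : ℝ → ℝ) : Prop :=
  ∀ e k, ∑ i ∈ Finset.Ico k L.n, ((i : ℝ) + 1) ^ (α - 1) * |L.increment e i g| ≤
    B * tailRate β p k

lemma increment_sub (L : IncrementFunctional) (e : Fin 2) (i : ℕ) (ϕ ψ : ℝ → ℝ) :
    L.increment e i (fun t => ϕ t - ψ t) = L.increment e i ϕ - L.increment e i ψ :=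
  sub_sub_sub_comm _ _ _ _

lemma eval_sub (L : IncrementFunctional) (ϕ ψ : ℝ → ℝ) :
    L.eval (fun t => ϕ t - ψ t) = L.eval ϕ - L.eval ψ := by
  simp only [eval, increment_sub, mul_sub, Finset.sum_sub_distrib]
  ring

lemma TailLE.mono {L : IncrementFunctional} {α β p B B' : ℝ} {g : ℝ → ℝ}
    (hg : L.TailLE α β p B g) (hB : B ≤ B') : L.TailLE α β p B' g := fun e k =>
  (hg e k).trans (mul_le_mul_of_nonneg_right hB (tailRate_pos β p k).le)

lemma TailLE.sub {L : IncrementFunctional} {α β p B B' : ℝ} {g g' : ℝ → ℝ}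
    (hg : L.TailLE α β p B g) (hg' : L.TailLE α β p B' g') :
    L.TailLE α β p (B + B') fun t => g t - g' t := by
  intro e k
  calc _ ≤ ∑ i ∈ Finset.Ico k L.n, (((i : ℝ) + 1) ^ (α - 1) * |L.increment e i g| +
        ((i : ℝ) + 1) ^ (α - 1) * |L.increment e i g'|) :=
        Finset.sum_le_sum fun i _ => by
          rw [← mul_add, increment_sub]
          gcongr
          exact abs_sub _ _
    _ ≤ _ := by
        rw [Finset.sum_add_distrib, add_mul]
        exact add_le_add (hg e k) (hg' e k)

namespace IsAdmissible

variable {L : IncrementFunctional} {α C h : ℝ}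

lemma mono (hL : L.IsAdmissible α C h) {C' : ℝ} (hC : C ≤ C') : L.IsAdmissible α C' h :=
  { hL with
    abs_c_le := hL.abs_c_le.trans hC
    abs_coeff_le := fun e i hi => (hL.abs_coeff_le e i hi).trans
      (mul_le_mul_of_nonneg_right hC (by positivity)) }

lemma const_nonneg (hL : L.IsAdmissible α C h) : 0 ≤ C := (abs_nonneg _).trans hL.abs_c_le

lemma scale_pos (hL : L.IsAdmissible α C h) : 0 < h := hL.τ_pos.trans_le hL.τ_le

lemma τ_mem (hL : L.IsAdmissible α C h) (R : ℕ) : L.τ ∈ Ioc 0 ((R + 1) * h) :=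
  ⟨hL.τ_pos, hL.τ_le.trans (le_mul_of_one_le_left hL.scale_pos.le (by simp))⟩

lemma b_mem (hL : L.IsAdmissible α C h) {R : ℕ} (e : Fin 2) {i : ℕ} (hi : i < L.n) (hiR : i < R) :
    L.b e i ∈ Ioc 0 ((R + 1) * h) := by
  refine ⟨(hL.a_pos e i hi).trans (hL.a_lt_b e i hi), (hL.b_le e i hi).trans ?_⟩
  have : (i : ℝ) + 1 ≤ R := by exact_mod_cast hiR
  exact mul_le_mul_of_nonneg_right (by linarith) hL.scale_pos.le

lemma a_mem (hL : L.IsAdmissible α C h) {R : ℕ} (e : Fin 2) {i : ℕ} (hi : i < L.n) (hiR : i < R) :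
    L.a e i ∈ Ioc 0 ((R + 1) * h) :=
  ⟨hL.a_pos e i hi, (hL.a_lt_b e i hi).le.trans (hL.b_mem e hi hiR).2⟩

lemma abs_increment_le (hL : L.IsAdmissible α C h) {R : ℕ} {g : ℝ → ℝ} {δ : ℝ}
    (hg : ∀ t ∈ Ioc 0 ((R + 1) * h), |g t| ≤ δ) (e : Fin 2) {i : ℕ} (hi : i < L.n) (hiR : i < R) :
    |L.increment e i g| ≤ 2 * δ :=
  (abs_sub _ _).trans <| by
    linarith [hg _ (hL.a_mem e hi hiR), hg _ (hL.b_mem e hi hiR)]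

lemma abs_eval_le (hL : L.IsAdmissible α C h) (ϕ : ℝ → ℝ) :
    |L.eval ϕ| ≤ C * (|ϕ L.τ| + ∑ e, ∑ i ∈ Finset.range L.n,
      ((i : ℝ) + 1) ^ (α - 1) * |L.increment e i ϕ|) := by
  rw [eval, mul_add, Finset.mul_sum]
  refine (abs_add_le _ _).trans (add_le_add ?_ ?_)
  · rw [abs_mul]
    exact mul_le_mul_of_nonneg_right hL.abs_c_le (abs_nonneg _)
  · refine (Finset.abs_sum_le_sum_abs _ _).trans (Finset.sum_le_sum fun e _ => ?_)
    rw [Finset.mul_sum]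
    refine (Finset.abs_sum_le_sum_abs _ _).trans (Finset.sum_le_sum fun i hi => ?_)
    rw [abs_mul, ← mul_assoc]
    exact mul_le_mul_of_nonneg_right (hL.abs_coeff_le e i (Finset.mem_range.1 hi)) (abs_nonneg _)

lemma sum_tail_le (hL : L.IsAdmissible α C h) {lam : ℕ → ℝ} {V : ℝ} {g : ℝ → ℝ}
    (hg : IncVarLE lam V g) (e : Fin 2) (k : ℕ) :
    ∑ l ∈ Finset.range (L.n - k), |L.increment e (k + l) g| / lam (l + 1) ≤ V :=
  hg (L.n - k) (fun l => L.a e (k + l)) (fun l => L.b e (k + l))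
    (fun i hi => ⟨hL.a_pos e _ (by lia), hL.a_lt_b e _ (by lia), hL.b_le_two_pi e _ (by lia)⟩)
    fun i hi => hL.b_le_a_succ e (k + i) (by lia)

end IsAdmissible

lemma exists_tailLE_of_incVarLE {α β p : ℝ} (hβ : 0 ≤ β) (hαβ : α + β < 1) (hp : 0 < p) :
    ∃ W : ℝ, 0 < W ∧ ∀ {L : IncrementFunctional} {C h V : ℝ} {g : ℝ → ℝ}, L.IsAdmissible α C h →
      IncVarLE (powLogSeq (α + β) p) V g → L.TailLE α β p (W * V) g := by
  obtain ⟨W, hW, hle⟩ := exists_weight_mul_powLogSeq_le hβ hαβ hp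
  refine ⟨W, hW, fun {L C h V g} hL hg e k => ?_⟩
  have hrate := tailRate_pos β p k
  rw [Finset.sum_Ico_eq_sum_range]
  calc _ ≤ ∑ l ∈ Finset.range (L.n - k),
        W * tailRate β p k * (|L.increment e (k + l) g| / powLogSeq (α + β) p (l + 1)) :=
        Finset.sum_le_sum fun l _ => by
          rw [mul_div_assoc', le_div_iff₀ (powLogSeq_succ_pos (α + β) p l), mul_right_comm]
          exact mul_le_mul_of_nonneg_right (hle k l) (abs_nonneg _)
    _ ≤ W * tailRate β p k * V := by
        rw [← Finset.mul_sum]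
        exact mul_le_mul_of_nonneg_left (hL.sum_tail_le hg e k) (by positivity)
    _ = _ := by ring

section TensorProduct

variable {α β p B C h h' δ : ℝ} {L L' : IncrementFunctional} {G : ℝ → ℝ → ℝ} {R : ℕ}

lemma IsAdmissible.sum_weight_abs_increment_le (hL : L.IsAdmissible α C h) (hα : α ≤ 1)
    {g : ℝ → ℝ} (hg : L.TailLE α β p B g) (hδ : ∀ t ∈ Ioc 0 ((R + 1) * h), |g t| ≤ δ) (e : Fin 2) :
    ∑ i ∈ Finset.range L.n, ((i : ℝ) + 1) ^ (α - 1) * |L.increment e i g| ≤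
      2 * δ * R + B * tailRate β p R := by
  have hδ₀ : 0 ≤ δ := (abs_nonneg _).trans (hδ _ (hL.τ_mem R))
  exact sum_weight_le hα (by positivity) (hg e R) fun i hi hiR => hL.abs_increment_le hδ e hi hiR

lemma sum_sum_weight_abs_increment_le (hL : L.IsAdmissible α C h) (hL' : L'.IsAdmissible β C h')
    (hα : α ∈ Icc (0 : ℝ) 1) (hβ : β ∈ Icc (0 : ℝ) 1) (hp : 1 < p) (hB : 0 ≤ B)
    (hG₁ : ∀ s, L.TailLE α β p B fun t => G t s) (hG₂ : ∀ t, L'.TailLE β α p B (G t))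
    (hδ : ∀ t ∈ Ioc 0 ((R + 1) * h), ∀ s ∈ Ioc 0 ((R + 1) * h'), |G t s| ≤ δ) (e e' : Fin 2) :
    ∑ i ∈ Finset.range L.n, ∑ j ∈ Finset.range L'.n, ((i : ℝ) + 1) ^ (α - 1) *
        (((j : ℝ) + 1) ^ (β - 1) * |L.increment e i fun t => L'.increment e' j (G t)|) ≤
      4 * δ * R ^ 2 + 2 * B * (tailSum β p R + tailSum α p R) := by
  have hδ₀ : 0 ≤ δ := (abs_nonneg _).trans (hδ _ (hL.τ_mem R) _ (hL'.τ_mem R))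
  refine sum_sum_weight_le hα hβ hp (by positivity) (by positivity) (fun _ _ _ _ => abs_nonneg _)
    (fun j _ k => ?_) (fun i _ k => ?_) fun i hi j hj hiR hjR => ?_
  · rw [two_mul]
    exact (hG₁ (L'.b e' j)).sub (hG₁ (L'.a e' j)) e k
  · rw [two_mul]
    have htail := (hG₂ (L.b e i)).sub (hG₂ (L.a e i)) e' k
    simp only [increment_sub] at htail
    exact htail
  · calc _ ≤ 2 * (2 * δ) :=
          hL.abs_increment_le (fun t ht => hL'.abs_increment_le (hδ t ht) e' hj hjR) e hi hiR
      _ = 4 * δ := by ring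

lemma sum_weight_abs_increment_eval_le (hL : L.IsAdmissible α C h)
    (hL' : L'.IsAdmissible β C h') (hα : α ∈ Icc (0 : ℝ) 1) (hβ : β ∈ Icc (0 : ℝ) 1) (hp : 1 < p)
    (hB : 0 ≤ B)
    (hG₁ : ∀ s, L.TailLE α β p B fun t => G t s) (hG₂ : ∀ t, L'.TailLE β α p B (G t))
    (hδ : ∀ t ∈ Ioc 0 ((R + 1) * h), ∀ s ∈ Ioc 0 ((R + 1) * h'), |G t s| ≤ δ) (e' : Fin 2) :
    ∑ j ∈ Finset.range L'.n, ((j : ℝ) + 1) ^ (β - 1) *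
        |L'.increment e' j fun s => L.eval fun t => G t s| ≤
      C * ((2 * δ * R + B * tailRate α p R) +
        2 * (4 * δ * R ^ 2 + 2 * B * (tailSum β p R + tailSum α p R))) := by
  calc _ ≤ ∑ j ∈ Finset.range L'.n, C * (((j : ℝ) + 1) ^ (β - 1) * |L'.increment e' j (G L.τ)| +
        ∑ e, ∑ i ∈ Finset.range L.n, ((i : ℝ) + 1) ^ (α - 1) *
          (((j : ℝ) + 1) ^ (β - 1) * |L.increment e i fun t => L'.increment e' j (G t)|)) := by
        refine Finset.sum_le_sum fun j _ => ?_
        rw [increment, ← eval_sub]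
        refine (mul_le_mul_of_nonneg_left (hL.abs_eval_le _) (by positivity)).trans_eq ?_
        simp only [mul_left_comm _ C, mul_add, Finset.mul_sum]
        simp only [mul_left_comm (((j : ℝ) + 1) ^ (β - 1)), increment]
    _ ≤ _ := by
        rw [← Finset.mul_sum, Finset.sum_add_distrib, Finset.sum_comm]
        refine mul_le_mul_of_nonneg_left (add_le_add ?_ ?_) hL.const_nonneg
        · exact hL'.sum_weight_abs_increment_le hβ.2 (hG₂ L.τ) (hδ _ (hL.τ_mem R)) e'
        · refine (Finset.sum_le_sum fun e _ => Finset.sum_comm.trans_le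
            (sum_sum_weight_abs_increment_le hL hL' hα hβ hp hB hG₁ hG₂ hδ e e')).trans_eq ?_
          simp [mul_add]

lemma abs_eval_eval_le (hL : L.IsAdmissible α C h) (hL' : L'.IsAdmissible β C h')
    (hα : α ∈ Icc (0 : ℝ) 1) (hβ : β ∈ Icc (0 : ℝ) 1) (hp : 1 < p) (hB : 0 ≤ B)
    (hG₁ : ∀ s, L.TailLE α β p B fun t => G t s) (hG₂ : ∀ t, L'.TailLE β α p B (G t))
    (hδ : ∀ t ∈ Ioc 0 ((R + 1) * h), ∀ s ∈ Ioc 0 ((R + 1) * h'), |G t s| ≤ δ) :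
    |L'.eval fun s => L.eval fun t => G t s| ≤
      C ^ 2 * (δ * (1 + 8 * R + 16 * R ^ 2) +
        B * (2 * tailRate β p R + 2 * tailRate α p R + 8 * (tailSum β p R + tailSum α p R))) := by
  have hτ' := hL'.τ_mem R
  have hevaluation : |L.eval fun t => G t L'.τ| ≤
      C * (δ + 2 * (2 * δ * R + B * tailRate β p R)) := by
    refine (hL.abs_eval_le _).trans
      (mul_le_mul_of_nonneg_left (add_le_add (hδ _ (hL.τ_mem R) _ hτ') ?_) hL.const_nonneg)
    refine (Finset.sum_le_sum fun e _ => hL.sum_weight_abs_increment_le hα.2 (hG₁ L'.τ)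
      (fun t ht => hδ t ht _ hτ') e).trans_eq ?_
    simp [mul_add]
  have hincrements := Finset.sum_le_sum fun (e' : Fin 2) (_ : e' ∈ Finset.univ) =>
    sum_weight_abs_increment_eval_le hL hL' hα hβ hp hB hG₁ hG₂ hδ e'
  rw [Finset.sum_const, Finset.card_univ, Fintype.card_fin, nsmul_eq_mul] at hincrements
  calc _ ≤ _ := hL'.abs_eval_le _
    _ ≤ _ := mul_le_mul_of_nonneg_left (add_le_add hevaluation hincrements) hL.const_nonneg
    _ = _ := by
        push_cast
        ring

end TensorProduct

end IncrementFunctional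

/-! ### Integration against a kernel as an average of increment functionals -/

/-- The functional whose average over `u ∈ (0, π / n)` is integration against `K` over `(0, π)`: on
the `i`-th cell of length `π / n`, the values of a function are compared with its value at the
reference point `(i + 1) * (π / n) - v`, and the values at the reference points are summed by
parts. The sign in the first family of coefficients orders the endpoints of its intervals. -/
def kernelFunctional (K : ℝ → ℝ) (n : ℕ) (u v : ℝ) : IncrementFunctional where
  n := n
  c := ∫ x in 0..π, K x
  τ := π / n - v
  coeff := ![fun i => (if u < v then 1 else -1) * (π / n * K ((i + 1) * (π / n) - u)),
    fun i => ∫ x in ((i + 1) * (π / n))..π, K x]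
  a := ![fun i => (i + 1) * (π / n) - max u v, fun i => (i + 1) * (π / n) - v]
  b := ![fun i => (i + 1) * (π / n) - min u v, fun i => (i + 2) * (π / n) - v]

lemma kernelFunctional_eval (K : ℝ → ℝ) (n : ℕ) (u v : ℝ) (ϕ : ℝ → ℝ) :
    (kernelFunctional K n u v).eval ϕ =
      π / n * ∑ i ∈ Finset.range n, K ((i + 1) * (π / n) - u) *
        (ϕ ((i + 1) * (π / n) - u) - ϕ ((i + 1) * (π / n) - v)) +
      ((∫ x in 0..π, K x) * ϕ (π / n - v) +
        ∑ i ∈ Finset.range n, (∫ x in ((i + 1) * (π / n))..π, K x) *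
          (ϕ ((i + 2) * (π / n) - v) - ϕ ((i + 1) * (π / n) - v))) := by
  simp only [IncrementFunctional.eval, IncrementFunctional.increment, kernelFunctional,
    Fin.sum_univ_two, Matrix.cons_val_zero, Matrix.cons_val_one]
  rw [add_left_comm, Finset.mul_sum]
  congr 1
  refine Finset.sum_congr rfl fun i _ => ?_
  rcases lt_or_ge u v with h | h
  · rw [if_pos h, max_eq_right h.le, min_eq_left h.le]
    ring
  · rw [if_neg h.not_gt, max_eq_left h, min_eq_right h]
    ring

lemma add_one_le_mul_cell_sub {n i : ℕ} (hn : 0 < n) (hi : 0 < i) {u : ℝ} (hu : u < π / n) :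
    (i : ℝ) + 1 ≤ n * ((i + 1) * (π / n) - u) := by
  have hn₀ : (0 : ℝ) < n := by exact_mod_cast hn
  have hi₁ : (1 : ℝ) ≤ i := by exact_mod_cast hi
  have hnu : n * u < π := by rwa [lt_div_iff₀' hn₀] at hu
  have hexpand : n * ((i + 1) * (π / n) - u) = (i + 1) * π - n * u := by field_simp
  nlinarith [Real.pi_gt_three]

lemma exists_cesaroKernel_cell_bounds {α : ℝ} (hα : α ∈ Ioo (0 : ℝ) 1) : ∃ C : ℝ, 0 < C ∧
    ∀ n : ℕ, ∀ i < n,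
      (∀ u ∈ Ioo 0 (π / n), π / n * |cesaroKernel (-α) n ((i + 1) * (π / n) - u)| ≤
        C * ((i : ℝ) + 1) ^ (α - 1)) ∧
      |∫ x in ((i + 1) * (π / n))..π, cesaroKernel (-α) n x| ≤ C * ((i : ℝ) + 1) ^ (α - 1) := by
  obtain ⟨C, hC, hK⟩ := exists_cesaroKernel_bounds hα
  refine ⟨π * C, by positivity, fun n i hi => ?_⟩
  have hn : (0 : ℝ) < n := by exact_mod_cast i.zero_le.trans_lt hi
  obtain ⟨hbound, hdecay, hintegral⟩ := hK n (by lia)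
  set h := π / n with hh
  have : 0 < h := by positivity
  have hnh : n * h = π := by rw [hh]; field_simp
  have hcell : ((i : ℝ) + 1) * h ≤ π := by
    rw [← hnh]
    gcongr
    exact_mod_cast hi
  have hpow {x : ℝ} (hx : (i : ℝ) + 1 ≤ x) : x ^ (α - 1) ≤ ((i : ℝ) + 1) ^ (α - 1) :=
    Real.rpow_le_rpow_of_nonpos (by positivity) hx (by linarith [hα.2])
  refine ⟨fun u hu => ?_, ?_⟩
  · rcases Nat.eq_zero_or_pos i with rfl | hi₀
    · calc _ ≤ h * (C * n) := by gcongr; exact hbound _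
        _ = n * h * C * ((0 : ℕ) + 1 : ℝ) ^ (α - 1) := by simp; ring
        _ = _ := by rw [hnh]
    · have hge := add_one_le_mul_cell_sub (Nat.cast_pos.1 hn) hi₀ hu.2
      calc _ ≤ h * (C * n * (n * ((i + 1) * h - u)) ^ (α - 1)) := by
            gcongr
            exact hdecay _ (by linarith [hu.1]) (by linarith)
        _ = π * C * (n * ((i + 1) * h - u)) ^ (α - 1) := by rw [← hnh]; ring
        _ ≤ _ := mul_le_mul_of_nonneg_left (hpow hge) (by positivity)
  · have hge : (i : ℝ) + 1 ≤ n * ((i + 1) * h) := by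
      rw [mul_left_comm, hnh]
      exact le_mul_of_one_le_right (by positivity) (by linarith [Real.pi_gt_three])
    calc _ ≤ C * (n * ((i + 1) * h)) ^ (α - 1) :=
          hintegral _ hcell (by linarith [(Nat.cast_nonneg i : (0 : ℝ) ≤ i)])
      _ ≤ C * ((i : ℝ) + 1) ^ (α - 1) := mul_le_mul_of_nonneg_left (hpow hge) hC.le
      _ ≤ _ := by
          gcongr
          exact le_mul_of_one_le_left hC.le (by linarith [Real.pi_gt_three])

lemma exists_kernelFunctional_isAdmissible {α : ℝ} (hα : α ∈ Ioo (0 : ℝ) 1) : ∃ C : ℝ,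
    ∀ n : ℕ, ∀ u ∈ Ioo 0 (π / n), ∀ v ∈ Ioo 0 (π / n), u ≠ v →
      (kernelFunctional (cesaroKernel (-α) n) n u v).IsAdmissible α C (π / n) := by
  obtain ⟨C, _, hK⟩ := exists_cesaroKernel_cell_bounds hα
  refine ⟨max (π / 2) C, fun n u hu v hv huv => ?_⟩
  have hmax : max u v < π / n := max_lt hu.2 hv.2
  have hmin : 0 < min u v := lt_min hu.1 hv.1
  have hminmax : min u v < max u v := min_lt_max.2 huv
  have hh : 0 < π / n := hu.1.trans hu.2
  have hscale {i : ℕ} (hi : i < n) : ((i : ℝ) + 1) * (π / n) ≤ π :=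
    calc _ ≤ (n : ℝ) * (π / n) := by gcongr; exact_mod_cast hi
      _ = π := by
        have : (n : ℝ) ≠ 0 := by exact_mod_cast (i.zero_le.trans_lt hi).ne'
        field_simp
  constructor <;>
    simp only [kernelFunctional, Fin.forall_fin_two, Matrix.cons_val_zero, Matrix.cons_val_one]
  · rw [integral_cesaroKernel (cesaroNumber_neg_pos hα.2 n).ne', abs_of_pos (by positivity)]
    exact le_max_left _ _
  · linarith [hv.2]
  · linarith [hv.1]
  · have hweight (i : ℕ) : C * ((i : ℝ) + 1) ^ (α - 1) ≤
        max (π / 2) C * ((i : ℝ) + 1) ^ (α - 1) := by gcongr; exact le_max_right _ _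
    refine ⟨fun i hi => le_trans (le_of_eq ?_) (((hK n i hi).1 u hu).trans (hweight i)),
      fun i hi => (hK n i hi).2.trans (hweight i)⟩
    rw [abs_mul, abs_mul, abs_of_pos hh]
    split_ifs <;> simp
  · refine ⟨fun i _ => ?_, fun i _ => ?_⟩ <;> nlinarith [hv.2, (Nat.cast_nonneg i : (0 : ℝ) ≤ i)]
  · exact ⟨fun i _ => by linarith, fun i _ => by linarith⟩
  · exact ⟨fun i hi => by linarith [hscale hi, Real.pi_pos], fun i hi => by
      have := hscale (i.zero_le.trans_lt hi)
      push_cast at this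
      linarith [hscale hi, hv.1]⟩
  · exact ⟨fun i _ => by linarith, fun i _ => by linarith [hv.1]⟩
  · push_cast
    exact ⟨fun i _ => by linarith, fun i _ => by linarith⟩

lemma sum_mul_sub_succ_of_eq_zero {R : Type*} [CommRing R] (x Φ : ℕ → R) {n : ℕ} (hΦ : Φ n = 0) :
    ∑ i ∈ Finset.range n, x i * (Φ i - Φ (i + 1)) =
      Φ 0 * x 0 + ∑ i ∈ Finset.range n, Φ (i + 1) * (x (i + 1) - x i) := by
  rw [← sub_eq_iff_eq_add, ← Finset.sum_sub_distrib]
  have htelescope := Finset.sum_range_sub' (fun i => Φ i * x i) n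
  rw [hΦ, zero_mul, sub_zero] at htelescope
  rw [← htelescope]
  exact Finset.sum_congr rfl fun i _ => by ring

lemma integral_cell_eq (F : ℝ → ℝ) (h : ℝ) (i : ℕ) :
    ∫ t in (i * h)..((i + 1) * h), F t = ∫ u in 0..h, F ((i + 1) * h - u) := by
  rw [intervalIntegral.integral_comp_sub_left]
  congr 1 <;> ring

section KernelFunctional

variable {K ϕ : ℝ → ℝ} {n : ℕ}

lemma intervalIntegrable_cell (hϕ : IntervalIntegrable ϕ volume 0 π) {i : ℕ} (hi : i < n) :
    IntervalIntegrable ϕ volume (i * (π / n)) ((i + 1) * (π / n)) := by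
  have hn : (0 : ℝ) < n := by exact_mod_cast i.zero_le.trans_lt hi
  refine hϕ.mono_set ?_
  rw [uIcc_of_le (by gcongr; linarith), uIcc_of_le Real.pi_pos.le]
  refine Icc_subset_Icc (by positivity) ?_
  calc _ ≤ (n : ℝ) * (π / n) := by gcongr; exact_mod_cast hi
    _ = π := by field_simp

lemma intervalIntegrable_comp_cell_sub (hϕ : IntervalIntegrable ϕ volume 0 π) {i : ℕ}
    (hi : i < n) :
    IntervalIntegrable (fun u => ϕ ((i + 1) * (π / n) - u)) volume 0 (π / n) := by
  convert ((intervalIntegrable_cell hϕ hi).comp_sub_left ((i + 1) * (π / n))).symm using 1 <;> ring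

lemma integral_mul_kernel_eq_sum (hK : Continuous K) (hn : 1 ≤ n) (v : ℝ)
    (hϕ : IntervalIntegrable ϕ volume 0 π) :
    ∫ t in 0..π, ϕ t * K t =
      ∑ i ∈ Finset.range n, (∫ u in 0..(π / n), K ((i + 1) * (π / n) - u) *
        (ϕ ((i + 1) * (π / n) - u) - ϕ ((i + 1) * (π / n) - v))) +
      ∑ i ∈ Finset.range n, ϕ ((i + 1) * (π / n) - v) *
        ((∫ x in (i * (π / n))..π, K x) - ∫ x in ((i + 1) * (π / n))..π, K x) := by
  have hn₀ : (0 : ℝ) < n := by exact_mod_cast hn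
  have hKi (x y : ℝ) : IntervalIntegrable K volume x y := hK.intervalIntegrable _ _
  have hcells : ∫ t in 0..π, ϕ t * K t =
      ∑ i ∈ Finset.range n, ∫ t in (i * (π / n))..((i + 1) * (π / n)), ϕ t * K t := by
    have := intervalIntegral.sum_integral_adjacent_intervals (f := fun t => ϕ t * K t)
      (a := fun i : ℕ => (i : ℝ) * (π / n)) fun i hi => by
        simpa using intervalIntegrable_cell (hϕ.mul_continuousOn hK.continuousOn) hi
    simp only [Nat.cast_zero, zero_mul, mul_div_cancel₀ π hn₀.ne', Nat.cast_add_one] at this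
    exact this.symm
  rw [hcells, ← Finset.sum_add_distrib]
  refine Finset.sum_congr rfl fun i hi => ?_
  rw [← intervalIntegral.integral_add_adjacent_intervals (hKi (i * (π / n)) ((i + 1) * (π / n)))
    (hKi _ π), add_sub_cancel_right, integral_cell_eq, integral_cell_eq,
    ← intervalIntegral.integral_const_mul, ← intervalIntegral.integral_add]
  · exact intervalIntegral.integral_congr fun u _ => by ring
  · exact ((intervalIntegrable_comp_cell_sub hϕ (Finset.mem_range.1 hi)).sub
      intervalIntegrable_const).continuousOn_mul (by fun_prop)
  · exact (Continuous.intervalIntegrable (by fun_prop) _ _).const_mul _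

lemma integral_kernelFunctional_eval (hK : Continuous K) (hn : 1 ≤ n) (v : ℝ)
    (hϕ : IntervalIntegrable ϕ volume 0 π) :
    ∫ u in 0..(π / n), (kernelFunctional K n u v).eval ϕ =
      π / n * ∫ t in 0..π, ϕ t * K t := by
  have hn₀ : (n : ℝ) ≠ 0 := by exact_mod_cast (by lia : n ≠ 0)
  have hint (i : ℕ) (hi : i ∈ Finset.range n) : IntervalIntegrable
      (fun u => K ((i + 1) * (π / n) - u) *
        (ϕ ((i + 1) * (π / n) - u) - ϕ ((i + 1) * (π / n) - v))) volume 0 (π / n) :=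
    ((intervalIntegrable_comp_cell_sub hϕ (Finset.mem_range.1 hi)).sub
      intervalIntegrable_const).continuousOn_mul (by fun_prop)
  have habel := sum_mul_sub_succ_of_eq_zero (n := n)
    (fun i : ℕ => ϕ ((i + 1) * (π / n) - v)) (fun i : ℕ => ∫ x in (i * (π / n))..π, K x)
    (by simp [mul_div_cancel₀ π hn₀])
  push_cast at habel
  simp only [zero_mul, zero_add, one_mul, add_assoc, one_add_one_eq_two] at habel
  have hsum : IntervalIntegrable (fun u => π / n * ∑ i ∈ Finset.range n,
      K ((i + 1) * (π / n) - u) *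
        (ϕ ((i + 1) * (π / n) - u) - ϕ ((i + 1) * (π / n) - v))) volume 0 (π / n) := by
    simpa only [Finset.sum_apply] using (IntervalIntegrable.sum _ hint).const_mul (π / n)
  simp only [kernelFunctional_eval]
  rw [intervalIntegral.integral_add hsum intervalIntegrable_const,
    intervalIntegral.integral_const_mul, intervalIntegral.integral_finsetSum hint,
    intervalIntegral.integral_const, integral_mul_kernel_eq_sum hK hn v hϕ, smul_eq_mul, sub_zero,
    ← mul_add, habel]

lemma abs_integral_mul_le_of_abs_eval_le (hK : Continuous K) (hn : 1 ≤ n) (v : ℝ)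
    (hϕ : IntervalIntegrable ϕ volume 0 π) {B : ℝ}
    (hB : ∀ᵐ u, u ∈ Ioo 0 (π / n) → |(kernelFunctional K n u v).eval ϕ| ≤ B) :
    |∫ t in 0..π, ϕ t * K t| ≤ B := by
  have : (0 : ℝ) < n := by exact_mod_cast hn
  have hh : 0 < π / n := by positivity
  have hle := intervalIntegral.norm_integral_le_of_norm_le_const_ae (a := 0) (b := π / n) (C := B)
    (f := fun u => (kernelFunctional K n u v).eval ϕ) (by
      filter_upwards [hB, Measure.ae_ne volume (π / n)] with u hu hne hmem
      rw [uIoc_of_le hh.le] at hmem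
      exact hu ⟨hmem.1, hmem.2.lt_of_ne hne⟩)
  rw [integral_kernelFunctional_eval hK hn v hϕ, Real.norm_eq_abs, abs_mul, sub_zero,
    abs_of_pos hh, mul_comm] at hle
  exact le_of_mul_le_mul_right hle hh

end KernelFunctional

/-! ### The quadrant estimate -/

namespace IncrementFunctional

/-- The points at which the functional evaluates its argument. -/
def nodes (L : IncrementFunctional) : Set ℝ :=
  insert L.τ {t | ∃ e i, t = L.a e i ∨ t = L.b e i}

lemma τ_mem_nodes (L : IncrementFunctional) : L.τ ∈ L.nodes := mem_insert _ _

lemma a_mem_nodes (L : IncrementFunctional) (e : Fin 2) (i : ℕ) : L.a e i ∈ L.nodes :=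
  mem_insert_of_mem _ ⟨e, i, Or.inl rfl⟩

lemma b_mem_nodes (L : IncrementFunctional) (e : Fin 2) (i : ℕ) : L.b e i ∈ L.nodes :=
  mem_insert_of_mem _ ⟨e, i, Or.inr rfl⟩

lemma eval_mul_const (L : IncrementFunctional) (ϕ : ℝ → ℝ) (c : ℝ) :
    (L.eval fun t => ϕ t * c) = L.eval ϕ * c := by
  simp only [eval, increment, add_mul, Finset.sum_mul, ← sub_mul, mul_assoc]

section Integral

variable {L : IncrementFunctional} {G : ℝ → ℝ → ℝ} {x y : ℝ}

lemma intervalIntegrable_increment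
    (hG : ∀ t ∈ L.nodes, IntervalIntegrable (G t) volume x y) (e : Fin 2) (i : ℕ) :
    IntervalIntegrable (fun s => L.increment e i fun t => G t s) volume x y :=
  (hG _ (L.b_mem_nodes e i)).sub (hG _ (L.a_mem_nodes e i))

lemma intervalIntegrable_sum_increment
    (hG : ∀ t ∈ L.nodes, IntervalIntegrable (G t) volume x y) (e : Fin 2) :
    IntervalIntegrable (fun s => ∑ i ∈ Finset.range L.n, L.coeff e i *
      L.increment e i fun t => G t s) volume x y := by
  simpa only [Finset.sum_fn] using IntervalIntegrable.sum (Finset.range L.n) fun i _ =>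
    (intervalIntegrable_increment hG e i).const_mul (L.coeff e i)

lemma intervalIntegrable_eval (hG : ∀ t ∈ L.nodes, IntervalIntegrable (G t) volume x y) :
    IntervalIntegrable (fun s => L.eval fun t => G t s) volume x y := by
  simpa only [eval, Fin.sum_univ_two] using ((hG _ L.τ_mem_nodes).const_mul L.c).add
    ((intervalIntegrable_sum_increment hG 0).add (intervalIntegrable_sum_increment hG 1))

lemma increment_integral (hG : ∀ t ∈ L.nodes, IntervalIntegrable (G t) volume x y) (e : Fin 2)
    (i : ℕ) :
    (L.increment e i fun t => ∫ s in x..y, G t s) =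
      ∫ s in x..y, L.increment e i fun t => G t s :=
  (intervalIntegral.integral_sub (hG _ (L.b_mem_nodes e i)) (hG _ (L.a_mem_nodes e i))).symm

lemma eval_integral (hG : ∀ t ∈ L.nodes, IntervalIntegrable (G t) volume x y) :
    (L.eval fun t => ∫ s in x..y, G t s) = ∫ s in x..y, L.eval fun t => G t s := by
  have hsum (e : Fin 2) := intervalIntegrable_sum_increment hG e
  simp only [eval, increment_integral hG, Fin.sum_univ_two]
  rw [intervalIntegral.integral_add ((hG _ L.τ_mem_nodes).const_mul L.c) ((hsum 0).add (hsum 1)),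
    intervalIntegral.integral_add (hsum 0) (hsum 1), intervalIntegral.integral_const_mul]
  simp only [← intervalIntegral.integral_const_mul]
  rw [intervalIntegral.integral_finsetSum fun i _ =>
      (intervalIntegrable_increment hG 0 i).const_mul (L.coeff 0 i),
    intervalIntegral.integral_finsetSum fun i _ =>
      (intervalIntegrable_increment hG 1 i).const_mul (L.coeff 1 i)]

end Integral

end IncrementFunctional

lemma forall_mem_nodes_kernelFunctional {P : ℝ → Prop} {n : ℕ} {u v : ℝ}
    (hu : ∀ i : ℕ, P ((i + 1) * (π / n) - u)) (hv : ∀ i : ℕ, P ((i + 1) * (π / n) - v))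
    (K : ℝ → ℝ) : ∀ t ∈ (kernelFunctional K n u v).nodes, P t := by
  have hsucc (i : ℕ) : P ((i + 2) * (π / n) - v) := by
    have := hv (i + 1)
    push_cast at this
    rwa [add_assoc, one_add_one_eq_two] at this
  rintro t (rfl | ⟨e, i, rfl | rfl⟩)
  · simpa [kernelFunctional] using hv 0
  · fin_cases e
    · rcases max_choice u v with h | h <;> simp [kernelFunctional, h, hu, hv]
    · exact hv i
  · fin_cases e
    · rcases min_choice u v with h | h <;> simp [kernelFunctional, h, hu, hv]
    · exact hsucc i

lemma exists_ae_forall_mem_nodes {P : ℝ → Prop} (hP : ∀ᵐ t, P t) (K : ℝ → ℝ) {n : ℕ}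
    (hn : 1 ≤ n) :
    ∃ v ∈ Ioo 0 (π / n), ∀ᵐ u, ∀ t ∈ (kernelFunctional K n u v).nodes, P t := by
  have hae : ∀ᵐ v, ∀ i : ℕ, P ((i + 1) * (π / n) - v) := ae_all_iff.2 fun i =>
    (Measure.measurePreserving_sub_left volume _).quasiMeasurePreserving.ae hP
  have : (0 : ℝ) < n := by exact_mod_cast hn
  obtain ⟨v, hv, hvmem⟩ := (Measure.dense_of_ae hae).exists_mem_open isOpen_Ioo
    (nonempty_Ioo.2 (by positivity : 0 < π / n))
  exact ⟨v, hvmem, hae.mono fun u hu => forall_mem_nodes_kernelFunctional hu hv K⟩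

lemma abs_integral_integral_mul_le_of_abs_eval_eval_le {K K' : ℝ → ℝ} {n m : ℕ} {G : ℝ → ℝ → ℝ}
    {B : ℝ} (hK : Continuous K) (hK' : Continuous K') (hn : 1 ≤ n) (hm : 1 ≤ m)
    (hG : ∀ᵐ t, IntervalIntegrable (G t) volume 0 π)
    (hGK' : IntervalIntegrable (fun t => ∫ s in 0..π, G t s * K' s) volume 0 π)
    (hB : ∀ u ∈ Ioo 0 (π / n), ∀ v ∈ Ioo 0 (π / n), u ≠ v →
      ∀ u' ∈ Ioo 0 (π / m), ∀ v' ∈ Ioo 0 (π / m), u' ≠ v' →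
        |(kernelFunctional K' m u' v').eval fun s =>
          (kernelFunctional K n u v).eval fun t => G t s| ≤ B) :
    |∫ t in 0..π, (∫ s in 0..π, G t s * K' s) * K t| ≤ B := by
  obtain ⟨v, hv, hnodes⟩ := exists_ae_forall_mem_nodes hG K hn
  have : (0 : ℝ) < m := by exact_mod_cast hm
  obtain ⟨v', hv'⟩ := nonempty_Ioo.2 (by positivity : 0 < π / m)
  refine abs_integral_mul_le_of_abs_eval_le hK hn v hGK' ?_
  filter_upwards [hnodes, Measure.ae_ne volume v] with u hint huv hu
  rw [IncrementFunctional.eval_integral fun t ht =>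
    (hint t ht).mul_continuousOn hK'.continuousOn]
  simp only [IncrementFunctional.eval_mul_const]
  refine abs_integral_mul_le_of_abs_eval_le hK' hm v'
    (IncrementFunctional.intervalIntegrable_eval hint) ?_
  filter_upwards [Measure.ae_ne volume v'] with u' huv' hu'
  exact hB u hu v hv huv u' hu' v' hv' huv'

lemma exists_radius_tail_lt {α β p ε : ℝ} (hα : 0 < α) (hβ : 0 < β) (hp : 1 < p) (hε : 0 < ε)
    (A : ℝ) :
    ∃ R : ℕ, A * (2 * tailRate β p R + 2 * tailRate α p R +
      8 * (tailSum β p R + tailSum α p R)) < ε := by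
  have hlim : Tendsto (fun R => A * (2 * tailRate β p R + 2 * tailRate α p R +
      8 * (tailSum β p R + tailSum α p R))) atTop (𝓝 (A * (2 * 0 + 2 * 0 + 8 * (0 + 0)))) :=
    ((((tendsto_tailRate hβ (by linarith)).const_mul 2).add
      ((tendsto_tailRate hα (by linarith)).const_mul 2)).add
      (((tendsto_tailSum hβ hp).add (tendsto_tailSum hα hp)).const_mul 8)).const_mul A
  exact (hlim.eventually_lt_const (by simpa using hε)).exists

lemma exists_quadrant_estimate {α β p V η : ℝ} (hα : α ∈ Ioo (0 : ℝ) 1) (hβ : β ∈ Ioo (0 : ℝ) 1)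
    (hαβ : α + β < 1) (hp : 1 < p) (hV : 0 ≤ V) (hη : 0 < η) :
    ∃ δ > 0, ∃ R : ℕ, ∀ n m : ℕ, 1 ≤ n → 1 ≤ m → ∀ G : ℝ → ℝ → ℝ,
      (∀ᵐ t, IntervalIntegrable (G t) volume 0 π) →
      IntervalIntegrable (fun t => ∫ s in 0..π, G t s * cesaroKernel (-β) m s) volume 0 π →
      (∀ s, IncVarLE (powLogSeq (α + β) p) V fun t => G t s) →
      (∀ t, IncVarLE (powLogSeq (α + β) p) V (G t)) →
      (∀ t ∈ Ioc 0 ((R + 1) * (π / n)), ∀ s ∈ Ioc 0 ((R + 1) * (π / m)), |G t s| ≤ δ) →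
      |∫ t in 0..π, (∫ s in 0..π, G t s * cesaroKernel (-β) m s) * cesaroKernel (-α) n t| ≤ η := by
  obtain ⟨C₁, hL₁⟩ := exists_kernelFunctional_isAdmissible hα
  obtain ⟨C₂, hL₂⟩ := exists_kernelFunctional_isAdmissible hβ
  obtain ⟨W₁, hW₁, htail₁⟩ := IncrementFunctional.exists_tailLE_of_incVarLE hβ.1.le hαβ
    (zero_lt_one.trans hp)
  obtain ⟨W₂, _, htail₂⟩ := IncrementFunctional.exists_tailLE_of_incVarLE hα.1.le
    ((add_comm β α).trans_lt hαβ) (zero_lt_one.trans hp)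
  set C := max C₁ C₂
  set B := max W₁ W₂ * V
  obtain ⟨R, hR⟩ := exists_radius_tail_lt hα.1 hβ.1 hp (half_pos hη) (C ^ 2 * B)
  set Q : ℝ := 1 + 8 * R + 16 * R ^ 2
  refine ⟨η / 2 / ((C ^ 2 + 1) * Q), by positivity, R, fun n m hn hm G hG hGK hG₁ hG₂ hsmall => ?_⟩
  refine abs_integral_integral_mul_le_of_abs_eval_eval_le (continuous_cesaroKernel _ _)
    (continuous_cesaroKernel _ _) hn hm hG hGK fun u hu v hv huv u' hu' v' hv' huv' => ?_
  have hL := (hL₁ n u hu v hv huv).mono (le_max_left C₁ C₂)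
  have hL' := (hL₂ m u' hu' v' hv' huv').mono (le_max_right C₁ C₂)
  have hcentral : C ^ 2 * (η / 2 / ((C ^ 2 + 1) * Q) * Q) ≤ η / 2 := by
    have : C ^ 2 / (C ^ 2 + 1) ≤ 1 := div_le_one_of_le₀ (by linarith) (by positivity)
    have : Q ≠ 0 := by positivity
    calc _ = C ^ 2 / (C ^ 2 + 1) * (η / 2) := by field_simp
      _ ≤ 1 * (η / 2) := by gcongr
      _ = η / 2 := one_mul _
  refine (IncrementFunctional.abs_eval_eval_le hL hL' (Ioo_subset_Icc_self hα)
    (Ioo_subset_Icc_self hβ) hp (by positivity : 0 ≤ B) (fun s => ?_) (fun t => ?_) hsmall).trans ?_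
  · exact (htail₁ hL (hG₁ s)).mono (mul_le_mul_of_nonneg_right (le_max_left W₁ W₂) hV)
  · refine (htail₂ hL' ?_).mono (mul_le_mul_of_nonneg_right (le_max_right W₁ W₂) hV)
    rw [add_comm]
    exact hG₂ t
  · linarith

/-! ### Variation of periodic functions -/

/-- The intervals `[a i, b i]`, `i < n`, are nondegenerate, nonoverlapping and contained in
`[x, y]`; they may come in any order. -/
structure NonoverlappingIn (x y : ℝ) (n : ℕ) (a b : ℕ → ℝ) : Prop where
  le_left : ∀ i < n, x ≤ a i
  lt : ∀ i < n, a i < b i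
  right_le : ∀ i < n, b i ≤ y
  le_or_le : ∀ i < n, ∀ j < n, i ≠ j → b i ≤ a j ∨ b j ≤ a i

namespace NonoverlappingIn

variable {x y P : ℝ} {n : ℕ} {a b : ℕ → ℝ}

lemma of_consecutive (hx : ∀ i < n, x ≤ a i) (hab : ∀ i < n, a i < b i) (hy : ∀ i < n, b i ≤ y)
    (hconsecutive : ∀ i, i + 1 < n → b i ≤ a (i + 1)) : NonoverlappingIn x y n a b := by
  have hle {i j : ℕ} (hij : i < j) : j < n → b i ≤ a j := by
    induction j, hij using Nat.le_induction with
    | base => exact hconsecutive i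
    | succ j _ ih =>
      exact fun hj => ((ih (by lia)).trans (hab j (by lia)).le).trans (hconsecutive j hj)
  exact ⟨hx, hab, hy, fun i hi j hj hij =>
    (lt_or_gt_of_ne hij).imp (fun h => hle h hj) fun h => hle h hi⟩

lemma add_const (h : NonoverlappingIn x y n a b) (c : ℝ) :
    NonoverlappingIn (c + x) (c + y) n (fun i => c + a i) fun i => c + b i where
  le_left i hi := by linarith [h.le_left i hi]
  lt i hi := by linarith [h.lt i hi]
  right_le i hi := by linarith [h.right_le i hi]
  le_or_le i hi j hj hij := by simpa using h.le_or_le i hi j hj hij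

lemma const_sub (h : NonoverlappingIn x y n a b) (c : ℝ) :
    NonoverlappingIn (c - y) (c - x) n (fun i => c - b i) fun i => c - a i where
  le_left i hi := by linarith [h.right_le i hi]
  lt i hi := by linarith [h.lt i hi]
  right_le i hi := by linarith [h.le_left i hi]
  le_or_le i hi j hj hij := by
    simpa only [sub_le_sub_iff_left] using (h.le_or_le i hi j hj hij).symm

lemma wrapRight (h : NonoverlappingIn x (x + P) n a b) (hx : x ∈ Icc 0 P) :
    NonoverlappingIn 0 P n (fun i => if P ≤ a i then a i - P else a i)
      fun i => if P ≤ a i then b i - P else min (b i) P := by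
  obtain ⟨hxa, hab, hby, hdisjoint⟩ := h
  obtain ⟨hx₀, hxP⟩ := hx
  constructor <;> grind

lemma wrapLeft (h : NonoverlappingIn x (x + P) n a b) (hx : x ∈ Icc 0 P) :
    NonoverlappingIn 0 P n (fun i => if b i ≤ P then a i else max (a i) P - P)
      fun i => if b i ≤ P then b i else b i - P := by
  obtain ⟨hxa, hab, hby, hdisjoint⟩ := h
  obtain ⟨hx₀, hxP⟩ := hx
  constructor <;> grind

end NonoverlappingIn

section LambdaVar

variable {lam : ℕ → ℝ} {g : ℝ → ℝ} {V : ℝ}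

lemma sum_le_of_lambdaVar_le (hV : 0 ≤ V) (hlam : ∀ i, 0 < lam (i + 1))
    (hg : lambdaVar lam g ≤ ENNReal.ofReal V) {n : ℕ} {a b : ℕ → ℝ}
    (hab : NonoverlappingIn 0 (2 * π) n a b) :
    ∑ i ∈ Finset.range n, |g (b i) - g (a i)| / lam (i + 1) ≤ V := by
  let E : IntervalCollection :=
    { n := n
      a := fun i => a i
      b := fun i => b i
      zero_le := fun i => hab.le_left i i.2
      lt := fun i => hab.lt i i.2
      le_two_pi := fun i => hab.right_le i i.2
      nonoverlapping := fun i j hij => by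
        rw [Ioo_disjoint_Ioo]
        rcases hab.le_or_le i i.2 j j.2 fun h => hij (Fin.ext h) with h | h
        · exact min_le_of_left_le (h.trans (le_max_right _ _))
        · exact min_le_of_right_le (h.trans (le_max_left _ _)) }
  have hE : ∑ i : Fin n, ENNReal.ofReal (|g (b i) - g (a i)| / lam (i + 1)) ≤ ENNReal.ofReal V :=
    (le_iSup (fun E : IntervalCollection => ∑ i : Fin E.n,
      ENNReal.ofReal (|g (E.b i) - g (E.a i)| / lam (i + 1))) E).trans hg
  rwa [← ENNReal.ofReal_sum_of_nonneg fun (i : Fin n) _ => div_nonneg (abs_nonneg _) (hlam i).le,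
    ENNReal.ofReal_le_ofReal_iff hV,
    Fin.sum_univ_eq_sum_range fun i => |g (b i) - g (a i)| / lam (i + 1)] at hE

lemma sum_le_of_periodic_of_mem_Icc (hV : 0 ≤ V) (hlam : ∀ i, 0 < lam (i + 1))
    (hgV : lambdaVar lam g ≤ ENNReal.ofReal V) (hg : g.Periodic (2 * π)) {x : ℝ}
    (hx : x ∈ Icc 0 (2 * π)) {n : ℕ} {a b : ℕ → ℝ} (hab : NonoverlappingIn x (x + 2 * π) n a b) :
    ∑ i ∈ Finset.range n, |g (b i) - g (a i)| / lam (i + 1) ≤ 2 * V := by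
  refine le_trans ?_ ((add_le_add (sum_le_of_lambdaVar_le hV hlam hgV (hab.wrapRight hx))
    (sum_le_of_lambdaVar_le hV hlam hgV (hab.wrapLeft hx))).trans_eq (two_mul V).symm)
  rw [← Finset.sum_add_distrib]
  refine Finset.sum_le_sum fun i _ => ?_
  rw [← add_div]
  refine div_le_div_of_nonneg_right ?_ (hlam i).le
  by_cases hPa : 2 * π ≤ a i
  · rw [if_pos hPa, if_pos hPa, hg.sub_eq, hg.sub_eq]
    exact le_add_of_nonneg_right (abs_nonneg _)
  rw [if_neg hPa, if_neg hPa]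
  by_cases hbP : b i ≤ 2 * π
  · rw [min_eq_left hbP]
    exact le_add_of_nonneg_right (abs_nonneg _)
  · rw [if_neg hbP, if_neg hbP, min_eq_right (not_le.1 hbP).le, max_eq_right (not_le.1 hPa).le,
      hg.sub_eq, sub_self, ← hg.eq, add_comm]
    exact abs_sub_le _ _ _

lemma sum_le_of_periodic (hV : 0 ≤ V) (hlam : ∀ i, 0 < lam (i + 1))
    (hgV : lambdaVar lam g ≤ ENNReal.ofReal V) (hg : g.Periodic (2 * π)) {x : ℝ} {n : ℕ}
    {a b : ℕ → ℝ} (hab : NonoverlappingIn x (x + 2 * π) n a b) :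
    ∑ i ∈ Finset.range n, |g (b i) - g (a i)| / lam (i + 1) ≤ 2 * V := by
  obtain ⟨k, hk⟩ : ∃ k : ℤ, -(k • (2 * π)) + x ∈ Icc 0 (2 * π) := by
    have hmem := toIcoMod_mem_Ico Real.two_pi_pos 0 x
    rw [toIcoMod, zero_add, sub_eq_neg_add] at hmem
    exact ⟨_, Ico_subset_Icc_self hmem⟩
  have hshift := hab.add_const (-(k • (2 * π)))
  rw [← add_assoc] at hshift
  simpa only [neg_add_eq_sub, hg.sub_zsmul_eq] using
    sum_le_of_periodic_of_mem_Icc hV hlam hgV hg hk hshift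

lemma incVarLE_comp_const_add (hV : 0 ≤ V) (hlam : ∀ i, 0 < lam (i + 1))
    (hgV : lambdaVar lam g ≤ ENNReal.ofReal V) (hg : g.Periodic (2 * π)) (x : ℝ) :
    IncVarLE lam (2 * V) fun t => g (x + t) := by
  intro n a b hab hconsecutive
  have hnon := NonoverlappingIn.of_consecutive (fun i hi => (hab i hi).1.le)
    (fun i hi => (hab i hi).2.1) (fun i hi => (hab i hi).2.2) hconsecutive
  have hshift := hnon.add_const x
  rw [add_zero] at hshift
  exact sum_le_of_periodic hV hlam hgV hg hshift

lemma incVarLE_comp_const_sub (hV : 0 ≤ V) (hlam : ∀ i, 0 < lam (i + 1))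
    (hgV : lambdaVar lam g ≤ ENNReal.ofReal V) (hg : g.Periodic (2 * π)) (x : ℝ) :
    IncVarLE lam (2 * V) fun t => g (x - t) := by
  intro n a b hab hconsecutive
  have hnon := NonoverlappingIn.of_consecutive (fun i hi => (hab i hi).1.le)
    (fun i hi => (hab i hi).2.1) (fun i hi => (hab i hi).2.2) hconsecutive
  have hreflect := hnon.const_sub x
  rw [sub_zero] at hreflect
  nth_rw 2 [← sub_add_cancel x (2 * π)] at hreflect
  simpa only [abs_sub_comm] using sum_le_of_periodic hV hlam hgV hg hreflect

lemma IncVarLE.sub_const (hg : IncVarLE lam V g) (c : ℝ) : IncVarLE lam V fun t => g t - c := by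
  intro n a b hab hconsecutive
  simpa using hg n a b hab hconsecutive

end LambdaVar

/-- The point at signed distance `t` from `x`: to the right of `x` for `true`, to the left for
`false`. -/
def dir (e : Bool) (x t : ℝ) : ℝ := if e then x + t else x - t

lemma incVarLE_comp_dir {lam : ℕ → ℝ} {g : ℝ → ℝ} {V : ℝ} (hV : 0 ≤ V)
    (hlam : ∀ i, 0 < lam (i + 1)) (hgV : lambdaVar lam g ≤ ENNReal.ofReal V)
    (hg : g.Periodic (2 * π)) (e : Bool) (x : ℝ) :
    IncVarLE lam (2 * V) fun t => g (dir e x t) := by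
  cases e
  · exact incVarLE_comp_const_sub hV hlam hgV hg x
  · exact incVarLE_comp_const_add hV hlam hgV hg x

lemma apply_toIcoMod_of_periodic {g : ℝ → ℝ} (hg : g.Periodic (2 * π)) (x : ℝ) :
    g (toIcoMod Real.two_pi_pos 0 x) = g x := hg.sub_zsmul_eq _

lemma IsBiperiodic.periodic_fst {f : ℝ × ℝ → ℝ} (hf : IsBiperiodic f) (y : ℝ) :
    Function.Periodic (fun x => f (x, y)) (2 * π) := fun x => (hf x y).1

lemma IsBiperiodic.periodic_snd {f : ℝ × ℝ → ℝ} (hf : IsBiperiodic f) (x : ℝ) :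
    Function.Periodic (fun y => f (x, y)) (2 * π) := fun y => (hf x y).2

lemma MemPLambdaBV.exists_lambdaVar_le {lam : ℕ → ℝ} {f : ℝ × ℝ → ℝ} (hfv : MemPLambdaBV lam f)
    (hf : IsBiperiodic f) :
    ∃ V : ℝ, 0 ≤ V ∧ (∀ y, lambdaVar lam (fun x => f (x, y)) ≤ ENNReal.ofReal V) ∧
      ∀ x, lambdaVar lam (fun y => f (x, y)) ≤ ENNReal.ofReal V := by
  have hmem (t : ℝ) : toIcoMod Real.two_pi_pos 0 t ∈ Icc 0 (2 * π) := by
    simpa using Ico_subset_Icc_self (toIcoMod_mem_Ico Real.two_pi_pos 0 t)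
  refine ⟨(lambdaVar₁ lam f + lambdaVar₂ lam f).toReal, ENNReal.toReal_nonneg, fun y => ?_,
    fun x => ?_⟩ <;> rw [ENNReal.ofReal_toReal hfv.ne]
  · simp only [← apply_toIcoMod_of_periodic (hf.periodic_snd _) y]
    exact (le_iSup₂ (f := fun y (_ : y ∈ Icc (0 : ℝ) (2 * π)) => lambdaVar lam fun x => f (x, y))
      _ (hmem y)).trans le_self_add
  · simp only [← apply_toIcoMod_of_periodic (hf.periodic_fst _) x]
    exact (le_iSup₂ (f := fun x (_ : x ∈ Icc (0 : ℝ) (2 * π)) => lambdaVar lam fun y => f (x, y))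
      _ (hmem x)).trans le_add_self

/-! ### Integral representation of the Cesàro means -/

lemma sum_exp_eq_dirichletKernel (M : ℕ) (u : ℝ) :
    ∑ k ∈ Finset.Icc (-(M : ℤ)) M, Complex.exp (I * k * u) = (2 * dirichletKernel M u : ℝ) := by
  induction M with
  | zero => simp [dirichletKernel]
  | succ M ih =>
    have hIcc : Finset.Icc (-((M + 1 : ℕ) : ℤ)) ((M + 1 : ℕ) : ℤ) =
        insert ((M : ℤ) + 1) (insert (-((M : ℤ) + 1)) (Finset.Icc (-(M : ℤ)) M)) := by
      ext k
      simp only [Finset.mem_Icc, Finset.mem_insert]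
      lia
    have hsucc : dirichletKernel (M + 1) u = dirichletKernel M u + Real.cos ((M + 1) * u) := by
      simp only [dirichletKernel, Finset.sum_range_succ, add_assoc]
    rw [hIcc, Finset.sum_insert (by simp; lia), Finset.sum_insert (by simp), ih, hsucc]
    push_cast
    rw [Complex.cos]
    ring_nf

lemma isCompact_square : IsCompact square := isCompact_Icc.prod isCompact_Icc

lemma sum_sum_setIntegral_mul {𝕜 ι κ : Type*} [RCLike 𝕜] {f : ℝ × ℝ → 𝕜}
    (hf : IntegrableOn f square) (s : Finset ι) (t : Finset κ) {ψ : ι → κ → ℝ × ℝ → 𝕜}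
    (hψ : ∀ i j, Continuous (ψ i j)) :
    ∑ i ∈ s, ∑ j ∈ t, ∫ q in square, f q * ψ i j q =
      ∫ q in square, f q * ∑ i ∈ s, ∑ j ∈ t, ψ i j q := by
  have hint (i : ι) (j : κ) : IntegrableOn (fun q => f q * ψ i j q) square :=
    hf.mul_continuousOn (hψ i j).continuousOn isCompact_square
  simp only [Finset.mul_sum]
  rw [integral_finsetSum _ fun i _ => integrable_finsetSum _ fun j _ => hint i j]
  exact Finset.sum_congr rfl fun i _ => (integral_finsetSum _ fun j _ => hint i j).symm

lemma fourierCoeff₂_mul_exp_mul_exp (f : ℝ × ℝ → ℝ) (k l : ℤ) (p : ℝ × ℝ) :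
    fourierCoeff₂ f k l * Complex.exp (I * k * p.1) * Complex.exp (I * l * p.2) =
      1 / (4 * (π : ℂ) ^ 2) * ∫ q in square, (f q : ℂ) *
        (Complex.exp (I * k * (p.1 - q.1 : ℝ)) * Complex.exp (I * l * (p.2 - q.2 : ℝ))) := by
  rw [fourierCoeff₂, mul_assoc, mul_assoc, ← integral_mul_const]
  congr 2
  ext q
  simp only [mul_assoc, ← Complex.exp_add]
  push_cast
  ring_nf

lemma rectPartialSum_eq {f : ℝ × ℝ → ℝ} (hf : IntegrableOn f square) (M N : ℕ) (p : ℝ × ℝ) :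
    rectPartialSum f M N p = (1 / π ^ 2 * ∫ q in square,
      f q * (dirichletKernel M (p.1 - q.1) * dirichletKernel N (p.2 - q.2)) : ℝ) := by
  simp only [rectPartialSum, fourierCoeff₂_mul_exp_mul_exp, ← Finset.mul_sum]
  have hfC : IntegrableOn (fun q => (f q : ℂ)) square := hf.ofReal
  rw [sum_sum_setIntegral_mul hfC _ _ (ψ := fun (k l : ℤ) q =>
    Complex.exp (I * k * (p.1 - q.1 : ℝ)) * Complex.exp (I * l * (p.2 - q.2 : ℝ)))
    fun k l => by fun_prop]
  simp only [← Finset.mul_sum, ← Finset.sum_mul, sum_exp_eq_dirichletKernel]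
  push_cast
  rw [← integral_complex_ofReal, ← integral_const_mul, ← integral_const_mul]
  congr 1
  ext q
  push_cast
  ring

lemma cesaroMean_eq {f : ℝ × ℝ → ℝ} (hf : IntegrableOn f square) (a b : ℝ) (n m : ℕ) (p : ℝ × ℝ) :
    cesaroMean a b f n m p = (1 / π ^ 2 * ∫ q in square,
      f q * (cesaroKernel a n (p.1 - q.1) * cesaroKernel b m (p.2 - q.2)) : ℝ) := by
  have hkernel (q : ℝ × ℝ) :
      cesaroKernel a n (p.1 - q.1) * cesaroKernel b m (p.2 - q.2) =
        1 / cesaroNumber a n * (1 / cesaroNumber b m) * ∑ i ∈ Finset.range (n + 1),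
          ∑ j ∈ Finset.range (m + 1), cesaroNumber (a - 1) (n - i) * cesaroNumber (b - 1) (m - j) *
            (dirichletKernel i (p.1 - q.1) * dirichletKernel j (p.2 - q.2)) := by
    simp only [cesaroKernel, mul_mul_mul_comm (cesaroNumber (a - 1) _), ← Finset.sum_mul_sum]
    ring
  simp only [hkernel, mul_left_comm (f _) (1 / cesaroNumber a n * _), integral_const_mul]
  rw [← sum_sum_setIntegral_mul hf _ _ fun i j => by fun_prop]
  simp only [cesaroMean, rectPartialSum_eq hf, mul_left_comm (f _), integral_const_mul]
  push_cast
  simp only [Finset.mul_sum]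
  refine Finset.sum_congr rfl fun i _ => Finset.sum_congr rfl fun j _ => ?_
  ring

/-! ### Folding to the four quadrants -/

lemma dir_true (x : ℝ) : dir true x = fun t => x + t := rfl

lemma dir_false (x : ℝ) : dir false x = fun t => x - t := rfl

lemma measurePreserving_dir (e : Bool) (x : ℝ) : MeasurePreserving (dir e x) volume volume := by
  cases e
  · exact Measure.measurePreserving_sub_left volume x
  · exact measurePreserving_add_left volume x

lemma measurableEmbedding_dir (e : Bool) (x : ℝ) : MeasurableEmbedding (dir e x) := by
  cases e
  · exact (MeasurableEquiv.subLeft x).measurableEmbedding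
  · exact (MeasurableEquiv.addLeft x).measurableEmbedding

@[fun_prop]
lemma continuous_dir (e : Bool) (x : ℝ) : Continuous (dir e x) := by
  cases e
  · exact continuous_const.sub continuous_id
  · exact continuous_const.add continuous_id

lemma intervalIntegrable_comp_dir {ϕ : ℝ → ℝ} (hϕ : ∀ a b, IntervalIntegrable ϕ volume a b)
    (e : Bool) (x a b : ℝ) : IntervalIntegrable (fun t => ϕ (dir e x t)) volume a b := by
  cases e
  · simpa [dir_false] using (hϕ (x - a) (x - b)).comp_sub_left x
  · simpa [dir_true] using (hϕ (x + a) (x + b)).comp_add_left x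

lemma integral_mul_comp_sub_eq_sum_dir {ϕ K : ℝ → ℝ} (hϕ : ϕ.Periodic (2 * π))
    (hϕi : IntervalIntegrable ϕ volume 0 (2 * π)) (hK : K.Periodic (2 * π)) (hKc : Continuous K)
    (hKe : K.Even) (x : ℝ) :
    ∫ t in 0..(2 * π), ϕ t * K (x - t) = ∑ e, ∫ t in 0..π, ϕ (dir e x t) * K t := by
  set F := fun t => ϕ t * K (x - t)
  have hF : F.Periodic (2 * π) := hϕ.mul (hK.const_sub x)
  have hFi (u v : ℝ) : IntervalIntegrable F volume u v :=
    (hϕ.intervalIntegrable₀ Real.two_pi_pos.ne' hϕi u v).mul_continuousOn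
      (Continuous.continuousOn (by fun_prop))
  have hshift : ∫ t in 0..(2 * π), F t = ∫ t in (x - π)..(x + π), F t := by
    convert hF.intervalIntegral_add_eq 0 (x - π) using 2 <;> ring
  rw [hshift, ← intervalIntegral.integral_add_adjacent_intervals (hFi (x - π) x) (hFi x _),
    Fintype.sum_bool, add_comm]
  congr 1
  · rw [← add_zero x, add_assoc, zero_add, ← intervalIntegral.integral_comp_add_left F x]
    simp [F, dir_true, hKe _]
  · nth_rw 2 [← sub_zero x]
    rw [← intervalIntegral.integral_comp_sub_left F x]
    simp [F, dir_false]

lemma exists_int_sub_mul_two_pi_mem_Icc {t : ℝ} {N : ℕ} (ht : |t| ≤ N * (2 * π)) :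
    ∃ k ∈ Finset.Icc (-(N : ℤ)) N, t - k * (2 * π) ∈ Icc 0 (2 * π) := by
  have hle := Int.floor_le (t / (2 * π))
  have hlt := Int.lt_floor_add_one (t / (2 * π))
  obtain ⟨hlower, hupper⟩ := abs_le.1 ht
  have hdiv : t / (2 * π) ≤ N := by rwa [div_le_iff₀ Real.two_pi_pos]
  refine ⟨⌊t / (2 * π)⌋, Finset.mem_Icc.2 ⟨Int.le_floor.2 ?_, ?_⟩, ?_, ?_⟩
  · rw [le_div_iff₀ Real.two_pi_pos]
    push_cast
    linarith
  · exact_mod_cast hle.trans hdiv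
  · rw [le_div_iff₀ Real.two_pi_pos] at hle
    linarith
  · rw [div_lt_iff₀ Real.two_pi_pos] at hlt
    linarith

namespace IsBiperiodic

variable {f : ℝ × ℝ → ℝ} (hf : IsBiperiodic f) (hfi : IntegrableOn f square)
include hf

lemma sub_int_mul_eq (k l : ℤ) (q : ℝ × ℝ) : f (q - (k * (2 * π), l * (2 * π))) = f q :=
  ((hf.periodic_fst _).sub_int_mul_eq k).trans ((hf.periodic_snd _).sub_int_mul_eq l)

include hfi

lemma integrableOn_translate (k l : ℤ) :
    IntegrableOn f ((fun q => q - (k * (2 * π), l * (2 * π))) ⁻¹' square) := by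
  simpa only [Function.comp_def, hf.sub_int_mul_eq] using
    ((measurePreserving_sub_right volume (k * (2 * π), l * (2 * π))).integrableOn_comp_preimage
      (measurableEmbedding_subRight _)).2 hfi

lemma integrableOn_isCompact {s : Set (ℝ × ℝ)} (hs : IsCompact s) : IntegrableOn f s := by
  obtain ⟨r, hr⟩ := hs.isBounded.subset_closedBall 0
  obtain ⟨N, hN⟩ := exists_nat_gt (r / (2 * π))
  rw [div_lt_iff₀ Real.two_pi_pos] at hN
  have htranslates := (integrableOn_finset_iUnion (μ := volume) (f := f)
    (s := Finset.Icc (-(N : ℤ)) N ×ˢ Finset.Icc (-(N : ℤ)) N)).2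
    fun c _ => hf.integrableOn_translate hfi c.1 c.2
  refine htranslates.mono_set fun q hq => ?_
  have hq' := (mem_closedBall_zero_iff.1 (hr hq)).trans hN.le
  rw [Prod.norm_def, max_le_iff] at hq'
  obtain ⟨k, hk, hkq⟩ := exists_int_sub_mul_two_pi_mem_Icc hq'.1
  obtain ⟨l, hl, hlq⟩ := exists_int_sub_mul_two_pi_mem_Icc hq'.2
  simp only [mem_iUnion]
  exact ⟨(k, l), Finset.mem_product.2 ⟨hk, hl⟩, hkq, hlq⟩

lemma integrable_comp_dir (e e' : Bool) (x y a b c d : ℝ) :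
    Integrable (fun q : ℝ × ℝ => f (dir e x q.1, dir e' y q.2))
      ((volume.restrict (Ioc a b)).prod (volume.restrict (Ioc c d))) := by
  rw [Measure.prod_restrict]
  have himage := ((isCompact_Icc (a := a) (b := b)).prod (isCompact_Icc (a := c) (b := d))).image
    ((continuous_dir e x).prodMap (continuous_dir e' y))
  have hpreimage := (((measurePreserving_dir e x).prod
    (measurePreserving_dir e' y)).integrableOn_comp_preimage ((measurableEmbedding_dir e x).prodMap
      (measurableEmbedding_dir e' y))).2 (hf.integrableOn_isCompact hfi himage)
  exact hpreimage.mono_set ((Set.prod_mono Ioc_subset_Icc_self Ioc_subset_Icc_self).trans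
    (subset_preimage_image _ _))

lemma ae_intervalIntegrable_of_mem_Ioc (a b : ℝ) :
    ∀ᵐ t, t ∈ Ioc a b → ∀ c d, IntervalIntegrable (fun s => f (t, s)) volume c d := by
  have hsection := (hf.integrable_comp_dir hfi true true 0 0 a b 0 (2 * π)).prod_right_ae
  rw [ae_restrict_iff' measurableSet_Ioc] at hsection
  filter_upwards [hsection] with t ht hmem
  refine (hf.periodic_snd t).intervalIntegrable₀ Real.two_pi_pos.ne' ?_
  rw [intervalIntegrable_iff_integrableOn_Ioc_of_le Real.two_pi_pos.le]
  have h := ht hmem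
  simp only [dir_true, zero_add] at h
  exact h

lemma ae_intervalIntegrable :
    ∀ᵐ t, ∀ a b, IntervalIntegrable (fun s => f (t, s)) volume a b := by
  filter_upwards [ae_all_iff.2 fun N : ℕ => hf.ae_intervalIntegrable_of_mem_Ioc hfi (-N) N]
    with t ht
  obtain ⟨N, hN⟩ := exists_nat_gt |t|
  exact ht N ⟨(abs_lt.1 hN).1, (abs_lt.1 hN).2.le⟩

lemma ae_intervalIntegrable_dir (e e' : Bool) (x y : ℝ) :
    ∀ᵐ t, ∀ a b, IntervalIntegrable (fun s => f (dir e x t, dir e' y s)) volume a b := by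
  filter_upwards [(measurePreserving_dir e x).quasiMeasurePreserving.ae
    (hf.ae_intervalIntegrable hfi)] with t ht a b
  exact intervalIntegrable_comp_dir ht e' y a b

lemma intervalIntegrable_integral_mul (e e' : Bool) (x y : ℝ) {a b : ℝ} (hab : a ≤ b)
    {K : ℝ → ℝ} (hK : Continuous K) :
    IntervalIntegrable (fun t => ∫ s in 0..π, f (dir e x t, dir e' y s) * K s) volume a b := by
  rw [intervalIntegrable_iff_integrableOn_Ioc_of_le hab]
  simp only [intervalIntegral.integral_of_le Real.pi_pos.le]
  obtain ⟨C, hC⟩ := (isCompact_Icc (a := (0 : ℝ)) (b := π)).exists_bound_of_continuousOn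
    hK.continuousOn
  have hprod : Integrable (fun q : ℝ × ℝ => f (dir e x q.1, dir e' y q.2) * K q.2)
      ((volume.restrict (Ioc a b)).prod (volume.restrict (Ioc 0 π))) := by
    refine (hf.integrable_comp_dir hfi e e' x y a b 0 π).mul_bdd (c := C) (by fun_prop) ?_
    rw [Measure.prod_restrict, ae_restrict_iff' (measurableSet_Ioc.prod measurableSet_Ioc)]
    exact Eventually.of_forall fun q hq => hC _ (Ioc_subset_Icc_self hq.2)
  exact hprod.integral_prod_left

lemma integral_mul_mul_comp_sub_eq {K : ℝ → ℝ} (hK : K.Periodic (2 * π)) (hKc : Continuous K)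
    (hKe : K.Even) (y : ℝ) (c : ℝ → ℝ) : ∀ᵐ t, ∫ s in 0..(2 * π), f (t, s) * (c t * K (y - s)) =
      ∑ e', (∫ s in 0..π, f (t, dir e' y s) * K s) * c t := by
  filter_upwards [hf.ae_intervalIntegrable hfi] with t ht
  rw [← Finset.sum_mul, ← integral_mul_comp_sub_eq_sum_dir (hf.periodic_snd t) (ht _ _) hK hKc hKe,
    ← intervalIntegral.integral_mul_const]
  exact intervalIntegral.integral_congr fun s _ => by ring

lemma cesaroMean_eq_sum_quadrants (a b : ℝ) (n m : ℕ) (x y : ℝ) :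
    cesaroMean a b f n m (x, y) = (1 / π ^ 2 * ∑ e, ∑ e', ∫ t in 0..π,
      (∫ s in 0..π, f (dir e x t, dir e' y s) * cesaroKernel b m s) * cesaroKernel a n t : ℝ) := by
  have hint : IntegrableOn (fun q : ℝ × ℝ => f q *
      (cesaroKernel a n (x - q.1) * cesaroKernel b m (y - q.2))) square (volume.prod volume) :=
    hfi.mul_continuousOn (Continuous.continuousOn (by fun_prop)) isCompact_square
  have hinner (e' : Bool) : IntervalIntegrable (fun t => ∫ s in 0..π,
      f (t, dir e' y s) * cesaroKernel b m s) volume 0 (2 * π) := by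
    simpa only [dir_true, zero_add] using hf.intervalIntegrable_integral_mul hfi true e' 0 y
      Real.two_pi_pos.le (continuous_cesaroKernel b m)
  rw [cesaroMean_eq hfi]
  congr 2
  calc _ = ∫ t in 0..(2 * π), ∫ s in 0..(2 * π), f (t, s) *
        (cesaroKernel a n (x - t) * cesaroKernel b m (y - s)) := by
        simp only [intervalIntegral.integral_of_le Real.two_pi_pos.le,
          ← integral_Icc_eq_integral_Ioc]
        exact setIntegral_prod _ hint
    _ = ∫ t in 0..(2 * π), ∑ e', (∫ s in 0..π, f (t, dir e' y s) * cesaroKernel b m s) *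
        cesaroKernel a n (x - t) := by
        refine intervalIntegral.integral_congr_ae ?_
        filter_upwards [hf.integral_mul_mul_comp_sub_eq hfi (cesaroKernel_periodic b m)
          (continuous_cesaroKernel b m) (cesaroKernel_neg b m) y fun t => cesaroKernel a n (x - t)]
          with t ht _ using ht
    _ = ∑ e', ∑ e, ∫ t in 0..π, (∫ s in 0..π, f (dir e x t, dir e' y s) * cesaroKernel b m s) *
        cesaroKernel a n t := by
        rw [intervalIntegral.integral_finsetSum fun e' _ =>
          (hinner e').mul_continuousOn (Continuous.continuousOn (by fun_prop))]
        exact Finset.sum_congr rfl fun e' _ => integral_mul_comp_sub_eq_sum_dir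
          (fun t => by simp only [(hf _ _).1]) (hinner e') (cesaroKernel_periodic a n)
          (continuous_cesaroKernel a n) (cesaroKernel_neg a n) x
    _ = _ := Finset.sum_comm

end IsBiperiodic

/-! ### Convergence -/

lemma ae_integral_sub_const_mul {G : ℝ → ℝ → ℝ} {K : ℝ → ℝ} {a b : ℝ}
    (hG : ∀ᵐ t, IntervalIntegrable (G t) volume a b) (hK : Continuous K) (c : ℝ) :
    ∀ᵐ t, ∫ s in a..b, (G t s - c) * K s = (∫ s in a..b, G t s * K s) - c * ∫ s in a..b, K s := by
  filter_upwards [hG] with t ht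
  simp only [sub_mul]
  rw [intervalIntegral.integral_sub (ht.mul_continuousOn hK.continuousOn)
    ((hK.intervalIntegrable _ _).const_mul c), intervalIntegral.integral_const_mul]

lemma integral_integral_sub_const_mul_mul {G : ℝ → ℝ → ℝ} {K L : ℝ → ℝ} {a b : ℝ}
    (hG : ∀ᵐ t, IntervalIntegrable (G t) volume a b) (hK : Continuous K) (hL : Continuous L)
    (hGK : IntervalIntegrable (fun t => ∫ s in a..b, G t s * K s) volume a b) (c : ℝ) :
    ∫ t in a..b, (∫ s in a..b, (G t s - c) * K s) * L t =
      (∫ t in a..b, (∫ s in a..b, G t s * K s) * L t) -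
        c * ((∫ s in a..b, K s) * ∫ t in a..b, L t) := by
  rw [← mul_assoc, ← intervalIntegral.integral_const_mul, ← intervalIntegral.integral_sub
    (hGK.mul_continuousOn hL.continuousOn) ((hL.intervalIntegrable _ _).const_mul _)]
  refine intervalIntegral.integral_congr_ae ?_
  filter_upwards [ae_integral_sub_const_mul hG hK c] with t ht _
  rw [ht, sub_mul]

lemma dist_dir_of_pos (e : Bool) (x : ℝ) {t : ℝ} (ht : 0 < t) : dist (dir e x t) x = t := by
  cases e <;> simp [dir, abs_of_pos ht]

lemma tendsto_dir_true (x : ℝ) : Tendsto (dir true x) (𝓝[>] 0) (𝓝[>] x) :=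
  tendsto_nhdsWithin_iff.2 ⟨tendsto_nhdsWithin_of_tendsto_nhds
    (by simpa [dir] using (continuous_dir true x).tendsto 0),
    by filter_upwards [self_mem_nhdsWithin] with t ht using by simpa [dir] using ht⟩

lemma tendsto_dir_false (x : ℝ) : Tendsto (dir false x) (𝓝[>] 0) (𝓝[<] x) :=
  tendsto_nhdsWithin_iff.2 ⟨tendsto_nhdsWithin_of_tendsto_nhds
    (by simpa [dir] using (continuous_dir false x).tendsto 0),
    by filter_upwards [self_mem_nhdsWithin] with t ht using by simpa [dir] using ht⟩

lemma eventually_corner_lt {r : ℝ} (hr : 0 < r) (R : ℕ) :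
    ∀ᶠ n : ℕ in atTop, 1 ≤ n ∧ (R + 1) * (π / n) < r := by
  have hzero : Tendsto (fun n : ℕ => (R + 1) * (π / n)) atTop (𝓝 0) := by
    simpa using (tendsto_const_div_atTop_nhds_zero_nat π).const_mul ((R : ℝ) + 1)
  exact (eventually_ge_atTop 1).and (hzero.eventually (gt_mem_nhds hr))

section Convergence

variable {α β p : ℝ} (hα : α ∈ Ioo (0 : ℝ) 1) (hβ : β ∈ Ioo (0 : ℝ) 1) (hαβ : α + β < 1)
  (hp : 1 < p) {f : ℝ × ℝ → ℝ} (hf : IsBiperiodic f) (hfi : IntegrableOn f square)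
  (hfv : MemPLambdaBV (powLogSeq (α + β) p) f) {η : ℝ} (hη : 0 < η)
include hα hβ hαβ hp hf hfi hfv

include hη in
lemma exists_quadrant_integral_sub_le : ∃ δ > 0, ∃ R : ℕ, ∀ n m : ℕ, 1 ≤ n → 1 ≤ m →
    ∀ (e e' : Bool) (x y ℓ : ℝ), (∀ t ∈ Ioc 0 ((R + 1) * (π / n)),
      ∀ s ∈ Ioc 0 ((R + 1) * (π / m)), |f (dir e x t, dir e' y s) - ℓ| ≤ δ) →
    |(∫ t in 0..π, (∫ s in 0..π, f (dir e x t, dir e' y s) * cesaroKernel (-β) m s) *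
      cesaroKernel (-α) n t) - ℓ * (π / 2 * (π / 2))| ≤ η := by
  obtain ⟨V, hV, hV₁, hV₂⟩ := hfv.exists_lambdaVar_le hf
  obtain ⟨δ, hδ, R, hR⟩ := exists_quadrant_estimate hα hβ hαβ hp (mul_nonneg zero_le_two hV) hη
  refine ⟨δ, hδ, R, fun n m hn hm e e' x y ℓ hℓ => ?_⟩
  have hlam := powLogSeq_succ_pos (α + β) p
  have hslice : ∀ᵐ t, IntervalIntegrable (fun s => f (dir e x t, dir e' y s)) volume 0 π :=
    (hf.ae_intervalIntegrable_dir hfi e e' x y).mono fun t ht => ht 0 π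
  have hinner := hf.intervalIntegrable_integral_mul hfi e e' x y Real.pi_pos.le
    (continuous_cesaroKernel (-β) m)
  have hIβ := integral_cesaroKernel (cesaroNumber_neg_pos hβ.2 m).ne'
  have hIα := integral_cesaroKernel (cesaroNumber_neg_pos hα.2 n).ne'
  have hsub := integral_integral_sub_const_mul_mul hslice (continuous_cesaroKernel (-β) m)
    (continuous_cesaroKernel (-α) n) hinner ℓ
  rw [hIβ, hIα] at hsub
  rw [← hsub]
  refine hR n m hn hm _ (hslice.mono fun t ht => ht.sub intervalIntegrable_const) ?_
    (fun s => (incVarLE_comp_dir hV hlam (hV₁ (dir e' y s)) (hf.periodic_fst _) e x).sub_const ℓ)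
    (fun t => (incVarLE_comp_dir hV hlam (hV₂ (dir e x t)) (hf.periodic_snd _) e' y).sub_const ℓ) hℓ
  have hconst : IntervalIntegrable (fun _ => ℓ * ∫ s in 0..π, cesaroKernel (-β) m s) volume 0 π :=
    intervalIntegrable_const
  refine (hinner.sub hconst).congr_ae (ae_restrict_of_ae ?_)
  filter_upwards [ae_integral_sub_const_mul hslice (continuous_cesaroKernel (-β) m) ℓ] with t ht
    using ht.symm

include hη in
lemma exists_norm_cesaroMean_sub_le : ∃ δ > 0, ∃ R : ℕ, ∀ n m : ℕ, 1 ≤ n → 1 ≤ m →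
    ∀ (x y : ℝ) (ℓ : Bool → Bool → ℝ), (∀ e e', ∀ t ∈ Ioc 0 ((R + 1) * (π / n)),
      ∀ s ∈ Ioc 0 ((R + 1) * (π / m)), |f (dir e x t, dir e' y s) - ℓ e e'| ≤ δ) →
    ‖cesaroMean (-α) (-β) f n m (x, y) - ((1 / 4 * ∑ e, ∑ e', ℓ e e' : ℝ) : ℂ)‖ ≤ η := by
  obtain ⟨δ, hδ, R, hR⟩ := exists_quadrant_integral_sub_le hα hβ hαβ hp hf hfi hfv
    (by positivity : 0 < η * π ^ 2 / 4)
  refine ⟨δ, hδ, R, fun n m hn hm x y ℓ hℓ => ?_⟩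
  set J : Bool → Bool → ℝ := fun e e' => ∫ t in 0..π,
    (∫ s in 0..π, f (dir e x t, dir e' y s) * cesaroKernel (-β) m s) * cesaroKernel (-α) n t
  have hsum : 1 / π ^ 2 * ∑ e, ∑ e', J e e' - 1 / 4 * ∑ e, ∑ e', ℓ e e' =
      1 / π ^ 2 * ∑ e, ∑ e', (J e e' - ℓ e e' * (π / 2 * (π / 2))) := by
    simp only [Finset.sum_sub_distrib, ← Finset.sum_mul]
    field_simp
    ring
  rw [hf.cesaroMean_eq_sum_quadrants hfi, ← Complex.ofReal_sub, Complex.norm_real,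
    Real.norm_eq_abs, hsum, abs_mul, abs_of_pos (by positivity)]
  calc 1 / π ^ 2 * |∑ e, ∑ e', (J e e' - ℓ e e' * (π / 2 * (π / 2)))|
      ≤ 1 / π ^ 2 * ∑ _e : Bool, ∑ _e' : Bool, η * π ^ 2 / 4 := by
        gcongr
        refine (Finset.abs_sum_le_sum_abs _ _).trans (Finset.sum_le_sum fun e _ => ?_)
        exact (Finset.abs_sum_le_sum_abs _ _).trans
          (Finset.sum_le_sum fun e' _ => hR n m hn hm e e' x y _ (hℓ e e'))
    _ = η := by
        simp only [Fintype.sum_bool]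
        field_simp
        ring

lemma tendsto_cesaroMean {x y pp pm mp mm : ℝ} (h : HasQuadrantLimits f x y pp pm mp mm) :
    Tendsto (fun N : ℕ × ℕ => cesaroMean (-α) (-β) f N.1 N.2 (x, y)) (atTop ×ˢ atTop)
      (𝓝 (((1 / 4 : ℝ) * (pp + pm + mp + mm) : ℝ) : ℂ)) := by
  obtain ⟨hpp, hpm, hmp, hmm⟩ := h
  set ℓ : Bool → Bool → ℝ :=
    fun e e' => if e then (if e' then pp else pm) else if e' then mp else mm
  have hsum : pp + pm + mp + mm = ∑ e, ∑ e', ℓ e e' := by simp [ℓ]; ring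
  have hlim (e e' : Bool) : Tendsto (fun q : ℝ × ℝ => f (dir e x q.1, dir e' y q.2))
      (𝓝[>] 0 ×ˢ 𝓝[>] 0) (𝓝 (ℓ e e')) := by
    cases e <;> cases e'
    · exact hmm.comp ((tendsto_dir_false x).prodMap (tendsto_dir_false y))
    · exact hmp.comp ((tendsto_dir_false x).prodMap (tendsto_dir_true y))
    · exact hpm.comp ((tendsto_dir_true x).prodMap (tendsto_dir_false y))
    · exact hpp.comp ((tendsto_dir_true x).prodMap (tendsto_dir_true y))
  rw [Metric.tendsto_nhds, hsum]
  intro η hη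
  obtain ⟨δ, hδ, R, hR⟩ := exists_norm_cesaroMean_sub_le hα hβ hαβ hp hf hfi hfv (half_pos hη)
  have hclose : ∀ᶠ q : ℝ × ℝ in 𝓝[>] 0 ×ˢ 𝓝[>] 0,
      ∀ e e' : Bool, |f (dir e x q.1, dir e' y q.2) - ℓ e e'| < δ :=
    eventually_all.2 fun e => eventually_all.2 fun e' => Metric.tendsto_nhds.1 (hlim e e') δ hδ
  obtain ⟨P, hP, Q, hQ, hPQ⟩ := eventually_prod_iff.1 hclose
  obtain ⟨r, hr₀, hr⟩ := mem_nhdsGT_iff_exists_Ioo_subset.1 (hP.and hQ)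
  filter_upwards [(eventually_corner_lt hr₀ R).prod_mk (eventually_corner_lt hr₀ R)]
    with N ⟨⟨hn, hnr⟩, hm, hmr⟩
  rw [dist_eq_norm]
  refine (hR N.1 N.2 hn hm x y ℓ fun e e' t ht s hs => ?_).trans_lt (half_lt_self hη)
  exact (hPQ (hr ⟨ht.1, ht.2.trans_lt hnr⟩).1 (hr ⟨hs.1, hs.2.trans_lt hmr⟩).2 e e').le

lemma tendstoUniformlyOn_cesaroMean {K : Set (ℝ × ℝ)} (hK : IsCompact K)
    (hc : ∀ q ∈ K, ContinuousAt f q) :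
    TendstoUniformlyOn (fun (N : ℕ × ℕ) (q : ℝ × ℝ) => cesaroMean (-α) (-β) f N.1 N.2 q)
      (fun q => (f q : ℂ)) (atTop ×ˢ atTop) K := by
  rw [Metric.tendstoUniformlyOn_iff]
  intro η hη
  obtain ⟨δ, hδ, R, hR⟩ := exists_norm_cesaroMean_sub_le hα hβ hαβ hp hf hfi hfv (half_pos hη)
  obtain ⟨r, hr₀, hr⟩ := Metric.mem_uniformity_dist.1
    (hK.uniformContinuousAt_of_continuousAt f hc (Metric.dist_mem_uniformity hδ))
  filter_upwards [(eventually_corner_lt hr₀ R).prod_mk (eventually_corner_lt hr₀ R)]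
    with N ⟨⟨hn, hnr⟩, hm, hmr⟩ q hq
  have hsum : f q = 1 / 4 * ∑ _e : Bool, ∑ _e' : Bool, f q := by
    simp only [Fintype.sum_bool]
    ring
  rw [dist_comm, dist_eq_norm, hsum]
  refine (hR N.1 N.2 hn hm q.1 q.2 (fun _ _ => f q) fun e e' t ht s hs => ?_).trans_lt
    (half_lt_self hη)
  have hdist : dist q (dir e q.1 t, dir e' q.2 s) < r := by
    rw [dist_comm, Prod.dist_eq, dist_dir_of_pos e _ ht.1, dist_dir_of_pos e' _ hs.1]
    exact max_lt (ht.2.trans_lt hnr) (hs.2.trans_lt hmr)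
  rw [← Real.dist_eq, dist_comm]
  exact (hr hdist hq).le

end Convergence

/-! ### Test functions adapted to the kernel -/

/-- The projection of the line onto `[p, q]`: `Set.projIcc` without the proof that `p ≤ q` and
with values in `ℝ`. -/
def clamp (p q t : ℝ) : ℝ := max p (min t q)

/-- The parabolic bump on `[T, 2 * T]`, which vanishes at both ends. -/
def bump (T t : ℝ) : ℝ := (t - T) * (2 * T - t) / T ^ 2

/-- The test function that oscillates in phase with the Cesàro kernel of order `-α`, under a bump
on `[T, 2 * T]`. Composing with `clamp` makes it vanish outside `[T, 2 * T]`. -/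
def wave (α : ℝ) (N : ℕ) (T t : ℝ) : ℝ :=
  bump T (clamp T (2 * T) t) * Real.sin (kernelPhase α N (clamp T (2 * T) t))

lemma clamp_mem_Icc {p q : ℝ} (h : p ≤ q) (t : ℝ) : clamp p q t ∈ Icc p q :=
  ⟨le_max_left _ _, max_le h (min_le_right _ _)⟩

lemma clamp_of_mem_Icc {p q t : ℝ} (h : t ∈ Icc p q) : clamp p q t = t := by
  rw [clamp, min_eq_left h.2, max_eq_right h.1]

lemma clamp_of_le {p q t : ℝ} (h : t ≤ p) : clamp p q t = p :=
  max_eq_left ((min_le_left _ _).trans h)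

lemma clamp_of_ge {p q t : ℝ} (hpq : p ≤ q) (h : q ≤ t) : clamp p q t = q := by
  rw [clamp, min_eq_right h, max_eq_right hpq]

lemma clamp_mono (p q : ℝ) : Monotone (clamp p q) := fun _ _ h =>
  max_le_max le_rfl (min_le_min h le_rfl)

@[fun_prop]
lemma continuous_clamp (p q : ℝ) : Continuous (clamp p q) := by unfold clamp; fun_prop

@[fun_prop]
lemma continuous_bump (T : ℝ) : Continuous (bump T) := by unfold bump; fun_prop

@[fun_prop]
lemma continuous_wave (α : ℝ) (N : ℕ) (T : ℝ) : Continuous (wave α N T) := by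
  unfold wave kernelPhase
  fun_prop

lemma bump_left (T : ℝ) : bump T T = 0 := by simp [bump]

lemma bump_right (T : ℝ) : bump T (2 * T) = 0 := by simp [bump]

lemma wave_of_le (α : ℝ) (N : ℕ) {T t : ℝ} (h : t ≤ T) : wave α N T t = 0 := by
  rw [wave, clamp_of_le h, bump_left, zero_mul]

lemma wave_of_ge (α : ℝ) (N : ℕ) {T t : ℝ} (hT : 0 ≤ T) (h : 2 * T ≤ t) : wave α N T t = 0 := by
  rw [wave, clamp_of_ge (by linarith) h, bump_right, zero_mul]

lemma hasDerivAt_bump (T t : ℝ) : HasDerivAt (bump T) ((3 * T - 2 * t) / T ^ 2) t := by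
  have h := (((hasDerivAt_id t).sub_const T).mul ((hasDerivAt_id t).const_sub (2 * T))).div_const
    (T ^ 2)
  refine h.congr_deriv ?_
  simp only [id]
  ring

section Bump

variable {T t t' : ℝ} (hT : 0 < T)
include hT

lemma bump_mem_Icc (ht : t ∈ Icc T (2 * T)) : bump T t ∈ Icc 0 1 := by
  have hleft := sub_nonneg.2 ht.1
  have hright := sub_nonneg.2 ht.2
  refine ⟨div_nonneg (mul_nonneg hleft hright) (sq_nonneg T), ?_⟩
  rw [bump, div_le_one (by positivity)]
  nlinarith

lemma abs_deriv_bump_le (ht : t ∈ Icc T (2 * T)) : |(3 * T - 2 * t) / T ^ 2| ≤ 1 / T := by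
  have h : |3 * T - 2 * t| ≤ T := abs_le.2 ⟨by linarith [ht.2], by linarith [ht.1]⟩
  calc |(3 * T - 2 * t) / T ^ 2| ≤ T / T ^ 2 := by
        rw [abs_div, abs_of_pos (by positivity : 0 < T ^ 2)]
        gcongr
    _ = 1 / T := by field_simp

lemma abs_bump_sub_le (ht : t ∈ Icc T (2 * T)) (ht' : t' ∈ Icc T (2 * T)) :
    |bump T t - bump T t'| ≤ 1 / T * |t - t'| := by
  rw [← Real.norm_eq_abs, ← Real.norm_eq_abs]
  exact (convex_Icc T (2 * T)).norm_image_sub_le_of_norm_hasDerivWithin_le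
    (fun x _ => (hasDerivAt_bump T x).hasDerivWithinAt) (fun x hx => abs_deriv_bump_le hT hx) ht' ht

lemma integral_bump : ∫ t in T..(2 * T), bump T t = T / 6 := by
  have hderiv (t : ℝ) : HasDerivAt
      (fun t => (-(t ^ 3) / 3 + 3 * T * t ^ 2 / 2 - 2 * T ^ 2 * t) / T ^ 2) (bump T t) t := by
    have h := ((((hasDerivAt_pow 3 t).neg.div_const 3).add
      (((hasDerivAt_pow 2 t).const_mul (3 * T)).div_const 2)).sub
        ((hasDerivAt_id t).const_mul (2 * T ^ 2))).div_const (T ^ 2)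
    refine h.congr_deriv ?_
    rw [bump]
    push_cast
    field_simp
    ring
  rw [intervalIntegral.integral_eq_sub_of_hasDerivAt (fun t _ => hderiv t)
    ((continuous_bump T).intervalIntegrable _ _)]
  field_simp
  ring

lemma abs_wave_le (α : ℝ) (N : ℕ) (t : ℝ) : |wave α N T t| ≤ 1 := by
  obtain ⟨hbump₀, hbump₁⟩ := bump_mem_Icc hT (clamp_mem_Icc (by linarith : T ≤ 2 * T) t)
  rw [wave, abs_mul, abs_of_nonneg hbump₀]
  exact mul_le_one₀ hbump₁ (abs_nonneg _) (Real.abs_sin_le_one _)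

lemma abs_wave_sub_le {α : ℝ} {N : ℕ} (hM : 0 ≤ kernelFreq α N) (t t' : ℝ) :
    |wave α N T t - wave α N T t'| ≤
      (1 / T + kernelFreq α N) * |clamp T (2 * T) t - clamp T (2 * T) t'| := by
  have hc := clamp_mem_Icc (by linarith : T ≤ 2 * T) t
  have hc' := clamp_mem_Icc (by linarith : T ≤ 2 * T) t'
  simp only [wave]
  set c := clamp T (2 * T) t
  set c' := clamp T (2 * T) t'
  obtain ⟨hbump₀, hbump₁⟩ := bump_mem_Icc hT hc
  have hsin : |Real.sin (kernelPhase α N c) - Real.sin (kernelPhase α N c')| ≤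
      kernelFreq α N * |c - c'| := by
    refine (Real.abs_sin_sub_sin_le _ _).trans_eq ?_
    rw [kernelPhase, kernelPhase, add_sub_add_right_eq_sub, ← mul_sub, abs_mul, abs_of_nonneg hM]
  calc |bump T c * Real.sin (kernelPhase α N c) - bump T c' * Real.sin (kernelPhase α N c')|
      = |bump T c * (Real.sin (kernelPhase α N c) - Real.sin (kernelPhase α N c')) +
          (bump T c - bump T c') * Real.sin (kernelPhase α N c')| := by ring_nf
    _ ≤ 1 * (kernelFreq α N * |c - c'|) + 1 / T * |c - c'| * 1 := by
        refine (abs_add_le _ _).trans ?_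
        rw [abs_mul, abs_mul, abs_of_nonneg hbump₀]
        gcongr
        · exact abs_bump_sub_le hT hc hc'
        · exact Real.abs_sin_le_one _
    _ = (1 / T + kernelFreq α N) * |c - c'| := by ring

lemma integral_wave_mul_eq {α b : ℝ} {N : ℕ} (hb : 2 * T ≤ b) {K : ℝ → ℝ} (hK : Continuous K) :
    ∫ t in 0..b, wave α N T t * K t = ∫ t in T..(2 * T), wave α N T t * K t := by
  have hint (u v : ℝ) : IntervalIntegrable (fun t => wave α N T t * K t) volume u v :=
    Continuous.intervalIntegrable (by fun_prop) u v
  have hleft : ∫ t in 0..T, wave α N T t * K t = 0 :=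
    intervalIntegral.integral_zero_ae <| Eventually.of_forall fun t ht => by
      rw [uIoc_of_le hT.le] at ht
      rw [wave_of_le α N ht.2, zero_mul]
  have hright : ∫ t in (2 * T)..b, wave α N T t * K t = 0 :=
    intervalIntegral.integral_zero_ae <| Eventually.of_forall fun t ht => by
      rw [uIoc_of_le hb] at ht
      rw [wave_of_ge α N hT.le ht.1.le, zero_mul]
  rw [← intervalIntegral.integral_add_adjacent_intervals (hint 0 T) (hint T b),
    ← intervalIntegral.integral_add_adjacent_intervals (hint T (2 * T)) (hint (2 * T) b),
    hleft, hright, zero_add, add_zero]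

end Bump

-- Multiplying the wave by the kernel turns `sin² θ` into `(1 - cos 2θ) / 2`: a main term and an
-- oscillating term of twice the frequency.
lemma wave_mul_cesaroKernel (α : ℝ) (N : ℕ) {T t : ℝ} (ht : t ∈ Icc T (2 * T))
    (htπ : t ∈ Ioc 0 π) :
    wave α N T t * cesaroKernel (-α) N t = (bump T t * (kernelAmplitude α N t).re -
      (Complex.exp ((2 * kernelFreq α N * t + α * π : ℝ) * I) *
        (bump T t * kernelAmplitude α N t)).re) / (2 * cesaroNumber (-α) N) := by
  rw [wave, clamp_of_mem_Icc ht, cesaroKernel_eq_im α N htπ]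
  set S := kernelAmplitude α N t
  set θ := kernelPhase α N t with hθ
  have hphase : 2 * kernelFreq α N * t + α * π = 2 * θ := by rw [hθ, kernelPhase]; ring
  rw [hphase, mul_left_comm, Complex.re_ofReal_mul, Complex.mul_im, Complex.mul_re,
    Complex.exp_ofReal_mul_I_re, Complex.exp_ofReal_mul_I_im, Complex.exp_ofReal_mul_I_re,
    Complex.exp_ofReal_mul_I_im, Real.cos_two_mul, Real.sin_two_mul]
  rcases eq_or_ne (cesaroNumber (-α) N) 0 with h0 | h0
  · simp [h0]
  field_simp
  linear_combination 2 * bump T t * S.re * Real.sin_sq_add_cos_sq θ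

section WaveIntegral

variable {α T : ℝ} {N : ℕ} (hT : 0 < T) (hTπ : 2 * T ≤ π)
include hT hTπ

lemma Icc_subset_Ioc_zero_pi : Icc T (2 * T) ⊆ Ioc 0 π := fun _ hx =>
  ⟨hT.trans_le hx.1, hx.2.trans hTπ⟩

lemma continuousOn_kernelAmplitude : ContinuousOn (kernelAmplitude α N) (Icc T (2 * T)) :=
  fun _ hx => (hasDerivAt_kernelAmplitude N
    (Icc_subset_Ioc_zero_pi hT hTπ hx)).continuousAt.continuousWithinAt

lemma intervalIntegrable_bump_mul_re_kernelAmplitude :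
    IntervalIntegrable (fun t => bump T t * (kernelAmplitude α N t).re) volume T (2 * T) := by
  refine ContinuousOn.intervalIntegrable ?_
  rw [uIcc_of_le (by linarith)]
  exact (continuous_bump T).continuousOn.mul
    (Complex.continuous_re.comp_continuousOn (continuousOn_kernelAmplitude hT hTπ))

lemma integral_wave_mul_cesaroKernel_eq :
    ∫ t in T..(2 * T), wave α N T t * cesaroKernel (-α) N t =
      ((∫ t in T..(2 * T), bump T t * (kernelAmplitude α N t).re) -
        (∫ t in T..(2 * T), Complex.exp ((2 * kernelFreq α N * t + α * π : ℝ) * I) *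
          (bump T t * kernelAmplitude α N t)).re) / (2 * cesaroNumber (-α) N) := by
  have hT2 : T ≤ 2 * T := by linarith
  have hexp : IntervalIntegrable (fun t : ℝ =>
      Complex.exp ((2 * kernelFreq α N * t + α * π : ℝ) * I) *
        (bump T t * kernelAmplitude α N t)) volume T (2 * T) := by
    refine ContinuousOn.intervalIntegrable ?_
    rw [uIcc_of_le hT2]
    exact (Continuous.continuousOn (by fun_prop)).mul ((Continuous.continuousOn (by fun_prop)).mul
      (continuousOn_kernelAmplitude hT hTπ))
  have hexp_re : IntervalIntegrable (fun t : ℝ =>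
      (Complex.exp ((2 * kernelFreq α N * t + α * π : ℝ) * I) *
        (bump T t * kernelAmplitude α N t)).re) volume T (2 * T) := ⟨hexp.1.re, hexp.2.re⟩
  have hre := ContinuousLinearMap.intervalIntegral_comp_comm Complex.reCLM hexp
  simp only [Complex.reCLM_apply] at hre
  rw [← hre, ← intervalIntegral.integral_sub
    (intervalIntegrable_bump_mul_re_kernelAmplitude hT hTπ) hexp_re,
    ← intervalIntegral.integral_div]
  refine intervalIntegral.integral_congr fun t ht => ?_
  rw [uIcc_of_le hT2] at ht
  exact wave_mul_cesaroKernel α N ht (Icc_subset_Ioc_zero_pi hT hTπ ht)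

variable (hα : α ∈ Ioo (0 : ℝ) 1)
include hα

lemma integral_bump_mul_re_kernelAmplitude_ge (hNT : 12 * (N * T) ^ (-α) ≤ 1) (hN : 1 ≤ N) :
    T ^ α / 48 ≤ ∫ t in T..(2 * T), bump T t * (kernelAmplitude α N t).re := by
  have : (0 : ℝ) < N := by exact_mod_cast hN
  have hpow : 2⁻¹ ≤ (2 : ℝ) ^ (α - 1) := by
    rw [← Real.rpow_neg_one]
    exact Real.rpow_le_rpow_of_exponent_le one_le_two (by linarith [hα.1])
  have hre (t : ℝ) (ht : t ∈ Icc T (2 * T)) :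
      1 / 4 * (2 * T) ^ (α - 1) ≤ (kernelAmplitude α N t).re := by
    have ht₀ := hT.trans_le ht.1
    refine le_trans ?_ (re_kernelAmplitude_ge hα N (Icc_subset_Ioc_zero_pi hT hTπ ht) ?_)
    · gcongr ?_ * ?_
      exact Real.rpow_le_rpow_of_nonpos ht₀ ht.2 (by linarith [hα.2])
    · refine le_trans ?_ hNT
      gcongr ?_ * ?_
      refine Real.rpow_le_rpow_of_nonpos (by positivity) ?_ (by linarith [hα.1])
      gcongr
      · linarith
      · exact ht.1
  calc T ^ α / 48 = T ^ α / 24 * 2⁻¹ := by ring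
    _ ≤ T ^ α / 24 * 2 ^ (α - 1) := by gcongr
    _ = ∫ t in T..(2 * T), bump T t * (1 / 4 * (2 * T) ^ (α - 1)) := by
        rw [intervalIntegral.integral_mul_const, integral_bump hT, Real.mul_rpow zero_le_two hT.le,
          Real.rpow_sub_one hT.ne']
        field_simp
        norm_num
    _ ≤ _ := intervalIntegral.integral_mono_on (by linarith)
        (Continuous.intervalIntegrable (by fun_prop) _ _)
        (intervalIntegrable_bump_mul_re_kernelAmplitude hT hTπ)
        fun t ht => mul_le_mul_of_nonneg_left (hre t ht) (bump_mem_Icc hT ht).1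

lemma norm_deriv_bump_mul_kernelAmplitude_le {t : ℝ} (ht : t ∈ Icc T (2 * T))
    (hNT : 1 ≤ (N + 1) * T) :
    ‖deriv (fun t => (bump T t : ℂ) * kernelAmplitude α N t) t‖ ≤ 39 * T ^ (α - 2) := by
  have hsub := Icc_subset_Ioc_zero_pi hT hTπ ht
  have hNt : 1 ≤ ((N : ℝ) + 1) * t := hNT.trans (by gcongr; exact ht.1)
  have hα₁ := hα.2
  have hdiff := (hasDerivAt_kernelAmplitude (α := α) N hsub).differentiableAt.hasDerivAt
  have hderiv_mul : HasDerivAt (fun t => (bump T t : ℂ) * kernelAmplitude α N t) _ t :=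
    (hasDerivAt_bump T t).ofReal_comp.mul hdiff
  rw [hderiv_mul.deriv]
  have hamplitude := norm_kernelAmplitude_le hα N hsub hNt
  have hderiv := norm_deriv_kernelAmplitude_le hα N hsub hNt
  have hpow₁ : t ^ (α - 1) ≤ T ^ (α - 1) := Real.rpow_le_rpow_of_nonpos hT ht.1 (by linarith)
  have hpow₂ : t ^ (α - 2) ≤ T ^ (α - 2) := Real.rpow_le_rpow_of_nonpos hT ht.1 (by linarith)
  have hpow : T ^ (α - 2) = T ^ (α - 1) / T := by rw [← Real.rpow_sub_one hT.ne']; ring_nf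
  obtain ⟨hbump₀, hbump₁⟩ := bump_mem_Icc hT ht
  refine (norm_add_le _ _).trans ?_
  rw [norm_mul, norm_mul, Complex.norm_real, Complex.norm_of_nonneg hbump₀, Real.norm_eq_abs]
  calc |(3 * T - 2 * t) / T ^ 2| * ‖kernelAmplitude α N t‖ +
        bump T t * ‖deriv (kernelAmplitude α N) t‖
      ≤ 1 / T * (15 * T ^ (α - 1)) + 1 * (24 * T ^ (α - 2)) := by
        gcongr
        · exact abs_deriv_bump_le hT ht
        · exact hamplitude.trans (by gcongr)
        · exact hderiv.trans (by gcongr)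
    _ = 39 * T ^ (α - 2) := by rw [hpow]; ring

lemma norm_integral_exp_mul_bump_mul_kernelAmplitude_le (hNT : 2048 ≤ N * T) :
    ‖∫ t in T..(2 * T), Complex.exp ((2 * kernelFreq α N * t + α * π : ℝ) * I) *
      (bump T t * kernelAmplitude α N t)‖ ≤ T ^ α / 96 := by
  have hT2 : T ≤ 2 * T := by linarith
  have hfreq : 2048 ≤ kernelFreq α N * T := hNT.trans (by gcongr; exact kernelFreq_ge hα N)
  have hfreq₀ : 0 < kernelFreq α N := pos_of_mul_pos_left (by linarith) hT.le
  set S : ℝ → ℂ := fun t => bump T t * kernelAmplitude α N t with hS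
  have hdiff (x : ℝ) (hx : x ∈ Icc T (2 * T)) : DifferentiableAt ℝ S x :=
    ((hasDerivAt_bump T x).ofReal_comp.mul
      (hasDerivAt_kernelAmplitude N (Icc_subset_Ioc_zero_pi hT hTπ hx))).differentiableAt
  have hle (x : ℝ) (hx : x ∈ Icc T (2 * T)) : ‖deriv S x‖ ≤ 39 * T ^ (α - 2) :=
    norm_deriv_bump_mul_kernelAmplitude_le hT hTπ hα hx (by linarith)
  have hint := intervalIntegrable_deriv_of_norm_le hT2 intervalIntegrable_const hle
  have hvariation : ∫ x in T..(2 * T), ‖deriv S x‖ ≤ 39 * T ^ α / T := by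
    calc ∫ x in T..(2 * T), ‖deriv S x‖ ≤ ∫ _x in T..(2 * T), 39 * T ^ (α - 2) :=
          intervalIntegral.integral_mono_on hT2 hint.norm intervalIntegrable_const hle
      _ = 39 * T ^ α / T := by
          rw [intervalIntegral.integral_const, Real.rpow_sub hT, Real.rpow_two, smul_eq_mul]
          field_simp
          ring
  calc _ ≤ (‖S T‖ + ‖S (2 * T)‖ + ∫ x in T..(2 * T), ‖deriv S x‖) / (2 * kernelFreq α N) :=
        norm_integral_exp_mul_le (by positivity) (α * π) hT2 hdiff hint
    _ ≤ 39 * T ^ α / T / (2 * kernelFreq α N) := by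
        simp only [hS, bump_left, bump_right, Complex.ofReal_zero, zero_mul, norm_zero, zero_add]
        gcongr
    _ = 39 / 2 * T ^ α / (kernelFreq α N * T) := by field_simp
    _ ≤ 39 / 2 * T ^ α / 2048 := by gcongr
    _ ≤ T ^ α / 96 := by
        have : 0 ≤ T ^ α := by positivity
        linarith

lemma integral_wave_mul_cesaroKernel_ge (hNT : 2048 ≤ N * T) (hNT' : 12 * (N * T) ^ (-α) ≤ 1) :
    (N * T) ^ α / 192 ≤ ∫ t in 0..π, wave α N T t * cesaroKernel (-α) N t := by
  have hN₀ : (0 : ℝ) < N := pos_of_mul_pos_left (by linarith) hT.le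
  have hA := cesaroNumber_neg_pos hα.2 N
  have hmain := integral_bump_mul_re_kernelAmplitude_ge hT hTπ hα hNT' (by exact_mod_cast hN₀)
  have hosc := (Complex.re_le_norm _).trans
    (norm_integral_exp_mul_bump_mul_kernelAmplitude_le hT hTπ hα hNT)
  have hAle : cesaroNumber (-α) N ≤ (N : ℝ) ^ (-α) := (cesaroNumber_neg_le hα.1.le hα.2 N).trans
    (Real.rpow_le_rpow_of_nonpos hN₀ (by linarith) (by linarith [hα.1]))
  rw [integral_wave_mul_eq hT hTπ (continuous_cesaroKernel _ _),
    integral_wave_mul_cesaroKernel_eq hT hTπ, le_div_iff₀ (by positivity)]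
  calc (N * T) ^ α / 192 * (2 * cesaroNumber (-α) N)
      ≤ (N * T) ^ α / 192 * (2 * (N : ℝ) ^ (-α)) := by gcongr
    _ = T ^ α / 48 - T ^ α / 96 := by
        rw [Real.mul_rpow hN₀.le hT.le, Real.rpow_neg hN₀.le]
        field_simp
        norm_num
    _ ≤ _ := by linarith

end WaveIntegral

lemma exists_integral_wave_ge {α : ℝ} (hα : α ∈ Ioo (0 : ℝ) 1) :
    ∃ R : ℝ, ∀ (N : ℕ) (T : ℝ), 0 < T → 2 * T ≤ π → R ≤ N * T →
      (N * T) ^ α / 192 ≤ ∫ t in 0..π, wave α N T t * cesaroKernel (-α) N t := by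
  have hlim : Tendsto (fun x : ℝ => 12 * x ^ (-α)) atTop (𝓝 0) := by
    simpa using (tendsto_rpow_neg_atTop hα.1).const_mul 12
  obtain ⟨R, hR⟩ := eventually_atTop.1
    ((hlim.eventually (ge_mem_nhds one_pos)).and (eventually_ge_atTop 2048))
  exact ⟨R, fun N T hT hTπ hNT =>
    integral_wave_mul_cesaroKernel_ge hT hTπ hα (hR _ hNT).2 (hR _ hNT).1⟩

/-! ### Variation of the test functions -/

lemma sum_rpow_sub_one_le {s : ℝ} (hs : s ∈ Ioo (0 : ℝ) 1) (Q : ℕ) :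
    ∑ i ∈ Finset.range Q, ((i : ℝ) + 1) ^ (s - 1) ≤ (Q : ℝ) ^ s / s := by
  have hs₀ := hs.1
  induction Q with
  | zero => simp [Real.zero_rpow hs₀.ne']
  | succ k ih =>
    have hk : (0 : ℝ) < (k : ℝ) + 1 := by positivity
    have hbernoulli := rpow_one_add_le_one_add_mul_self (s := -(1 / ((k : ℝ) + 1))) (p := s)
      (by rw [neg_le_neg_iff, div_le_one hk]; linarith [k.cast_nonneg (α := ℝ)]) hs₀.le hs.2.le
    have hratio : (1 : ℝ) + -(1 / ((k : ℝ) + 1)) = k / (k + 1) := by field_simp; ring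
    rw [hratio, Real.div_rpow (by positivity) hk.le, div_le_iff₀ (by positivity)] at hbernoulli
    rw [le_div_iff₀ hs₀] at ih ⊢
    rw [Finset.sum_range_succ, Real.rpow_sub_one hk.ne', Nat.cast_add_one]
    linear_combination ih + hbernoulli

section Weights

variable {s : ℝ} {Q i : ℕ}

lemma inv_powLogSeq_one_succ (s : ℝ) (i : ℕ) :
    (powLogSeq s 1 (i + 1))⁻¹ = Real.log (i + 2) * ((i : ℝ) + 1) ^ (s - 1) := by
  rw [powLogSeq_succ, Real.rpow_one, inv_div, div_eq_mul_inv, ← Real.rpow_neg (by positivity),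
    neg_sub]

lemma inv_powLogSeq_one_le_of_lt (s : ℝ) (h : i < Q) :
    (powLogSeq s 1 (i + 1))⁻¹ ≤ Real.log (Q + 1) * ((i : ℝ) + 1) ^ (s - 1) := by
  have hiQ : (i : ℝ) + 1 ≤ Q := by exact_mod_cast h
  rw [inv_powLogSeq_one_succ]
  exact mul_le_mul_of_nonneg_right (Real.log_le_log (by positivity) (by linarith)) (by positivity)

lemma inv_powLogSeq_one_le_of_ge (hs : s < 1) (hQ : 1 ≤ Q) (h : Q ≤ i) :
    (powLogSeq s 1 (i + 1))⁻¹ ≤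
      (1 + 1 / ((1 - s) * Real.log 2)) * (Real.log (Q + 1) * (Q : ℝ) ^ (s - 1)) := by
  have hQ₁ : (1 : ℝ) ≤ Q := by exact_mod_cast hQ
  have hiQ : (Q : ℝ) ≤ (i : ℝ) + 1 := by exact_mod_cast h.trans i.le_succ
  have hcancel : (((i : ℝ) + 1) / Q) ^ (1 - s) * ((i : ℝ) + 1) ^ (s - 1) = (Q : ℝ) ^ (s - 1) := by
    rw [Real.div_rpow (by positivity) (by positivity), div_mul_eq_mul_div,
      ← Real.rpow_add (by positivity), ← neg_sub 1 s, Real.rpow_neg (by positivity), add_neg_cancel,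
      Real.rpow_zero, one_div]
  have hlog := log_add_one_le_mul_rpow (sub_pos.2 hs) hQ₁ hiQ
  rw [add_assoc, one_add_one_eq_two] at hlog
  rw [inv_powLogSeq_one_succ, ← hcancel]
  refine (mul_le_mul_of_nonneg_right hlog (by positivity)).trans_eq (by ring)

end Weights

-- The head `i < Q` is estimated by the size `D` of the terms, the tail `Q ≤ i` by their sum.
lemma exists_sum_div_powLogSeq_le {s : ℝ} (hs : s ∈ Ioo (0 : ℝ) 1) : ∃ C : ℝ, 0 ≤ C ∧
    ∀ (n : ℕ) (d : Fin n → ℝ) (D : ℝ) (Q : ℕ), 1 ≤ Q → 0 ≤ D → (∀ i, d i ∈ Icc 0 D) →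
      ∑ i, d i ≤ D * Q →
      ∑ i, d i / powLogSeq s 1 (i + 1) ≤ C * (D * (Real.log (Q + 1) * (Q : ℝ) ^ s)) := by
  obtain ⟨hs₀, hs₁⟩ := hs
  have : 0 < 1 - s := by linarith
  have : 0 < Real.log 2 := Real.log_pos one_lt_two
  set B : ℝ := 1 + 1 / ((1 - s) * Real.log 2)
  refine ⟨1 / s + B, by positivity, fun n d D Q hQ hD hd hsum => ?_⟩
  have : 0 ≤ Real.log ((Q : ℝ) + 1) := Real.log_nonneg (by simp)
  set L := Real.log ((Q : ℝ) + 1)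
  have hterm (i : Fin n) : d i / powLogSeq s 1 (i + 1) ≤
      D * L * (if (i : ℕ) < Q then ((i : ℝ) + 1) ^ (s - 1) else 0) +
        B * (L * (Q : ℝ) ^ (s - 1)) * d i := by
    obtain ⟨hd₀, hdD⟩ := hd i
    rw [div_eq_mul_inv]
    split_ifs with h
    · refine le_add_of_le_of_nonneg ?_ (by positivity)
      rw [mul_assoc]
      exact mul_le_mul hdD (inv_powLogSeq_one_le_of_lt s h)
        (inv_nonneg.2 (powLogSeq_succ_pos s 1 i).le) hD
    · rw [mul_zero, zero_add, mul_comm (d i)]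
      exact mul_le_mul_of_nonneg_right (inv_powLogSeq_one_le_of_ge hs₁ hQ (not_lt.1 h)) hd₀
  have hhead : ∑ i : Fin n, (if (i : ℕ) < Q then ((i : ℝ) + 1) ^ (s - 1) else 0) ≤
      (Q : ℝ) ^ s / s := by
    rw [Fin.sum_univ_eq_sum_range (fun i => if i < Q then ((i : ℝ) + 1) ^ (s - 1) else 0),
      ← Finset.sum_filter]
    refine (Finset.sum_le_sum_of_subset_of_nonneg (fun i hi => ?_)
      fun i _ _ => by positivity).trans (sum_rpow_sub_one_le ⟨hs₀, hs₁⟩ Q)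
    exact Finset.mem_range.2 (Finset.mem_filter.1 hi).2
  calc ∑ i, d i / powLogSeq s 1 (i + 1)
      ≤ D * L * ∑ i : Fin n, (if (i : ℕ) < Q then ((i : ℝ) + 1) ^ (s - 1) else 0) +
        B * (L * (Q : ℝ) ^ (s - 1)) * ∑ i, d i := by
        rw [Finset.mul_sum, Finset.mul_sum, ← Finset.sum_add_distrib]
        exact Finset.sum_le_sum fun i _ => hterm i
    _ ≤ D * L * ((Q : ℝ) ^ s / s) + B * (L * (Q : ℝ) ^ (s - 1)) * (D * Q) := by gcongr
    _ = _ := by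
        rw [Real.rpow_sub_one (by positivity)]
        field_simp

lemma exists_lambdaVar_powLogSeq_le {s : ℝ} (hs : s ∈ Ioo (0 : ℝ) 1) : ∃ C : ℝ, 0 ≤ C ∧
    ∀ (g : ℝ → ℝ) (D : ℝ) (Q : ℕ), 1 ≤ Q → 0 ≤ D → (∀ x y, |g x - g y| ≤ D) →
      (∀ E : IntervalCollection, ∑ i, |g (E.b i) - g (E.a i)| ≤ D * Q) →
      lambdaVar (powLogSeq s 1) g ≤
        ENNReal.ofReal (C * (D * (Real.log (Q + 1) * (Q : ℝ) ^ s))) := by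
  obtain ⟨C, hC, hbound⟩ := exists_sum_div_powLogSeq_le hs
  refine ⟨C, hC, fun g D Q hQ hD hg hvar => iSup_le fun E => ?_⟩
  rw [← ENNReal.ofReal_sum_of_nonneg fun (i : Fin E.n) _ =>
    div_nonneg (abs_nonneg _) (powLogSeq_succ_pos s 1 i).le]
  exact ENNReal.ofReal_le_ofReal
    (hbound E.n _ D Q hQ hD (fun i => ⟨abs_nonneg _, hg _ _⟩) (hvar E))

lemma lambdaVar_const_mul_le (lam : ℕ → ℝ) (c : ℝ) (g : ℝ → ℝ) :
    lambdaVar lam (fun x => c * g x) ≤ ENNReal.ofReal |c| * lambdaVar lam g := by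
  refine iSup_le fun E => ?_
  simp only [← mul_sub, abs_mul, mul_div_assoc, ENNReal.ofReal_mul (abs_nonneg c),
    ← Finset.mul_sum]
  gcongr
  exact le_iSup (fun E : IntervalCollection => ∑ i : Fin E.n,
    ENNReal.ofReal (|g (E.b i) - g (E.a i)| / lam ((i : ℕ) + 1))) E

lemma lambdaVar_tsum_le {κ : Type*} (lam : ℕ → ℝ) {g : κ → ℝ → ℝ}
    (hg : ∀ x, Summable fun m => g m x) :
    lambdaVar lam (fun x => ∑' m, g m x) ≤ ∑' m, lambdaVar lam (g m) := by
  refine iSup_le fun E => ?_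
  have hterm (i : Fin E.n) :
      ENNReal.ofReal (|∑' m, g m (E.b i) - ∑' m, g m (E.a i)| / lam ((i : ℕ) + 1)) ≤
        ∑' m, ENNReal.ofReal (|g m (E.b i) - g m (E.a i)| / lam ((i : ℕ) + 1)) := by
    simp only [div_eq_mul_inv, ENNReal.ofReal_mul (abs_nonneg _), ← Real.enorm_eq_ofReal_abs,
      ENNReal.tsum_mul_right]
    rw [← (hg _).tsum_sub (hg _)]
    gcongr
    exact enorm_tsum_le_tsum_enorm
  calc _ ≤ ∑ i : Fin E.n, ∑' m,
        ENNReal.ofReal (|g m (E.b i) - g m (E.a i)| / lam ((i : ℕ) + 1)) :=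
        Finset.sum_le_sum fun i _ => hterm i
    _ = ∑' m, ∑ i : Fin E.n,
        ENNReal.ofReal (|g m (E.b i) - g m (E.a i)| / lam ((i : ℕ) + 1)) :=
        (Summable.tsum_finsetSum fun _ _ => ENNReal.summable).symm
    _ ≤ _ := ENNReal.tsum_le_tsum fun m => le_iSup (fun E : IntervalCollection =>
        ∑ i : Fin E.n, ENNReal.ofReal (|g m (E.b i) - g m (E.a i)| / lam ((i : ℕ) + 1))) E

lemma clamp_sub_clamp {p q a b : ℝ} (hpq : p ≤ q) (hab : a ≤ b) :
    clamp p q b - clamp p q a = volume.real (Ioo a b ∩ Ioo p q) := by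
  rw [Ioo_inter_Ioo, Real.volume_real_Ioo, clamp, clamp]
  grind

lemma IntervalCollection.sum_clamp_sub_clamp_le (E : IntervalCollection) {p q : ℝ} (hpq : p ≤ q) :
    ∑ i, (clamp p q (E.b i) - clamp p q (E.a i)) ≤ q - p := by
  calc ∑ i, (clamp p q (E.b i) - clamp p q (E.a i))
      = ∑ i, volume.real (Ioo (E.a i) (E.b i) ∩ Ioo p q) :=
        Finset.sum_congr rfl fun i _ => clamp_sub_clamp hpq (E.lt i).le
    _ = volume.real (⋃ i ∈ Finset.univ, Ioo (E.a i) (E.b i) ∩ Ioo p q) :=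
        (measureReal_biUnion_finset
          (fun i _ j _ hij => (E.nonoverlapping i j hij).mono inter_subset_left inter_subset_left)
          (fun i _ => measurableSet_Ioo.inter measurableSet_Ioo)
          fun i _ => measure_ne_top_of_subset inter_subset_right measure_Ioo_lt_top.ne).symm
    _ ≤ volume.real (Ioo p q) := measureReal_mono (by simp) measure_Ioo_lt_top.ne
    _ = q - p := Real.volume_real_Ioo_of_le hpq

/-- The even `2π`-periodic function which is the identity on `[0, π]`; composing with it makes a
function on `[0, π]` even and `2π`-periodic. -/
def fold (x : ℝ) : ℝ := Real.arccos (Real.cos x)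

@[fun_prop]
lemma continuous_fold : Continuous fold := Real.continuous_arccos.comp Real.continuous_cos

lemma fold_add_two_pi (x : ℝ) : fold (x + 2 * π) = fold x := by
  rw [fold, fold, Real.cos_add_two_pi]

lemma fold_neg (x : ℝ) : fold (-x) = fold x := by rw [fold, fold, Real.cos_neg]

lemma fold_of_mem_Icc {x : ℝ} (h : x ∈ Icc 0 π) : fold x = x := Real.arccos_cos h.1 h.2

lemma fold_of_mem_Icc_pi_two_pi {x : ℝ} (h : x ∈ Icc π (2 * π)) : fold x = 2 * π - x := by
  rw [fold, ← Real.cos_two_pi_sub, Real.arccos_cos (by linarith [h.2]) (by linarith [h.1])]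

section FoldedWave

variable {T : ℝ} (hT₁ : T ≤ 1)
include hT₁

lemma clamp_fold (hT : 0 ≤ T) {x : ℝ} (hx : x ∈ Icc 0 (2 * π)) :
    clamp T (2 * T) (fold x) =
      clamp T (2 * T) x - clamp (2 * π - 2 * T) (2 * π - T) x + (2 * π - 2 * T) := by
  have hπ := Real.pi_gt_three
  rcases le_total x π with h | h
  · rw [fold_of_mem_Icc ⟨hx.1, h⟩, clamp_of_le (p := 2 * π - 2 * T) (by linarith)]
    ring
  · rw [fold_of_mem_Icc_pi_two_pi ⟨h, hx.2⟩, clamp_of_ge (t := x) (by linarith) (by linarith)]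
    simp only [clamp]
    grind

lemma IntervalCollection.sum_abs_clamp_fold_sub_le (hT : 0 ≤ T) (E : IntervalCollection) :
    ∑ i, |clamp T (2 * T) (fold (E.b i)) - clamp T (2 * T) (fold (E.a i))| ≤ 2 * T := by
  have hterm (i : Fin E.n) : |clamp T (2 * T) (fold (E.b i)) - clamp T (2 * T) (fold (E.a i))| ≤
      (clamp T (2 * T) (E.b i) - clamp T (2 * T) (E.a i)) +
      (clamp (2 * π - 2 * T) (2 * π - T) (E.b i) -
        clamp (2 * π - 2 * T) (2 * π - T) (E.a i)) := by
    have hab := (E.lt i).le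
    rw [clamp_fold hT₁ hT ⟨(E.zero_le i).trans hab, E.le_two_pi i⟩,
      clamp_fold hT₁ hT ⟨E.zero_le i, hab.trans (E.le_two_pi i)⟩]
    have hleft := clamp_mono T (2 * T) hab
    have hright := clamp_mono (2 * π - 2 * T) (2 * π - T) hab
    rw [abs_le]
    constructor <;> linarith
  refine (Finset.sum_le_sum fun i _ => hterm i).trans ?_
  rw [Finset.sum_add_distrib]
  linarith [E.sum_clamp_sub_clamp_le (p := T) (q := 2 * T) (by linarith),
    E.sum_clamp_sub_clamp_le (p := 2 * π - 2 * T) (q := 2 * π - T) (by linarith)]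

lemma IntervalCollection.sum_abs_wave_fold_sub_le (hT : 0 < T) {α : ℝ} {N : ℕ}
    (hN : 0 ≤ kernelFreq α N) (E : IntervalCollection) :
    ∑ i, |wave α N T (fold (E.b i)) - wave α N T (fold (E.a i))| ≤
      2 + 2 * (kernelFreq α N * T) := by
  calc ∑ i, |wave α N T (fold (E.b i)) - wave α N T (fold (E.a i))|
      ≤ ∑ i, (1 / T + kernelFreq α N) *
          |clamp T (2 * T) (fold (E.b i)) - clamp T (2 * T) (fold (E.a i))| :=
        Finset.sum_le_sum fun i _ => abs_wave_sub_le hT hN _ _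
    _ ≤ (1 / T + kernelFreq α N) * (2 * T) := by
        rw [← Finset.mul_sum]
        gcongr
        exact E.sum_abs_clamp_fold_sub_le hT₁ hT.le
    _ = 2 + 2 * (kernelFreq α N * T) := by field_simp

end FoldedWave

/-- The wave with `N = 2 ^ m` on the dyadic interval `[2 ^ k / 2 ^ m, 2 ^ (k + 1) / 2 ^ m]`,
extended to an even `2π`-periodic function. -/
def dyadicWave (α : ℝ) (m k : ℕ) (x : ℝ) : ℝ := wave α (2 ^ m) (2 ^ k / 2 ^ m) (fold x)

@[fun_prop]
lemma continuous_dyadicWave (α : ℝ) (m k : ℕ) : Continuous (dyadicWave α m k) := by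
  unfold dyadicWave
  fun_prop

lemma abs_dyadicWave_le (α : ℝ) (m k : ℕ) (x : ℝ) : |dyadicWave α m k x| ≤ 1 :=
  abs_wave_le (by positivity) α (2 ^ m) (fold x)

lemma IntervalCollection.sum_abs_dyadicWave_sub_le (E : IntervalCollection) {α : ℝ}
    (hα : α ∈ Ioo (0 : ℝ) 1) {m k : ℕ} (hk : 1 ≤ k) (hkm : k ≤ m) :
    ∑ i, |dyadicWave α m k (E.b i) - dyadicWave α m k (E.a i)| ≤ 2 * (2 ^ (k + 1) : ℕ) := by
  have htwo : (2 : ℝ) ≤ 2 ^ k := le_self_pow₀ one_le_two (by lia)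
  have hT₁ : (2 : ℝ) ^ k / 2 ^ m ≤ 1 :=
    div_le_one_of_le₀ (pow_le_pow_right₀ one_le_two hkm) (by positivity)
  have hfreq : kernelFreq α (2 ^ m) ≤ 2 ^ m + 1 := by
    rw [kernelFreq]
    push_cast
    linarith [hα.1]
  have hfreq₀ : 0 ≤ kernelFreq α (2 ^ m) := (Nat.cast_nonneg _).trans (kernelFreq_ge hα (2 ^ m))
  calc ∑ i, |dyadicWave α m k (E.b i) - dyadicWave α m k (E.a i)|
      ≤ 2 + 2 * (kernelFreq α (2 ^ m) * (2 ^ k / 2 ^ m)) :=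
        E.sum_abs_wave_fold_sub_le hT₁ (by positivity) hfreq₀
    _ ≤ 2 + 2 * ((2 ^ m + 1) * (2 ^ k / 2 ^ m)) := by gcongr
    _ = 2 + 2 * (2 ^ k + 2 ^ k / 2 ^ m) := by field_simp
    _ ≤ 2 * (2 ^ (k + 1) : ℕ) := by
        push_cast
        rw [pow_succ]
        linarith

lemma log_two_pow_succ_add_one_le {k : ℕ} (hk : 1 ≤ k) :
    Real.log ((2 ^ (k + 1) : ℕ) + 1) ≤ 3 * k := by
  have hk₁ : (1 : ℝ) ≤ k := by exact_mod_cast hk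
  have hle : ((2 ^ (k + 1) : ℕ) : ℝ) + 1 ≤ 2 ^ (k + 2) := by
    push_cast
    rw [pow_succ _ (k + 1)]
    linarith [one_le_pow₀ (one_le_two (α := ℝ)) (n := k + 1)]
  calc Real.log ((2 ^ (k + 1) : ℕ) + 1) ≤ Real.log (2 ^ (k + 2)) :=
        Real.log_le_log (by positivity) hle
    _ = (k + 2) * Real.log 2 := by rw [Real.log_pow]; push_cast; rfl
    _ ≤ (k + 2) * 1 := by gcongr; linarith [Real.log_two_lt_d9]
    _ ≤ 3 * k := by linarith

lemma exists_lambdaVar_dyadicWave_le {s : ℝ} (hs : s ∈ Ioo (0 : ℝ) 1) : ∃ C : ℝ,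
    ∀ α ∈ Ioo (0 : ℝ) 1, ∀ m k : ℕ, 1 ≤ k → k ≤ m →
      lambdaVar (powLogSeq s 1) (dyadicWave α m k) ≤
        ENNReal.ofReal (C * (k * ((2 : ℝ) ^ k) ^ s)) := by
  obtain ⟨C, hC, hbound⟩ := exists_lambdaVar_powLogSeq_le hs
  refine ⟨12 * C, fun α hα m k hk hkm => ?_⟩
  have hosc (x y : ℝ) : |dyadicWave α m k x - dyadicWave α m k y| ≤ 2 :=
    (abs_sub _ _).trans (by linarith [abs_dyadicWave_le α m k x, abs_dyadicWave_le α m k y])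
  refine (hbound _ 2 (2 ^ (k + 1)) Nat.one_le_two_pow zero_le_two hosc
    fun E => E.sum_abs_dyadicWave_sub_le hα hk hkm).trans (ENNReal.ofReal_le_ofReal ?_)
  have hpow : ((2 ^ (k + 1) : ℕ) : ℝ) ^ s ≤ 2 * ((2 : ℝ) ^ k) ^ s := by
    push_cast
    rw [pow_succ, Real.mul_rpow (by positivity) zero_le_two, mul_comm]
    gcongr
    exact Real.rpow_le_self_of_one_le one_le_two hs.2.le
  calc C * (2 * (Real.log ((2 ^ (k + 1) : ℕ) + 1) * ((2 ^ (k + 1) : ℕ) : ℝ) ^ s))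
      ≤ C * (2 * (3 * k * (2 * ((2 : ℝ) ^ k) ^ s))) := by
        gcongr
        exact log_two_pow_succ_add_one_le hk
    _ = 12 * C * (k * ((2 : ℝ) ^ k) ^ s) := by ring

/-! ### Superpositions of waves -/

/-- The coefficient of the `k`-th product wave in `waveSum`: small enough for the variation to stay
bounded, yet contributing a term of the harmonic series to the Cesàro mean at the origin. -/
def waveCoeff (s : ℝ) (k : ℕ) : ℝ := 1 / (k * ((2 : ℝ) ^ k) ^ s)

/-- The superposition of the product waves on the dyadic squares
`[2 ^ k / 2 ^ m, 2 ^ (k + 1) / 2 ^ m]²`, `k₁ ≤ k ≤ m`. -/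
def waveSum (α β : ℝ) (k₁ m : ℕ) (q : ℝ × ℝ) : ℝ :=
  ∑ k ∈ Finset.Ico k₁ (m + 1),
    waveCoeff (α + β) k * (dyadicWave α m k q.1 * dyadicWave β m k q.2)

lemma waveCoeff_nonneg (s : ℝ) (k : ℕ) : 0 ≤ waveCoeff s k := by unfold waveCoeff; positivity

lemma waveCoeff_le_one {s : ℝ} (hs : 0 ≤ s) (k : ℕ) : waveCoeff s k ≤ 1 := by
  rcases k.eq_zero_or_pos with rfl | hk
  · simp [waveCoeff]
  · have hk₁ : (1 : ℝ) ≤ k := by exact_mod_cast hk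
    have hpow : (1 : ℝ) ≤ ((2 : ℝ) ^ k) ^ s := Real.one_le_rpow (one_le_pow₀ one_le_two) hs
    exact div_le_one_of_le₀ (one_le_mul_of_one_le_of_one_le hk₁ hpow) (by positivity)

lemma continuous_waveSum (α β : ℝ) (k₁ m : ℕ) : Continuous (waveSum α β k₁ m) := by
  unfold waveSum
  fun_prop

lemma isBiperiodic_waveSum (α β : ℝ) (k₁ m : ℕ) : IsBiperiodic (waveSum α β k₁ m) := fun x y => by
  simp only [waveSum, dyadicWave, fold_add_two_pi, and_self]

lemma waveSum_swap (α β : ℝ) (k₁ m : ℕ) (x y : ℝ) :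
    waveSum α β k₁ m (x, y) = waveSum β α k₁ m (y, x) := by
  simp only [waveSum, add_comm α β, mul_comm (dyadicWave α m _ x)]

lemma mem_Ioo_of_dyadicWave_ne_zero {α : ℝ} {m k : ℕ} {x : ℝ} (h : dyadicWave α m k x ≠ 0) :
    fold x ∈ Ioo ((2 : ℝ) ^ k / 2 ^ m) (2 * (2 ^ k / 2 ^ m)) :=
  ⟨lt_of_not_ge fun hle => h (wave_of_le _ _ hle),
    lt_of_not_ge fun hle => h (wave_of_ge _ _ (by positivity) hle)⟩

lemma eq_of_dyadicWave_ne_zero {α : ℝ} {m k l : ℕ} {x : ℝ} (hk : dyadicWave α m k x ≠ 0)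
    (hl : dyadicWave α m l x ≠ 0) : k = l := by
  have hle (i j : ℕ) (hi : dyadicWave α m i x ≠ 0) (hj : dyadicWave α m j x ≠ 0) : i ≤ j := by
    have hlt := (mem_Ioo_of_dyadicWave_ne_zero hi).1.trans (mem_Ioo_of_dyadicWave_ne_zero hj).2
    rw [← mul_div_assoc, div_lt_div_iff_of_pos_right (by positivity), ← pow_succ'] at hlt
    exact Nat.lt_succ_iff.1 ((pow_lt_pow_iff_right₀ one_lt_two).1 hlt)
  exact le_antisymm (hle k l hk hl) (hle l k hl hk)

-- The waves at different scales have disjoint supports, so only one survives on a line.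
lemma exists_waveSum_eq (α β : ℝ) (k₁ m : ℕ) (y : ℝ) : (∀ x, waveSum α β k₁ m (x, y) = 0) ∨
    ∃ k ∈ Finset.Ico k₁ (m + 1), ∃ c, |c| ≤ 1 ∧
      ∀ x, waveSum α β k₁ m (x, y) = waveCoeff (α + β) k * c * dyadicWave α m k x := by
  by_cases h : ∃ k ∈ Finset.Ico k₁ (m + 1), dyadicWave β m k y ≠ 0
  · obtain ⟨k, hk, hky⟩ := h
    refine Or.inr ⟨k, hk, dyadicWave β m k y, abs_dyadicWave_le β m k y, fun x => ?_⟩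
    rw [waveSum, Finset.sum_eq_single_of_mem k hk fun l _ hlk => ?_, mul_right_comm, mul_assoc]
    rw [not_ne_iff.1 (mt (eq_of_dyadicWave_ne_zero hky) hlk.symm), mul_zero, mul_zero]
  · push Not at h
    exact Or.inl fun x => Finset.sum_eq_zero fun k hk => by rw [h k hk, mul_zero, mul_zero]

lemma abs_waveSum_le {α β : ℝ} (hαβ : 0 ≤ α + β) (k₁ m : ℕ) (q : ℝ × ℝ) :
    |waveSum α β k₁ m q| ≤ 1 := by
  rcases exists_waveSum_eq α β k₁ m q.2 with h | ⟨k, -, c, hc, h⟩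
  · rw [h, abs_zero]
    exact zero_le_one
  · rw [h, abs_mul, abs_mul, abs_of_nonneg (waveCoeff_nonneg _ _)]
    exact mul_le_one₀ (mul_le_one₀ (waveCoeff_le_one hαβ k) (abs_nonneg _) hc) (abs_nonneg _)
      (abs_dyadicWave_le α m k _)

lemma exists_lambdaVar_waveSum_le {s : ℝ} (hs : s ∈ Ioo (0 : ℝ) 1) : ∃ V : ℝ,
    ∀ α ∈ Ioo (0 : ℝ) 1, ∀ β, α + β = s → ∀ k₁ m : ℕ, 1 ≤ k₁ → ∀ y : ℝ,
      lambdaVar (powLogSeq s 1) (fun x => waveSum α β k₁ m (x, y)) ≤ ENNReal.ofReal V := by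
  obtain ⟨C, hC⟩ := exists_lambdaVar_dyadicWave_le hs
  refine ⟨C, fun α hα β hαβ k₁ m hk₁ y => ?_⟩
  rcases exists_waveSum_eq α β k₁ m y with h | ⟨k, hk, c, hc, h⟩
  · simp only [lambdaVar, h, sub_self, abs_zero, zero_div, ENNReal.ofReal_zero,
      Finset.sum_const_zero, ENNReal.iSup_zero, zero_le]
  · obtain ⟨hk, hkm⟩ := Finset.mem_Ico.1 hk
    have hk₀ : (0 : ℝ) < k := by exact_mod_cast hk₁.trans hk
    simp only [h, hαβ]
    calc _ ≤ ENNReal.ofReal |waveCoeff s k * c| * lambdaVar (powLogSeq s 1) (dyadicWave α m k) :=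
          lambdaVar_const_mul_le _ _ _
      _ ≤ ENNReal.ofReal (waveCoeff s k) * ENNReal.ofReal (C * (k * ((2 : ℝ) ^ k) ^ s)) := by
          gcongr
          · rw [abs_mul, abs_of_nonneg (waveCoeff_nonneg _ _)]
            exact mul_le_of_le_one_right (waveCoeff_nonneg _ _) hc
          · exact hC α hα m k (hk₁.trans hk) (Nat.lt_succ_iff.1 hkm)
      _ = ENNReal.ofReal C := by
          rw [← ENNReal.ofReal_mul (waveCoeff_nonneg _ _), waveCoeff]
          congr 1
          field_simp

lemma dyadicWave_dir (α : ℝ) (m k : ℕ) (e : Bool) {t : ℝ} (ht : t ∈ Icc 0 π) :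
    dyadicWave α m k (dir e 0 t) = wave α (2 ^ m) (2 ^ k / 2 ^ m) t := by
  have hfold : fold (dir e 0 t) = t := by
    cases e <;> simp [dir, fold_neg, fold_of_mem_Icc ht]
  rw [dyadicWave, hfold]

/-- The Cesàro mean at the origin of a single wave, up to the factor `2 / π`. -/
def waveMean (α : ℝ) (m k : ℕ) : ℝ :=
  ∫ t in 0..π, wave α (2 ^ m) (2 ^ k / 2 ^ m) t * cesaroKernel (-α) (2 ^ m) t

lemma integral_dyadicWave_dir_mul (α : ℝ) (m k : ℕ) (e : Bool) :
    ∫ t in 0..π, dyadicWave α m k (dir e 0 t) * cesaroKernel (-α) (2 ^ m) t = waveMean α m k :=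
  intervalIntegral.integral_congr fun t ht => by
    rw [uIcc_of_le Real.pi_pos.le] at ht
    simp only [dyadicWave_dir α m k e ht]

lemma integral_integral_waveSum_dir (α β : ℝ) (k₁ m : ℕ) (e e' : Bool) :
    ∫ t in 0..π, (∫ s in 0..π, waveSum α β k₁ m (dir e 0 t, dir e' 0 s) *
        cesaroKernel (-β) (2 ^ m) s) * cesaroKernel (-α) (2 ^ m) t =
      ∑ k ∈ Finset.Ico k₁ (m + 1),
        waveCoeff (α + β) k * (waveMean α m k * waveMean β m k) := by
  have : Continuous (dir e 0) := continuous_dir e 0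
  have : Continuous (dir e' 0) := continuous_dir e' 0
  have hinner (t : ℝ) : ∫ s in 0..π, waveSum α β k₁ m (dir e 0 t, dir e' 0 s) *
      cesaroKernel (-β) (2 ^ m) s = ∑ k ∈ Finset.Ico k₁ (m + 1),
        waveCoeff (α + β) k * waveMean β m k * dyadicWave α m k (dir e 0 t) := by
    simp only [waveSum, Finset.sum_mul]
    rw [intervalIntegral.integral_finsetSum fun k _ =>
      Continuous.intervalIntegrable (by fun_prop) _ _]
    refine Finset.sum_congr rfl fun k _ => ?_
    simp only [← integral_dyadicWave_dir_mul β m k e', mul_assoc,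
      intervalIntegral.integral_const_mul]
    ring
  simp only [hinner, Finset.sum_mul]
  rw [intervalIntegral.integral_finsetSum fun k _ =>
    Continuous.intervalIntegrable (by fun_prop) _ _]
  refine Finset.sum_congr rfl fun k _ => ?_
  simp only [mul_assoc, intervalIntegral.integral_const_mul, integral_dyadicWave_dir_mul]
  ring

lemma cesaroMean_waveSum (α β : ℝ) (k₁ m : ℕ) :
    cesaroMean (-α) (-β) (waveSum α β k₁ m) (2 ^ m) (2 ^ m) (0, 0) =
      (4 / π ^ 2 * ∑ k ∈ Finset.Ico k₁ (m + 1),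
        waveCoeff (α + β) k * (waveMean α m k * waveMean β m k) : ℝ) := by
  rw [(isBiperiodic_waveSum α β k₁ m).cesaroMean_eq_sum_quadrants
    ((continuous_waveSum α β k₁ m).continuousOn.integrableOn_compact isCompact_square)]
  simp only [integral_integral_waveSum_dir, Fintype.sum_bool]
  congr 1
  ring

lemma exists_waveMean_ge {α : ℝ} (hα : α ∈ Ioo (0 : ℝ) 1) :
    ∃ k₁ : ℕ, ∀ k m : ℕ, k₁ ≤ k → k ≤ m → ((2 : ℝ) ^ k) ^ α / 192 ≤ waveMean α m k := by
  obtain ⟨R, hR⟩ := exists_integral_wave_ge hα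
  obtain ⟨k₁, hk₁⟩ := pow_unbounded_of_one_lt R one_lt_two
  refine ⟨k₁, fun k m hk hkm => ?_⟩
  have hNT : ((2 ^ m : ℕ) : ℝ) * (2 ^ k / 2 ^ m) = 2 ^ k := by push_cast; field_simp
  have hT : (2 : ℝ) ^ k / 2 ^ m ≤ 1 :=
    div_le_one_of_le₀ (pow_le_pow_right₀ one_le_two hkm) (by positivity)
  have h := hR (2 ^ m) (2 ^ k / 2 ^ m) (by positivity) (by linarith [Real.two_le_pi])
  rw [hNT] at h
  exact h (hk₁.le.trans (pow_le_pow_right₀ one_le_two hk))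

lemma tendsto_sum_Ico_one_div_atTop (k₀ : ℕ) :
    Tendsto (fun m : ℕ => ∑ k ∈ Finset.Ico k₀ m, (1 : ℝ) / k) atTop atTop := by
  have hharmonic : Tendsto (fun m : ℕ => ∑ k ∈ Finset.range m, (1 : ℝ) / k) atTop atTop :=
    (not_summable_iff_tendsto_nat_atTop_of_nonneg fun k => by positivity).1
      Real.not_summable_one_div_natCast
  refine (tendsto_atTop_add_const_right _ (-∑ k ∈ Finset.range k₀, (1 : ℝ) / k) hharmonic).congr'
    ?_
  filter_upwards [eventually_ge_atTop k₀] with m hm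
  rw [Finset.sum_Ico_eq_sub _ hm, sub_eq_add_neg]

lemma exists_cesaroMean_waveSum_gt {α β : ℝ} (hα : α ∈ Ioo (0 : ℝ) 1) (hβ : β ∈ Ioo (0 : ℝ) 1) :
    ∃ k₁ : ℕ, 1 ≤ k₁ ∧ ∀ C : ℝ, ∃ m,
      C < ‖cesaroMean (-α) (-β) (waveSum α β k₁ m) (2 ^ m) (2 ^ m) (0, 0)‖ := by
  obtain ⟨k₁, hk₁⟩ := exists_waveMean_ge hα
  obtain ⟨k₂, hk₂⟩ := exists_waveMean_ge hβ
  set k₀ := max 1 (max k₁ k₂)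
  refine ⟨k₀, le_max_left _ _, fun C => ?_⟩
  have hterm (m k : ℕ) (hk : k ∈ Finset.Ico k₀ (m + 1)) : 1 / 192 ^ 2 * (1 / (k : ℝ)) ≤
      waveCoeff (α + β) k * (waveMean α m k * waveMean β m k) := by
    have hk := Finset.mem_Ico.1 hk
    have hα_le := hk₁ k m (by lia) (by lia)
    have hβ_le := hk₂ k m (by lia) (by lia)
    calc 1 / 192 ^ 2 * (1 / (k : ℝ)) = waveCoeff (α + β) k *
          (((2 : ℝ) ^ k) ^ α / 192 * (((2 : ℝ) ^ k) ^ β / 192)) := by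
          rw [waveCoeff, Real.rpow_add (by positivity)]
          field_simp
      _ ≤ waveCoeff (α + β) k * (waveMean α m k * waveMean β m k) :=
          mul_le_mul_of_nonneg_left (mul_le_mul hα_le hβ_le (by positivity)
            (hα_le.trans' (by positivity))) (waveCoeff_nonneg _ _)
  have hdiverge : Tendsto (fun m : ℕ => 4 / π ^ 2 * (1 / 192 ^ 2 *
      ∑ k ∈ Finset.Ico k₀ (m + 1), (1 : ℝ) / k)) atTop atTop :=
    (((tendsto_sum_Ico_one_div_atTop k₀).comp (tendsto_add_atTop_nat 1)).const_mul_atTop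
      (by positivity)).const_mul_atTop (by positivity)
  obtain ⟨m, hm⟩ := (hdiverge.eventually_gt_atTop C).exists
  refine ⟨m, hm.trans_le ?_⟩
  rw [cesaroMean_waveSum, Complex.norm_real, Finset.mul_sum]
  refine le_trans ?_ (le_abs_self _)
  exact mul_le_mul_of_nonneg_left (Finset.sum_le_sum fun k hk => hterm m k hk) (by positivity)

/-! ### Condensation of singularities -/

section Superposition

variable {κ X : Type*} {g : κ → X → ℝ} (hg : ∀ m q, |g m q| ≤ 1)
  {c : κ → ℝ} (hc : Summable fun m => |c m|)
include hg

lemma abs_superposition_term_le (c : κ → ℝ) (m : κ) (q : X) : |c m * g m q| ≤ |c m| := by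
  rw [abs_mul]
  exact mul_le_of_le_one_right (abs_nonneg _) (hg m q)

include hc

lemma summable_superposition (q : X) : Summable fun m => c m * g m q :=
  Summable.of_norm_bounded hc fun m => abs_superposition_term_le hg c m q

lemma continuous_superposition [TopologicalSpace X] (hgc : ∀ m, Continuous (g m)) :
    Continuous fun q => ∑' m, c m * g m q :=
  continuous_tsum (fun m => (hgc m).const_mul _) hc fun m q => abs_superposition_term_le hg c m q

lemma integral_superposition [Countable κ] [MeasurableSpace X] {μ : Measure X}
    (hgm : ∀ m, AEStronglyMeasurable (g m) μ) {K : X → ℝ} (hK : Integrable K μ) :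
    ∫ q, (∑' m, c m * g m q) * K q ∂μ = ∑' m, c m * ∫ q, g m q * K q ∂μ := by
  have hint (m : κ) : Integrable (fun q => c m * (g m q * K q)) μ :=
    (hK.bdd_mul (hgm m) (Eventually.of_forall (hg m))).const_mul (c m)
  have hnorm (m : κ) : ∫ q, ‖c m * (g m q * K q)‖ ∂μ ≤ |c m| * ∫ q, |K q| ∂μ := by
    rw [← integral_const_mul]
    refine integral_mono (hint m).norm (hK.abs.const_mul _) fun q => ?_
    simp only [Real.norm_eq_abs, abs_mul]
    exact mul_le_mul_of_nonneg_left (mul_le_of_le_one_left (abs_nonneg _) (hg m q)) (abs_nonneg _)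
  have hsum : Summable fun m => ∫ q, ‖c m * (g m q * K q)‖ ∂μ :=
    .of_nonneg_of_le (fun m => by positivity) hnorm (hc.mul_right _)
  simp only [← integral_const_mul, ← tsum_mul_right, mul_assoc]
  exact (integral_tsum_of_summable_integral_norm hint hsum).symm

end Superposition

lemma memPLambdaBV_superposition {κ : Type*} {g : κ → ℝ × ℝ → ℝ} (hg : ∀ m q, |g m q| ≤ 1)
    {c : κ → ℝ} (hc : Summable fun m => |c m|)
    {lam : ℕ → ℝ} {V₁ V₂ : ℝ}
    (hV₁ : ∀ m y, lambdaVar lam (fun x => g m (x, y)) ≤ ENNReal.ofReal V₁)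
    (hV₂ : ∀ m x, lambdaVar lam (fun y => g m (x, y)) ≤ ENNReal.ofReal V₂) :
    MemPLambdaBV lam fun q => ∑' m, c m * g m q := by
  have hbound {u : ℝ → ℝ × ℝ} {V : ℝ}
      (hV : ∀ m, lambdaVar lam (fun t => g m (u t)) ≤ ENNReal.ofReal V) :
      lambdaVar lam (fun t => ∑' m, c m * g m (u t)) ≤
        (∑' m, ENNReal.ofReal |c m|) * ENNReal.ofReal V :=
    calc lambdaVar lam (fun t => ∑' m, c m * g m (u t))
        ≤ ∑' m, lambdaVar lam (fun t => c m * g m (u t)) :=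
          lambdaVar_tsum_le lam fun t => summable_superposition hg hc (u t)
      _ ≤ ∑' m, ENNReal.ofReal |c m| * ENNReal.ofReal V :=
          ENNReal.tsum_le_tsum fun m =>
            (lambdaVar_const_mul_le lam (c m) _).trans (mul_le_mul_right (hV m) _)
      _ = (∑' m, ENNReal.ofReal |c m|) * ENNReal.ofReal V := ENNReal.tsum_mul_right
  have hfinite (V : ℝ) : (∑' m, ENNReal.ofReal |c m|) * ENNReal.ofReal V < ∞ :=
    ENNReal.mul_lt_top hc.tsum_ofReal_lt_top ENNReal.ofReal_lt_top
  exact ENNReal.add_lt_top.2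
    ⟨(iSup₂_le fun y _ => hbound fun m => hV₁ m y).trans_lt (hfinite V₁),
      (iSup₂_le fun x _ => hbound fun m => hV₂ m x).trans_lt (hfinite V₂)⟩

lemma exists_forall_abs_le_of_forall_summable {ι κ : Type*} {A : ι → κ → ℝ}
    (hA : ∀ N, ∃ B, ∀ m, |A N m| ≤ B)
    (h : ∀ c : κ → ℝ, Summable (fun m => |c m|) → ∃ C, ∀ N, |∑' m, c m * A N m| ≤ C) :
    ∃ C, ∀ N m, |A N m| ≤ C := by
  classical
  have hmem (N : ι) : Memℓp (A N) ∞ := by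
    obtain ⟨B, hB⟩ := hA N
    exact memℓp_infty ⟨B, by rintro _ ⟨m, rfl⟩; exact hB m⟩
  let T (N : ι) : lp (fun _ : κ => ℝ) 1 →L[ℝ] ℝ :=
    lp.dualPairing ∞ 1 (K := 1) (fun _ => ContinuousLinearMap.mul ℝ ℝ)
      (fun _ => ContinuousLinearMap.opNorm_mul_le ℝ ℝ) ⟨A N, hmem N⟩
  have hT (N : ι) (c : lp (fun _ : κ => ℝ) 1) : T N c = ∑' m, c m * A N m :=
    tsum_congr fun m => mul_comm _ _
  obtain ⟨C, hC⟩ := banach_steinhaus (g := T) fun c => by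
    obtain ⟨C, hC⟩ := h c (by simpa using (lp.hasSum_norm (p := 1) (by simp) c).summable)
    exact ⟨C, fun N => by simpa only [hT, Real.norm_eq_abs] using hC N⟩
  refine ⟨C, fun N m => ?_⟩
  have hsingle : T N (lp.single 1 m 1) = A N m := by
    rw [hT, tsum_eq_single m fun l hl => by simp [hl]]
    simp
  have hle := (T N).le_of_opNorm_le (hC N) (lp.single 1 m 1)
  rwa [hsingle, lp.norm_single (by simp), norm_one, mul_one] at hle

lemma exists_superposition_integral_gt {ι κ X : Type*} [Countable κ] [MeasurableSpace X]
    {μ : Measure X} {g : κ → X → ℝ} (hgm : ∀ m, AEStronglyMeasurable (g m) μ)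
    (hg : ∀ m q, |g m q| ≤ 1) {K : ι → X → ℝ} (hK : ∀ N, Integrable (K N) μ)
    (hunbounded : ∀ C, ∃ N m, C < |∫ q, g m q * K N q ∂μ|) :
    ∃ c : κ → ℝ, Summable (fun m => |c m|) ∧
      ∀ C, ∃ N, C < |∫ q, (∑' m, c m * g m q) * K N q ∂μ| := by
  by_contra! hcon
  have hrow (N : ι) : ∃ B, ∀ m, |∫ q, g m q * K N q ∂μ| ≤ B := by
    refine ⟨∫ q, |K N q| ∂μ, fun m => ?_⟩
    rw [← Real.norm_eq_abs]
    refine norm_integral_le_of_norm_le (hK N).abs (Eventually.of_forall fun q => ?_)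
    rw [Real.norm_eq_abs, abs_mul]
    exact mul_le_of_le_one_left (abs_nonneg _) (hg m q)
  obtain ⟨C, hC⟩ := exists_forall_abs_le_of_forall_summable hrow fun c hc =>
    (hcon c hc).imp fun C hC N => by
      simpa only [integral_superposition hg hc hgm (hK N)] using hC N
  obtain ⟨N, m, hNm⟩ := hunbounded C
  exact (hC N m).not_gt hNm

lemma norm_cesaroMean_eq {f : ℝ × ℝ → ℝ} (hf : IntegrableOn f square) (a b : ℝ) (n m : ℕ)
    (p : ℝ × ℝ) : ‖cesaroMean a b f n m p‖ = 1 / π ^ 2 *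
      |∫ q in square, f q * (cesaroKernel a n (p.1 - q.1) * cesaroKernel b m (p.2 - q.2))| := by
  rw [cesaroMean_eq hf, Complex.norm_real, norm_mul, Real.norm_of_nonneg (by positivity),
    Real.norm_eq_abs]

lemma exists_superposition_cesaroMean_gt {κ ι : Type*} [Countable κ] {g : κ → ℝ × ℝ → ℝ}
    (hgc : ∀ m, Continuous (g m)) (hg : ∀ m q, |g m q| ≤ 1) (a b : ℝ) (p : ℝ × ℝ) (u v : ι → ℕ)
    (hunbounded : ∀ C : ℝ, ∃ N m, C < ‖cesaroMean a b (g m) (u N) (v N) p‖) :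
    ∃ c : κ → ℝ, Summable (fun m => |c m|) ∧
      ∀ C, ∃ N, C < ‖cesaroMean a b (fun q => ∑' m, c m * g m q) (u N) (v N) p‖ := by
  have hintegrable {h : ℝ × ℝ → ℝ} (hh : Continuous h) : IntegrableOn h square :=
    hh.continuousOn.integrableOn_compact isCompact_square
  have hscale {C J : ℝ} : C < 1 / π ^ 2 * J ↔ π ^ 2 * C < J := by
    rw [one_div_mul_eq_div, lt_div_iff₀' (by positivity)]
  obtain ⟨c, hc, hbig⟩ := exists_superposition_integral_gt (ι := ι) (μ := volume.restrict square)
    (fun m => (hgc m).aestronglyMeasurable) hg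
    (K := fun N q => cesaroKernel a (u N) (p.1 - q.1) * cesaroKernel b (v N) (p.2 - q.2))
    (fun N => hintegrable (by fun_prop)) fun C => by
      obtain ⟨N, m, hNm⟩ := hunbounded (1 / π ^ 2 * C)
      rw [norm_cesaroMean_eq (hintegrable (hgc m))] at hNm
      exact ⟨N, m, lt_of_mul_lt_mul_left hNm (by positivity)⟩
  refine ⟨c, hc, fun C => ?_⟩
  simp only [norm_cesaroMean_eq (hintegrable (continuous_superposition hg hc hgc)), hscale]
  exact hbig (π ^ 2 * C)

theorem exists_continuous_divergent {α β : ℝ} (hα : α ∈ Ioo (0 : ℝ) 1) (hβ : β ∈ Ioo (0 : ℝ) 1)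
    (hαβ : α + β < 1) : ∃ f : ℝ × ℝ → ℝ, IsBiperiodic f ∧ Continuous f ∧
      MemPLambdaBV (powLogSeq (α + β) 1) f ∧
      ¬ ∃ L : ℂ, Tendsto (fun N : ℕ => cesaroMean (-α) (-β) f N N (0, 0)) atTop (𝓝 L) := by
  obtain ⟨k₁, hk₁, hbig⟩ := exists_cesaroMean_waveSum_gt hα hβ
  obtain ⟨V, hV⟩ := exists_lambdaVar_waveSum_le ⟨add_pos hα.1 hβ.1, hαβ⟩
  have hbound := abs_waveSum_le (add_pos hα.1 hβ.1).le k₁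
  have hcont := continuous_waveSum α β k₁
  obtain ⟨c, hc, hunbounded⟩ := exists_superposition_cesaroMean_gt hcont hbound (-α) (-β) (0, 0)
    id id fun C => (hbig C).imp' (2 ^ ·) fun m hm => ⟨m, hm⟩
  refine ⟨fun q => ∑' m, c m * waveSum α β k₁ m q, fun x y => ?_,
    continuous_superposition hbound hc hcont, memPLambdaBV_superposition hbound hc
      (V₂ := V) (fun m => hV α hα β rfl k₁ m hk₁) fun m x => ?_, fun ⟨L, hL⟩ => ?_⟩
  · simp only [(isBiperiodic_waveSum α β k₁ _ x y).1, (isBiperiodic_waveSum α β k₁ _ x y).2,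
      and_self]
  · simp only [waveSum_swap α β]
    exact hV β hβ α (add_comm β α) k₁ m hk₁ x
  · obtain ⟨C, hC⟩ := (Metric.isBounded_range_of_tendsto _ hL).exists_norm_le
    obtain ⟨N, hN⟩ := hunbounded C
    exact (hC _ (mem_range_self N)).not_gt hN

end CesaroNeg

end

theorem corollary1 (α β : ℝ) (hα : α ∈ Ioo (0 : ℝ) 1) (hβ : β ∈ Ioo (0 : ℝ) 1)
    (hαβ : α + β < 1) :
    (∀ (ε : ℝ) (_ : 0 < ε) (f : ℝ × ℝ → ℝ) (_ : CesaroNeg.IsBiperiodic f)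
        (_ : IntegrableOn f CesaroNeg.square volume)
        (_ : CesaroNeg.MemPLambdaBV
          (fun n : ℕ => (n : ℝ) ^ (1 - (α + β)) / Real.log ((n : ℝ) + 1) ^ (1 + ε)) f),
      (∀ x y pp pm mp mm : ℝ, CesaroNeg.HasQuadrantLimits f x y pp pm mp mm →
        Tendsto (fun N : ℕ × ℕ => CesaroNeg.cesaroMean (-α) (-β) f N.1 N.2 (x, y))
          (atTop ×ˢ atTop) (𝓝 (((1 / 4 : ℝ) * (pp + pm + mp + mm) : ℝ) : ℂ))) ∧
      (∀ K : Set (ℝ × ℝ), IsCompact K → (∀ p ∈ K, ContinuousAt f p) →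
        TendstoUniformlyOn
          (fun (N : ℕ × ℕ) (p : ℝ × ℝ) => CesaroNeg.cesaroMean (-α) (-β) f N.1 N.2 p)
          (fun p => (f p : ℂ)) (atTop ×ˢ atTop) K)) ∧
    (∃ f : ℝ × ℝ → ℝ, CesaroNeg.IsBiperiodic f ∧ Continuous f ∧
      CesaroNeg.MemPLambdaBV
        (fun n : ℕ => (n : ℝ) ^ (1 - (α + β)) / Real.log ((n : ℝ) + 1)) f ∧
      ¬ ∃ L : ℂ, Tendsto (fun N : ℕ => CesaroNeg.cesaroMean (-α) (-β) f N N (0, 0))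
        atTop (𝓝 L)) := by
  have hseq : CesaroNeg.powLogSeq (α + β) 1 =
      fun n : ℕ => (n : ℝ) ^ (1 - (α + β)) / Real.log ((n : ℝ) + 1) := by
    funext n
    rw [CesaroNeg.powLogSeq, Real.rpow_one]
  refine ⟨fun ε hε f hf hfi hfv => ⟨fun x y pp pm mp mm h => ?_, fun K hK hc => ?_⟩, ?_⟩
  · exact CesaroNeg.tendsto_cesaroMean hα hβ hαβ (by linarith) hf hfi hfv h
  · exact CesaroNeg.tendstoUniformlyOn_cesaroMean hα hβ hαβ (by linarith) hf hfi hfv hK hc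
  · rw [← hseq]
    exact CesaroNeg.exists_continuous_divergent hα hβ hαβ
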